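/- **Proposition 3.1.** Let $p$ be a prime, let $R$ be a smooth $\mathbb Z$-algebra and let $\square:\mathbb Z[T_1,\ldots,T_d]\to R$ be an étale map (a framing). *Notation.* Let $\mathbb Z[[q-1]]$ and $R[[q-1]]$ be the power series rings in $q-1$. For $1\le i\le d$ let $\gamma_i$ be the unique $\mathbb Z[[q-1]]$-automorphism of $R[[q-1]]$ that is the identity modulo $q-1$, sends $T_i$ to $qT_i$, and fixes $T_j$ for $j\ne i$. Then $\gamma_i(f)-f$ is uniquely divisible by $qT_i-T_i$; put $\nabla_{q,i}(f)=\frac{\gamma_i(f)-f}{qT_i-T_i}$. As $\Omega^n_{R/\mathbb Z}$ is free over $R$ on the forms $dT_I$, $|I|=n$, the $q$-de Rham complex $$q\text{-}\Omega_R^\square:\quad R[[q-1]]\xrightarrow{\nabla_q}\Omega^1_{R/\mathbb Z}[[q-1]]\xrightarrow{\nabla_q}\cdots\xrightarrow{\nabla_q}\Omega^d_{R/\mathbb Z}[[q-1]]$$ is defined by $\nabla_q(f\,dT_I)=\sum_{i=1}^d\nabla_{q,i}(f)\,dT_i\wedge dT_I$. It is a complex of $\mathbb Z[[q-1]]$-modules,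 and a differential graded algebra for the product $(f\,dT_I)(g\,dT_J)=f\,\gamma_I(g)\,dT_I\wedge dT_J$, where $\gamma_I=\prod_{i\in I}\gamma_i$. This product induces the cup product on the cohomology of its reductions. Let $\Phi_p(q)=1+q+\cdots+q^{p-1}$, let $\hat R$ be the $p$-adic completion of $R$, and let $\hat R[\zeta_p]=\hat R[x]/\Phi_p(x)$, with $\zeta_p$ the class of $x$. There is a unique ring endomorphism $\varphi$ of $\hat R$ that lifts the Frobenius of $\hat R/p$ and satisfies $\varphi(T_i)=T_i^p$ for all $i$; extend it to $\hat R[\zeta_p]$ by $\varphi(\zeta_p)=\zeta_p$. There is a unique isomorphism of $R$-algebras $\hat R[\zeta_p]\cong R[[q-1]]/\Phi_p(q)$ that sends $\zeta_p$ to $q$; these two rings are identified by it below. *Statement.* (i) The image of $\varphi:\hat R[\zeta_p]\to\hat R[\zeta_p]=R[[q-1]]/\Phi_p(q)$ lies in the kernel of $\nabla_q: R[[q-1]]/\Phi_p(q)\to\Omega^1_{R/\mathbb Z}[[q-1]]/\Phi_p(q)$, and $\varphi$ induces a ring isomorphism $\hat R[\zeta_p]\cong H^0(q\text{-}\Omega_R^\square/\Phi_p(q))$.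 Through it and the cup product, the groups $H^i(q\text{-}\Omega_R^\square/\Phi_p(q))$ are regarded as $\hat R[\zeta_p]$-modules. (ii) The boundary map $\partial:H^0(q\text{-}\Omega_R^\square/\Phi_p(q))\to H^1(q\text{-}\Omega_R^\square/\Phi_p(q))$ of the short exact sequence of complexes $$0\to q\text{-}\Omega_R^\square/\Phi_p(q)\xrightarrow{\ \Phi_p(q)\ }q\text{-}\Omega_R^\square/\Phi_p(q)^2\to q\text{-}\Omega_R^\square/\Phi_p(q)\to0$$ is, via (i), a derivation of $\hat R[\zeta_p]$ that is $\mathbb Z_p[\zeta_p]$-linear and continuous for the $p$-adic topologies. The induced $\hat R[\zeta_p]$-linear map $$\Omega^1_{R/\mathbb Z}\otimes_R\hat R[\zeta_p]\to H^1(q\text{-}\Omega_R^\square/\Phi_p(q)),\qquad dr\otimes1\mapsto\partial(\varphi(r))\quad(r\in R),$$ is well defined and an isomorphism. (iii) For every $i\ge0$, cup product of the classes in (ii) induces an isomorphism of $\hat R[\zeta_p]$-modules $$\Omega^i_{R/\mathbb Z}\otimes_R\hat R[\zeta_p]\cong H^i(q\text{-}\Omega_R^\square/\Phi_p(q)),$$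 which sends $(\omega_1\wedge\cdots\wedge\omega_i)\otimes1$ to the cup product of the images of $\omega_1\otimes1,\ldots,\omega_i\otimes1$ under the isomorphism of (ii). -/

import Mathlib

open scoped TensorProduct PowerSeries

namespace QDeRham

/-- The operators out of which a `q`-de Rham complex in coordinates is built, on an `S`-algebra `B`:
`d` commuting `S`-algebra endomorphisms `γ i` and `d` commuting `S`-linear operators `del i` that
satisfy the twisted Leibniz rule `∂ᵢ(f g) = ∂ᵢ(f) γᵢ(g) + f ∂ᵢ(g)`. (The instance used below is
`∂ᵢ f = (γᵢ f - f) / (q Tᵢ - Tᵢ)` on `R[[q-1]]` and its quotients.) -/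
structure TwistedDerivations (S B : Type*) [CommRing S] [CommRing B] [Algebra S B] (d : ℕ) where
  γ : Fin d → B →ₐ[S] B
  del : Fin d → B →ₗ[S] B
  del_mul : ∀ i f g, del i (f * g) = del i f * γ i g + f * del i g
  γ_comm : ∀ i j f, γ i (γ j f) = γ j (γ i f)
  γ_del : ∀ i j, i ≠ j → ∀ f, γ j (del i f) = del i (γ j f)
  del_comm : ∀ i j f, del i (del j f) = del j (del i f)

theorem sum_sum_eq_zero_of_antisymm {M : Type*} [AddCommGroup M] {d : ℕ} (F : Fin d → Fin d → M)
    (h0 : ∀ i, F i i = 0) (h : ∀ i j, F i j + F j i = 0) : ∑ i, ∑ j, F i j = 0 := by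
  rw [← Finset.sum_product']
  refine Finset.sum_involution (fun a _ => a.swap) ?_ ?_ ?_ ?_
  · rintro ⟨i, j⟩ _; exact h i j
  · rintro ⟨i, j⟩ _ hne heq
    simp only [Prod.swap_prod_mk, Prod.mk.injEq] at heq
    apply hne; rw [heq.1]; exact h0 _
  · intros; simp
  · intros; simp

/-- The exterior algebra over `ℤ` on symbols `dT₁, …, dT_d`. -/
abbrev FormAlgebra (d : ℕ) : Type := ExteriorAlgebra ℤ (Fin d → ℤ)

namespace FormAlgebra
/-- The symbol `dT_i`. -/
noncomputable def dT {d : ℕ} (i : Fin d) : FormAlgebra d := ExteriorAlgebra.ι ℤ (Pi.single i 1)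

theorem dT_mul_self {d : ℕ} (i : Fin d) : dT i * dT i = 0 := ExteriorAlgebra.ι_sq_zero _

theorem dT_anticomm {d : ℕ} (i j : Fin d) : dT i * dT j + dT j * dT i = 0 :=
  ExteriorAlgebra.ι_add_mul_swap _ _

theorem ι_eq_sum {d : ℕ} (v : Fin d → ℤ) : ExteriorAlgebra.ι ℤ v = ∑ i, v i • dT i := by
  have h : v = ∑ i, v i • (Pi.single i 1 : Fin d → ℤ) := by
    ext j; simp [Finset.sum_apply, Pi.single_apply]
  conv_lhs => rw [h]
  rw [map_sum]
  exact Finset.sum_congr rfl fun i _ => map_zsmul _ _ _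

/-- The grade involution `ω ↦ (-1)^{deg ω} ω`. -/
noncomputable def sgn (d : ℕ) : FormAlgebra d →ₐ[ℤ] FormAlgebra d :=
  ExteriorAlgebra.map (-LinearMap.id)

@[simp] theorem sgn_dT {d : ℕ} (i : Fin d) : sgn d (dT i) = -dT i := by
  simp [sgn, dT]

theorem induction {d : ℕ} {C : FormAlgebra d → Prop} (one : C 1) (gen : ∀ i, C (dT i))
    (add : ∀ a b, C a → C b → C (a + b)) (neg : ∀ a, C a → C (-a))
    (mul : ∀ a b, C a → C b → C (a * b)) (a : FormAlgebra d) : C a := by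
  have zero : C 0 := by simpa using add _ _ one (neg _ one)
  have zs : ∀ (n : ℤ) x, C x → C (n • x) := by
    intro n x hx
    induction n with
    | zero => simpa using zero
    | succ n ih => rw [add_smul, one_smul]; exact add _ _ ih hx
    | pred n ih => rw [sub_smul, one_smul, sub_eq_add_neg]; exact add _ _ ih (neg _ hx)
  induction a using ExteriorAlgebra.induction with
  | algebraMap r => rw [Algebra.algebraMap_eq_smul_one]; exact zs _ _ one
  | ι x =>
    rw [ι_eq_sum]
    exact Finset.sum_induction _ C (fun a b => add a b) zero (fun i _ => zs _ _ (gen i))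
  | mul a b ha hb => exact mul _ _ ha hb
  | add a b ha hb => exact add _ _ ha hb
end FormAlgebra

namespace TwistedDerivations
variable {S B : Type*} [CommRing S] [CommRing B] [Algebra S B] {d : ℕ}

/-- The total cochain module `⨁ₙ ⨁_{|I| = n} B dT_I = B ⊗_ℤ Λ(dT₁, …, dT_d)`. If `B` is an algebra over
an étale `ℤ[T₁, …, T_d]`-algebra `R`, its part of degree `n` is `B ⊗_R Ωⁿ_{R/ℤ}`, see
`baseChangeFormsEquiv`. -/
def Forms (_q : TwistedDerivations S B d) : Type _ := B ⊗[ℤ] FormAlgebra d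

variable (q : TwistedDerivations S B d)

noncomputable instance : AddCommGroup q.Forms := inferInstanceAs (AddCommGroup (B ⊗[ℤ] FormAlgebra d))
noncomputable instance : Module B q.Forms := inferInstanceAs (Module B (B ⊗[ℤ] FormAlgebra d))
noncomputable instance : Module S q.Forms := inferInstanceAs (Module S (B ⊗[ℤ] FormAlgebra d))
instance : IsScalarTower S B q.Forms := inferInstanceAs (IsScalarTower S B (B ⊗[ℤ] FormAlgebra d))

/-- The form `b ω`. -/
noncomputable def form (b : B) (ω : FormAlgebra d) : q.Forms := b ⊗ₜ[ℤ] ω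

open FormAlgebra

theorem form_add (b : B) (ω η : FormAlgebra d) : q.form b (ω + η) = q.form b ω + q.form b η :=
  TensorProduct.tmul_add _ _ _
theorem add_form (b c : B) (ω : FormAlgebra d) : q.form (b + c) ω = q.form b ω + q.form c ω :=
  TensorProduct.add_tmul _ _ _
theorem form_neg (b : B) (ω : FormAlgebra d) : q.form b (-ω) = - q.form b ω :=
  TensorProduct.tmul_neg _ _
theorem smul_form (c b : B) (ω : FormAlgebra d) : c • q.form b ω = q.form (c * b) ω := rfl

variable {q} in
@[elab_as_elim]
theorem form_induction {C : q.Forms → Prop} (x : q.Forms) (h0 : C 0)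
    (hf : ∀ b ω, C (q.form b ω)) (ha : ∀ x y, C x → C y → C (x + y)) : C x :=
  TensorProduct.induction_on (motive := C) x h0 hf ha

/-- The operator `f ω ↦ φ(f) dT_i ∧ ω`, for an `S`-linear `φ`. -/
noncomputable def wedge (i : Fin d) (φ : B →ₗ[S] B) : q.Forms →ₗ[S] q.Forms :=
  (TensorProduct.AlgebraTensorModule.map φ (LinearMap.mulLeft ℤ (dT i)) :
    B ⊗[ℤ] FormAlgebra d →ₗ[S] B ⊗[ℤ] FormAlgebra d)

@[simp] theorem wedge_form (i : Fin d) (φ : B →ₗ[S] B) (b : B) (ω : FormAlgebra d) :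
    q.wedge i φ (q.form b ω) = q.form (φ b) (dT i * ω) := rfl

theorem form_zero (b : B) : q.form b 0 = 0 := TensorProduct.tmul_zero _ _

theorem wedge_comp_self (i : Fin d) (φ ψ : B →ₗ[S] B) : q.wedge i φ ∘ₗ q.wedge i ψ = 0 := by
  refine LinearMap.ext fun x => ?_
  induction x using form_induction with
  | h0 => simp
  | hf b ω => simp [← mul_assoc, dT_mul_self, form_zero]
  | ha x y hx hy => rw [map_add, hx, hy]; simp

theorem wedge_comp_anticomm (i j : Fin d) (φ ψ φ' ψ' : B →ₗ[S] B)
    (h : ∀ b, φ (ψ b) = ψ' (φ' b)) :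
    q.wedge i φ ∘ₗ q.wedge j ψ + q.wedge j ψ' ∘ₗ q.wedge i φ' = 0 := by
  refine LinearMap.ext fun x => ?_
  induction x using form_induction with
  | h0 => simp
  | hf b ω => simp [← mul_assoc, h, ← form_add, ← add_mul, dT_anticomm, form_zero]
  | ha x y hx hy => rw [map_add, hx, hy]; simp

/-- Left multiplication by `dT_i`, namely `dT_i · (f ω) = γ_i(f) dT_i ∧ ω`. -/
noncomputable def mulDT (i : Fin d) : q.Forms →ₗ[S] q.Forms := q.wedge i (q.γ i).toLinearMap

/-- The differential `∇(f ω) = ∑ᵢ ∂ᵢ(f) dT_i ∧ ω`, on all degrees at once. -/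
noncomputable def D : q.Forms →ₗ[S] q.Forms := ∑ i, q.wedge i (q.del i)

theorem D_form (b : B) (ω : FormAlgebra d) :
    q.D (q.form b ω) = ∑ i, q.form (q.del i b) (dT i * ω) := by
  simp [D, LinearMap.sum_apply]

theorem D_D (x : q.Forms) : q.D (q.D x) = 0 := by
  have : q.D ∘ₗ q.D = 0 := by
    have h : q.D ∘ₗ q.D = ∑ i, ∑ j, q.wedge i (q.del i) ∘ₗ q.wedge j (q.del j) := by
      refine LinearMap.ext fun x => ?_
      simp [D, LinearMap.sum_apply, map_sum]
    rw [h]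
    apply sum_sum_eq_zero_of_antisymm
    · intro i; apply wedge_comp_self
    · intro i j; exact q.wedge_comp_anticomm i j _ _ _ _ (q.del_comm i j)
  exact LinearMap.congr_fun this x

/-- Left multiplication by `dT_{i₁} ⋯ dT_{iₙ}`, extended `ℤ`-linearly. -/
noncomputable def leftMul : FormAlgebra d →ₐ[ℤ] Module.End S q.Forms :=
  ExteriorAlgebra.lift ℤ ⟨Fintype.linearCombination ℤ (fun i => q.mulDT i), by
    intro v
    simp only [Fintype.linearCombination_apply, Finset.sum_mul_sum]
    apply sum_sum_eq_zero_of_antisymm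
    · intro i
      have := q.wedge_comp_self i (q.γ i).toLinearMap (q.γ i).toLinearMap
      rw [smul_mul_smul_comm]
      exact (congrArg _ this).trans (smul_zero _)
    · intro i j
      have := q.wedge_comp_anticomm i j (q.γ i).toLinearMap (q.γ j).toLinearMap
        (q.γ i).toLinearMap (q.γ j).toLinearMap (q.γ_comm i j)
      rw [smul_mul_smul_comm, smul_mul_smul_comm, mul_comm (v j), ← smul_add]
      exact (congrArg _ this).trans (smul_zero _)⟩

@[simp] theorem leftMul_dT (i : Fin d) : q.leftMul (dT i) = q.mulDT i := by
  simp [leftMul, dT, ExteriorAlgebra.lift_ι_apply, Fintype.linearCombination_apply_single]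

/-- The product of forms, `(f dT_I) (g dT_J) = f γ_I(g) dT_I ∧ dT_J`, where `γ_I` is the composite of
the `γ_i` for `i ∈ I`. With it the complex is a differential graded algebra, see `D_mul`; the Leibniz
rule in degree `0` is the asymmetric rule `∇(f g) = ∇(f) g + f ∇(g)` with `dT_i g = γ_i(g) dT_i`. -/
noncomputable def mulHom : q.Forms →ₗ[S] Module.End S q.Forms :=
  (TensorProduct.AlgebraTensorModule.lift
    { toFun := fun b =>
        { toFun := fun ω => b • q.leftMul ω
          map_add' := by intros; simp
          map_smul' := by
            intros; simp [smul_comm] }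
      map_add' := by intros; ext; simp [add_smul]
      map_smul' := by intros; ext; simp } : B ⊗[ℤ] FormAlgebra d →ₗ[S] Module.End S q.Forms)

noncomputable instance : Mul q.Forms := ⟨fun x y => q.mulHom x y⟩
noncomputable instance : One q.Forms := ⟨q.form 1 1⟩

theorem mul_def (x y : q.Forms) : x * y = q.mulHom x y := rfl
theorem one_def : (1 : q.Forms) = q.form 1 1 := rfl
theorem form_mul (b : B) (ω : FormAlgebra d) (y : q.Forms) :
    q.form b ω * y = b • q.leftMul ω y := rfl

@[simp] theorem mulDT_form (i : Fin d) (b : B) (ω : FormAlgebra d) :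
    q.mulDT i (q.form b ω) = q.form (q.γ i b) (dT i * ω) := rfl

theorem mulDT_smul (i : Fin d) (c : B) (x : q.Forms) :
    q.mulDT i (c • x) = q.γ i c • q.mulDT i x := by
  induction x using form_induction with
  | h0 => simp
  | hf b ω => simp [smul_form]
  | ha x y hx hy => simp [hx, hy]

theorem leftMul_comp (ω : FormAlgebra d) (x y : q.Forms) :
    q.leftMul ω (x * y) = q.leftMul ω x * y := by
  induction ω using FormAlgebra.induction generalizing x y with
  | one => simp
  | gen i =>
    rw [leftMul_dT]
    induction x using form_induction with
    | h0 => simp [mul_def]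
    | hf b ω => rw [mulDT_form, form_mul, form_mul, mulDT_smul, map_mul, leftMul_dT]; rfl
    | ha x x' hx hx' => simp only [mul_def, map_add, LinearMap.add_apply] at *; rw [hx, hx']
  | add a b ha hb => rw [map_add, LinearMap.add_apply, ha, hb]; simp [mul_def]
  | neg a ha => rw [map_neg, LinearMap.neg_apply, ha]; simp [mul_def]
  | mul a b ha hb => simp only [map_mul, Module.End.mul_apply, hb, ha]

theorem leftMul_form (ω η : FormAlgebra d) : q.leftMul ω (q.form 1 η) = q.form 1 (ω * η) := by
  induction ω using FormAlgebra.induction generalizing η with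
  | one => simp
  | gen i => simp
  | add a b ha hb => simp [ha, hb, add_mul, form_add]
  | neg a ha => simp [ha, form_neg]
  | mul a b ha hb => simp [ha, hb, mul_assoc]

theorem smul_mul (c : B) (x y : q.Forms) : (c • x) * y = c • (x * y) := by
  induction x using form_induction with
  | h0 => simp [mul_def]
  | hf b ω => rw [smul_form, form_mul, form_mul, mul_smul]
  | ha x x' hx hx' => simp only [mul_def, map_add, LinearMap.add_apply, smul_add] at *; rw [hx, hx']

noncomputable instance : Ring q.Forms where
  __ := (inferInstance : AddCommGroup q.Forms)
  left_distrib := by intros; simp [mul_def]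
  right_distrib := by intros; simp [mul_def]
  zero_mul := by intros; simp [mul_def]
  mul_zero := by intros; simp [mul_def]
  one_mul x := by rw [one_def, form_mul]; simp
  mul_one x := by
    induction x using form_induction with
    | h0 => simp [mul_def]
    | hf b ω => rw [one_def, form_mul, leftMul_form, smul_form]; simp
    | ha x x' hx hx' => simp only [mul_def, map_add, LinearMap.add_apply] at *; rw [hx, hx']
  mul_assoc x y z := by
    induction x using form_induction with
    | h0 => simp [mul_def]
    | hf b ω => rw [form_mul, form_mul, leftMul_comp, smul_mul]
    | ha x x' hx hx' => simp only [mul_def, map_add, LinearMap.add_apply] at *; rw [hx, hx']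

noncomputable instance : Algebra S q.Forms :=
  Algebra.ofModule (fun s x y => by simp [mul_def]) (fun s x y => by simp [mul_def])

theorem form_mul_form (b c : B) (η : FormAlgebra d) :
    q.form b 1 * q.form c η = q.form (b * c) η := by
  rw [form_mul, map_one]; rfl

theorem dT_mul_form (i : Fin d) (c : B) (η : FormAlgebra d) :
    q.form 1 (dT i) * q.form c η = q.form (q.γ i c) (dT i * η) := by
  rw [form_mul, leftMul_dT, one_smul]; rfl

theorem form_eq_mul (b : B) (ω : FormAlgebra d) : q.form b ω = q.form b 1 * q.form 1 ω := by
  rw [form_mul_form, mul_one]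

theorem form_one_mul (ω η : FormAlgebra d) : q.form 1 ω * q.form 1 η = q.form 1 (ω * η) := by
  rw [form_mul, leftMul_form, one_smul]

/-- The grade involution `x ↦ (-1)^{deg x} x`. -/
noncomputable def sign : q.Forms →ₗ[S] q.Forms :=
  (TensorProduct.AlgebraTensorModule.map LinearMap.id (sgn d).toLinearMap :
    B ⊗[ℤ] FormAlgebra d →ₗ[S] B ⊗[ℤ] FormAlgebra d)

@[simp] theorem sign_form (b : B) (ω : FormAlgebra d) :
    q.sign (q.form b ω) = q.form b (sgn d ω) := rfl

theorem sgn_sgn (ω : FormAlgebra d) : sgn d (sgn d ω) = ω := by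
  induction ω using FormAlgebra.induction with
  | one => simp
  | gen i => simp
  | add a b ha hb => simp [ha, hb]
  | neg a ha => simp [ha]
  | mul a b ha hb => simp [ha, hb]

theorem sign_sign (x : q.Forms) : q.sign (q.sign x) = x := by
  induction x using form_induction with
  | h0 => simp
  | hf b ω => simp [sgn_sgn]
  | ha x y hx hy => simp [hx, hy]

theorem D_sign (x : q.Forms) : q.D (q.sign x) = - q.sign (q.D x) := by
  induction x using form_induction with
  | h0 => simp
  | hf b ω => simp [D_form, form_neg]
  | ha x y hx hy => rw [map_add, map_add, hx, hy, map_add, map_add, neg_add]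

theorem D_smul (c : B) (x : q.Forms) :
    q.D (c • x) = ∑ i, q.del i c • q.mulDT i x + c • q.D x := by
  induction x using form_induction with
  | h0 => simp
  | hf b ω =>
    simp [D_form, smul_form, q.del_mul, add_form, Finset.sum_add_distrib, Finset.smul_sum]
  | ha x y hx hy =>
    simp only [smul_add, map_add, hx, hy, Finset.sum_add_distrib]; abel

theorem D_mulDT (i : Fin d) (x : q.Forms) : q.D (q.mulDT i x) = - q.mulDT i (q.D x) := by
  rw [eq_neg_iff_add_eq_zero]
  simp only [D, mulDT, LinearMap.sum_apply, map_sum, ← Finset.sum_add_distrib]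
  refine Finset.sum_eq_zero fun j _ => ?_
  by_cases h : j = i
  · subst h
    have h1 := LinearMap.congr_fun (q.wedge_comp_self j (q.del j) (q.γ j).toLinearMap) x
    have h2 := LinearMap.congr_fun (q.wedge_comp_self j (q.γ j).toLinearMap (q.del j)) x
    exact (congrArg₂ (· + ·) h1 h2).trans (add_zero _)
  · exact LinearMap.congr_fun (q.wedge_comp_anticomm j i (q.del j) (q.γ i).toLinearMap
      (q.del j) (q.γ i).toLinearMap (fun b => (q.γ_del j i h b).symm)) x

theorem D_leftMul (ω : FormAlgebra d) (x : q.Forms) :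
    q.D (q.leftMul ω x) = q.leftMul (sgn d ω) (q.D x) := by
  induction ω using FormAlgebra.induction generalizing x with
  | one => simp
  | gen i => simp [D_mulDT]
  | add a b ha hb => simp [ha, hb]
  | neg a ha => simp [ha]
  | mul a b ha hb => simp [ha, hb]

/-- The graded Leibniz rule `∇(x y) = ∇(x) y + (-1)^{deg x} x ∇(y)`. -/
theorem D_mul (x y : q.Forms) : q.D (x * y) = q.D x * y + q.sign x * q.D y := by
  induction x using form_induction with
  | h0 => simp
  | hf b ω =>
    rw [form_mul, D_smul, D_leftMul, sign_form, form_mul, D_form, Finset.sum_mul]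
    congr 1
    refine Finset.sum_congr rfl fun i _ => ?_
    rw [form_mul, map_mul, leftMul_dT]; rfl
  | ha x x' hx hx' => simp only [add_mul, map_add, hx, hx']; abel

theorem D_one : q.D 1 = 0 := by
  have h : ∀ i, q.del i 1 = 0 := fun i => by
    have := q.del_mul i 1 1
    simpa using this
  rw [one_def, D_form]
  refine Finset.sum_eq_zero fun i _ => ?_
  rw [h]; exact TensorProduct.zero_tmul _ _

/-- The cocycles (of all degrees). -/
noncomputable def cocycles : Subalgebra S q.Forms where
  carrier := {x | q.D x = 0}
  mul_mem' {x y} hx hy := by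
    simp only [Set.mem_ofPred_eq] at *
    rw [D_mul, hx, hy, zero_mul, mul_zero, add_zero]
  add_mem' {x y} hx hy := by
    simp only [Set.mem_ofPred_eq] at *
    rw [map_add, hx, hy, add_zero]
  algebraMap_mem' s := by
    simp only [Set.mem_ofPred_eq]
    rw [Algebra.algebraMap_eq_smul_one, map_smul, D_one, smul_zero]

theorem mem_cocycles {x : q.Forms} : x ∈ q.cocycles ↔ q.D x = 0 := Iff.rfl

/-- The coboundaries, a two-sided ideal in the cocycles. -/
noncomputable def coboundaries : Ideal q.cocycles where
  carrier := {z | ∃ x, q.D x = z}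
  zero_mem' := ⟨0, by simp⟩
  add_mem' := by
    rintro a b ⟨x, hx⟩ ⟨y, hy⟩
    exact ⟨x + y, by simp [hx, hy]⟩
  smul_mem' := by
    rintro c a ⟨x, hx⟩
    refine ⟨q.sign c * x, ?_⟩
    have hc : q.D c = 0 := c.2
    rw [D_mul, sign_sign, D_sign, hc, hx]
    simp

instance : q.coboundaries.IsTwoSided where
  mul_mem_of_left := by
    rintro a b ⟨x, hx⟩
    refine ⟨x * b, ?_⟩
    have hb : q.D b = 0 := b.2
    rw [D_mul, hb, hx]
    simp

/-- The total cohomology ring `H^* = ⨁ₙ Hⁿ`; its multiplication is the cup product. -/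
abbrev Cohomology : Type _ := q.cocycles ⧸ q.coboundaries

/-- The cohomology class of a cocycle. -/
noncomputable def cls (z : q.Forms) (hz : q.D z = 0) : q.Cohomology :=
  Ideal.Quotient.mk q.coboundaries ⟨z, hz⟩

/-- The map `⨁_{|I| = n} B dT_I → ⨁_I B dT_I`. -/
noncomputable def degreeIncl (n : ℕ) : B ⊗[ℤ] ⋀[ℤ]^n (Fin d → ℤ) →ₗ[S] q.Forms :=
  (TensorProduct.AlgebraTensorModule.map (LinearMap.id : B →ₗ[S] B)
    (⋀[ℤ]^n (Fin d → ℤ)).subtype : B ⊗[ℤ] ⋀[ℤ]^n (Fin d → ℤ) →ₗ[S] B ⊗[ℤ] FormAlgebra d)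

/-- The forms of degree `n`. -/
noncomputable def degree (n : ℕ) : Submodule S q.Forms := LinearMap.range (q.degreeIncl n)

theorem degreeIncl_tmul {n : ℕ} (b : B) (ω : ⋀[ℤ]^n (Fin d → ℤ)) :
    q.degreeIncl n (b ⊗ₜ ω) = q.form b ω := rfl

theorem D_mem_degree {n : ℕ} {x : q.Forms} (hx : x ∈ q.degree n) : q.D x ∈ q.degree (n + 1) := by
  obtain ⟨y, rfl⟩ := hx
  induction y using TensorProduct.induction_on with
  | zero => rw [map_zero, map_zero]; exact zero_mem _
  | tmul b ω =>
    rw [degreeIncl_tmul, D_form]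
    refine sum_mem fun i _ => ?_
    have hm : dT i * (ω : FormAlgebra d) ∈ ⋀[ℤ]^(n + 1) (Fin d → ℤ) := by
      change _ ∈ LinearMap.range (ExteriorAlgebra.ι ℤ) ^ (n + 1)
      rw [pow_succ']
      exact Submodule.mul_mem_mul ⟨_, rfl⟩ ω.2
    exact ⟨q.del i b ⊗ₜ ⟨_, hm⟩, rfl⟩
  | add y z hy hz => rw [map_add, map_add]; exact add_mem hy hz

/-- The cohomology `Hⁿ`, as the part of degree `n` of the total cohomology: the classes of the
cocycles of degree `n`. As the differential is homogeneous of degree one, this is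
`ker(Cⁿ → Cⁿ⁺¹) / im(Cⁿ⁻¹ → Cⁿ)`. -/
noncomputable def H (n : ℕ) : Submodule S q.Cohomology :=
  ((q.degree n).comap q.cocycles.val.toLinearMap).map
    (Ideal.Quotient.mkₐ S q.coboundaries).toLinearMap

theorem mem_H {n : ℕ} {c : q.Cohomology} :
    c ∈ q.H n ↔ ∃ (z : q.Forms) (hz : q.D z = 0), z ∈ q.degree n ∧ q.cls z hz = c := by
  constructor
  · rintro ⟨⟨z, hz⟩, h, rfl⟩
    exact ⟨z, hz, h, rfl⟩
  · rintro ⟨z, hz, h, rfl⟩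
    exact ⟨⟨z, hz⟩, h, rfl⟩
end TwistedDerivations

namespace TwistedDerivations
variable {S B : Type*} [CommRing S] [CommRing B] [Algebra S B] {d : ℕ}

/-- The reduction `B/c`. -/
abbrev Mod (S B : Type*) [CommRing S] [CommRing B] [Algebra S B] (c : S) : Type _ :=
  B ⧸ Ideal.span {algebraMap S B c}

theorem span_sq_le (c : S) :
    Ideal.span {algebraMap S B (c ^ 2)} ≤ Ideal.span {algebraMap S B c} := by
  rw [Ideal.span_singleton_le_span_singleton, map_pow]
  exact dvd_pow_self _ two_ne_zero

theorem map_mem_span (c : S) (φ : B →ₗ[S] B) {b : B}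
    (hb : b ∈ Ideal.span {algebraMap S B c}) : φ b ∈ Ideal.span {algebraMap S B c} := by
  rw [Ideal.mem_span_singleton] at *
  obtain ⟨a, rfl⟩ := hb
  exact ⟨φ a, by rw [← Algebra.smul_def, map_smul, Algebra.smul_def]⟩

/-- The reduction mod `c` of an `S`-linear operator. -/
noncomputable def modMap (c : S) (φ : B →ₗ[S] B) : Mod S B c →ₗ[S] Mod S B c where
  toFun := Quotient.map' φ (fun a b h => by
    rw [Submodule.quotientRel_def] at *
    rw [← map_sub]
    exact map_mem_span c φ h)
  map_add' := by
    intro x y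
    obtain ⟨x, rfl⟩ := Ideal.Quotient.mk_surjective x
    obtain ⟨y, rfl⟩ := Ideal.Quotient.mk_surjective y
    exact congrArg (Ideal.Quotient.mk _) (map_add φ x y)
  map_smul' := by
    intro s x
    obtain ⟨x, rfl⟩ := Ideal.Quotient.mk_surjective x
    exact congrArg (Ideal.Quotient.mk _) (map_smul φ s x)

theorem modMap_mk (c : S) (φ : B →ₗ[S] B) (b : B) :
    modMap c φ (Ideal.Quotient.mk _ b) = Ideal.Quotient.mk _ (φ b) := rfl

variable (q : TwistedDerivations S B d)

/-- The operators induced on `B/c`; their complex is the reduction mod `c` of the complex of `q`. -/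
noncomputable def mod (c : S) : TwistedDerivations S (Mod S B c) d where
  γ i := Ideal.quotientMapₐ _ (q.γ i) (fun _ hb => map_mem_span c (q.γ i).toLinearMap hb)
  del i := modMap c (q.del i)
  del_mul i f g := by
    obtain ⟨f, rfl⟩ := Ideal.Quotient.mk_surjective f
    obtain ⟨g, rfl⟩ := Ideal.Quotient.mk_surjective g
    exact congrArg (Ideal.Quotient.mk _) (q.del_mul i f g)
  γ_comm i j f := by
    obtain ⟨f, rfl⟩ := Ideal.Quotient.mk_surjective f
    exact congrArg (Ideal.Quotient.mk _) (q.γ_comm i j f)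
  γ_del i j h f := by
    obtain ⟨f, rfl⟩ := Ideal.Quotient.mk_surjective f
    exact congrArg (Ideal.Quotient.mk _) (q.γ_del i j h f)
  del_comm i j f := by
    obtain ⟨f, rfl⟩ := Ideal.Quotient.mk_surjective f
    exact congrArg (Ideal.Quotient.mk _) (q.del_comm i j f)

/-- The reduction map `B/c² → B/c`. -/
noncomputable def redB (c : S) : Mod S B (c ^ 2) →ₐ[S] Mod S B c :=
  Ideal.Quotient.factorₐ S (span_sq_le c)

/-- The reduction map of complexes `C/c² → C/c`. -/
noncomputable def red (c : S) : (q.mod (c ^ 2)).Forms →ₗ[S] (q.mod c).Forms :=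
  (TensorProduct.AlgebraTensorModule.map (redB (B := B) c).toLinearMap LinearMap.id :
    Mod S B (c ^ 2) ⊗[ℤ] FormAlgebra d →ₗ[S] Mod S B c ⊗[ℤ] FormAlgebra d)

theorem red_form (c : S) (b : Mod S B (c ^ 2)) (ω : FormAlgebra d) :
    q.red c ((q.mod (c ^ 2)).form b ω) = (q.mod c).form (redB c b) ω := rfl

theorem red_D (c : S) (x : (q.mod (c ^ 2)).Forms) :
    q.red c ((q.mod (c ^ 2)).D x) = (q.mod c).D (q.red c x) := by
  induction x using form_induction with
  | h0 => simp
  | hf b ω =>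
    obtain ⟨b, rfl⟩ := Ideal.Quotient.mk_surjective b
    rw [D_form, red_form, D_form, map_sum]
    exact Finset.sum_congr rfl fun i _ => rfl
  | ha x y hx hy => simp only [map_add, hx, hy]

theorem redB_surjective (c : S) : Function.Surjective (redB (B := B) c) :=
  Ideal.Quotient.factor_surjective (span_sq_le c)

theorem red_surjective (c : S) : Function.Surjective (q.red c) :=
  LinearMap.rTensor_surjective (FormAlgebra d)
    (g := (redB (B := B) c).toLinearMap.restrictScalars ℤ) (redB_surjective c)

theorem smul_rTensor (c : S) (n : ℕ) (x : (q.mod (c ^ n)).Forms) :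
    LinearMap.rTensor (FormAlgebra d)
      ((LinearMap.lsmul S (Mod S B (c ^ n)) c).restrictScalars ℤ) x = c • x := by
  induction x using form_induction with
  | h0 => rw [smul_zero]; exact map_zero _
  | hf b ω => rfl
  | ha x y hx hy => rw [smul_add, ← hx, ← hy]; exact map_add _ _ _

theorem exists_of_red_eq_zero (c : S) (x : (q.mod (c ^ 2)).Forms) (h : q.red c x = 0) :
    ∃ y, x = c • y := by
  have hex : Function.Exact ((LinearMap.lsmul S (Mod S B (c ^ 2)) c).restrictScalars ℤ)
      ((redB (B := B) c).toLinearMap.restrictScalars ℤ) := by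
    intro b
    obtain ⟨b, rfl⟩ := Ideal.Quotient.mk_surjective b
    constructor
    · intro hb
      obtain ⟨a, rfl⟩ := Ideal.mem_span_singleton.1 (Ideal.Quotient.eq_zero_iff_mem.1 hb)
      exact ⟨Ideal.Quotient.mk _ a, congrArg (Ideal.Quotient.mk _) (Algebra.smul_def c a)⟩
    · rintro ⟨a, ha⟩
      obtain ⟨a, rfl⟩ := Ideal.Quotient.mk_surjective a
      rw [← ha]
      refine Ideal.Quotient.eq_zero_iff_mem.2 (Ideal.mem_span_singleton.2 ⟨a, ?_⟩)
      exact Algebra.smul_def c a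
  have := rTensor_exact (FormAlgebra d) hex (redB_surjective c)
  obtain ⟨y, hy⟩ := (this x).1 h
  exact ⟨y, hy.symm.trans (q.smul_rTensor c 2 y)⟩

instance : Module.Free ℤ (FormAlgebra d) :=
  Module.Free.of_basis (Module.Basis.ExteriorAlgebra (Pi.basisFun ℤ (Fin d)))

theorem red_eq_zero_of_smul (c : S) (hc : algebraMap S B c ∈ nonZeroDivisors B)
    (x : (q.mod (c ^ 2)).Forms) (h : c • x = 0) : q.red c x = 0 := by
  have hex : Function.Exact ((LinearMap.lsmul S (Mod S B (c ^ 2)) c).restrictScalars ℤ)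
      ((LinearMap.lsmul S (Mod S B (c ^ 2)) c).restrictScalars ℤ) := by
    intro b
    obtain ⟨b, rfl⟩ := Ideal.Quotient.mk_surjective b
    constructor
    · intro hb
      have hb' : c • b ∈ Ideal.span {algebraMap S B (c ^ 2)} := Ideal.Quotient.eq_zero_iff_mem.1 hb
      obtain ⟨a, ha⟩ := Ideal.mem_span_singleton.1 hb'
      refine ⟨Ideal.Quotient.mk _ a, congrArg (Ideal.Quotient.mk _) (?_ : c • a = b)⟩
      rw [Algebra.smul_def] at *
      rw [map_pow, pow_two, mul_assoc] at ha
      exact (mul_cancel_left_mem_nonZeroDivisors hc).1 ha.symm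
    · rintro ⟨a, ha⟩
      obtain ⟨a, rfl⟩ := Ideal.Quotient.mk_surjective a
      rw [← ha]
      refine Ideal.Quotient.eq_zero_iff_mem.2 (Ideal.mem_span_singleton.2 ⟨a, ?_⟩)
      simp [Algebra.smul_def, pow_two, mul_assoc]
  have := Module.Flat.rTensor_exact (FormAlgebra d) hex
  rw [← smul_rTensor] at h
  obtain ⟨y, hx⟩ : ∃ y : (q.mod (c ^ 2)).Forms, x = c • y := by
    obtain ⟨y, hy⟩ := (this x).1 h
    exact ⟨y, hy.symm.trans (q.smul_rTensor c 2 y)⟩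
  rw [hx, map_smul]
  generalize q.red c y = z
  induction z using form_induction with
  | h0 => simp
  | hf b ω =>
    have : c • b = 0 := by
      rw [Algebra.smul_def]
      refine (congrArg (· * b) ?_).trans (zero_mul b)
      exact Ideal.Quotient.eq_zero_iff_mem.2 (Ideal.mem_span_singleton_self _)
    rw [← algebraMap_smul (Mod S B c), smul_form, ← Algebra.smul_def, this]
    exact TensorProduct.zero_tmul _ _
  | ha x y hx hy => rw [smul_add, hx, hy, add_zero]

/-- `b` is the image of `a` under the boundary map of `0 → C/c → C/c² → C/c → 0`, where the first map is
multiplication by `c`, sending the reduction of `v ∈ C/c²` to `c v`: some lift `w ∈ C/c²` of a cocycle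
that represents `a` has differential `c v`, and the reduction of `v` represents `b`. -/
def IsBockstein (c : S) (a b : (q.mod c).Cohomology) : Prop :=
  ∃ (w v : (q.mod (c ^ 2)).Forms) (hw : (q.mod c).D (q.red c w) = 0)
    (hv : (q.mod c).D (q.red c v) = 0),
    (q.mod c).cls (q.red c w) hw = a ∧ (q.mod (c ^ 2)).D w = c • v ∧
      (q.mod c).cls (q.red c v) hv = b

variable {q} in
theorem cls_eq_zero_iff {z : q.Forms} {hz : q.D z = 0} : q.cls z hz = 0 ↔ ∃ x, q.D x = z :=
  Ideal.Quotient.eq_zero_iff_mem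

theorem IsBockstein.exists (c : S) (hc : algebraMap S B c ∈ nonZeroDivisors B)
    (a : (q.mod c).Cohomology) : ∃ b, q.IsBockstein c a b := by
  obtain ⟨⟨z, hz⟩, rfl⟩ := Ideal.Quotient.mk_surjective a
  obtain ⟨w, rfl⟩ := q.red_surjective c z
  have hz' : (q.mod c).D (q.red c w) = 0 := hz
  obtain ⟨v, hv⟩ := q.exists_of_red_eq_zero c ((q.mod (c ^ 2)).D w) (by rw [red_D, hz'])
  have : (q.mod c).D (q.red c v) = 0 := by
    rw [← red_D]
    apply q.red_eq_zero_of_smul c hc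
    rw [← map_smul, ← hv, D_D]
  exact ⟨_, w, v, hz', this, rfl, hv, rfl⟩

theorem IsBockstein.add {c : S} {a b a' b' : (q.mod c).Cohomology} (h : q.IsBockstein c a b)
    (h' : q.IsBockstein c a' b') : q.IsBockstein c (a + a') (b + b') := by
  obtain ⟨w, v, hw, hv, rfl, hD, rfl⟩ := h
  obtain ⟨w', v', hw', hv', rfl, hD', rfl⟩ := h'
  have e1 : (q.mod c).D (q.red c (w + w')) = 0 := by simp [hw, hw']
  have e2 : (q.mod c).D (q.red c (v + v')) = 0 := by simp [hv, hv']
  refine ⟨w + w', v + v', e1, e2, ?_, by rw [map_add, hD, hD', smul_add], ?_⟩ <;>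
  · rw [cls, cls, cls, ← map_add]; congr 1; ext; simp

theorem IsBockstein.smul {c : S} {a b : (q.mod c).Cohomology} (h : q.IsBockstein c a b)
    (s : S) : q.IsBockstein c (s • a) (s • b) := by
  obtain ⟨w, v, hw, hv, rfl, hD, rfl⟩ := h
  have e1 : (q.mod c).D (q.red c (s • w)) = 0 := by simp [hw]
  have e2 : (q.mod c).D (q.red c (s • v)) = 0 := by simp [hv]
  refine ⟨s • w, s • v, e1, e2, ?_, by rw [map_smul, hD, smul_comm], ?_⟩ <;>
  · rw [cls, cls, ← Ideal.Quotient.mkₐ_eq_mk S, ← map_smul]; congr 1; ext; simp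

theorem IsBockstein.eq_zero {c : S} (hc : algebraMap S B c ∈ nonZeroDivisors B)
    {b : (q.mod c).Cohomology} (h : q.IsBockstein c 0 b) : b = 0 := by
  obtain ⟨w, v, hw, hv, h0, hD, rfl⟩ := h
  obtain ⟨u, hu⟩ := cls_eq_zero_iff.1 h0
  obtain ⟨u, rfl⟩ := q.red_surjective c u
  obtain ⟨w', hw'⟩ := q.exists_of_red_eq_zero c (w - (q.mod (c ^ 2)).D u) (by
    rw [map_sub, red_D, hu, sub_self])
  refine cls_eq_zero_iff.2 ⟨q.red c w', ?_⟩
  rw [← red_D, ← sub_eq_zero, ← map_sub]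
  apply q.red_eq_zero_of_smul c hc
  rw [smul_sub, ← map_smul, ← hw', map_sub, D_D, hD]; simp

theorem IsBockstein.unique {c : S} (hc : algebraMap S B c ∈ nonZeroDivisors B)
    {a b b' : (q.mod c).Cohomology} (h : q.IsBockstein c a b) (h' : q.IsBockstein c a b') :
    b = b' := by
  have := IsBockstein.add q h (IsBockstein.smul q h' (-1))
  rw [neg_one_smul, neg_one_smul, add_neg_cancel] at this
  exact eq_of_sub_eq_zero (by rw [sub_eq_add_neg]; exact IsBockstein.eq_zero q hc this)

/-- The boundary map in cohomology of `0 → C/c → C/c² → C/c → 0`, in all degrees at once. -/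
noncomputable def bockstein (c : S) (hc : algebraMap S B c ∈ nonZeroDivisors B) :
    (q.mod c).Cohomology →ₗ[S] (q.mod c).Cohomology where
  toFun a := (IsBockstein.exists q c hc a).choose
  map_add' a a' := IsBockstein.unique q hc (IsBockstein.exists q c hc _).choose_spec
    (IsBockstein.add q (IsBockstein.exists q c hc a).choose_spec
      (IsBockstein.exists q c hc a').choose_spec)
  map_smul' s a := IsBockstein.unique q hc (IsBockstein.exists q c hc _).choose_spec
    (IsBockstein.smul q (IsBockstein.exists q c hc a).choose_spec s)

theorem bockstein_eq_iff (c : S) (hc : algebraMap S B c ∈ nonZeroDivisors B)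
    (a b : (q.mod c).Cohomology) : q.bockstein c hc a = b ↔ q.IsBockstein c a b := by
  constructor
  · rintro rfl; exact (IsBockstein.exists q c hc a).choose_spec
  · exact IsBockstein.unique q hc (IsBockstein.exists q c hc a).choose_spec

end TwistedDerivations

section Lifting
variable {d : ℕ} {R : Type*} [CommRing R] [Algebra (MvPolynomial (Fin d) ℤ) R]

/-- The coordinate `T_i` in `R`. -/
noncomputable def coord (R : Type*) [CommRing R] {d : ℕ} [Algebra (MvPolynomial (Fin d) ℤ) R]
    (i : Fin d) : R := algebraMap (MvPolynomial (Fin d) ℤ) R (MvPolynomial.X i)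

/-- Uniqueness of lifts along a framing. -/
theorem framed_hom_ext [Algebra.FormallyUnramified (MvPolynomial (Fin d) ℤ) R] {B : Type*}
    [CommRing B] (I : Ideal B) [IsHausdorff I B] (f g : R →+* B)
    (hX : ∀ i : Fin d, f (coord R i) = g (coord R i)) (h : ∀ r, f r - g r ∈ I) : f = g := by
  have hP : f.comp (algebraMap (MvPolynomial (Fin d) ℤ) R) =
      g.comp (algebraMap (MvPolynomial (Fin d) ℤ) R) :=
    MvPolynomial.ringHom_ext (by simp) hX
  let _ := (f.comp (algebraMap (MvPolynomial (Fin d) ℤ) R)).toAlgebra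
  let f' : R →ₐ[MvPolynomial (Fin d) ℤ] B := { f with commutes' := fun _ => rfl }
  let g' : R →ₐ[MvPolynomial (Fin d) ℤ] B :=
    { g with commutes' := fun x => (RingHom.congr_fun hP x).symm }
  have hI : ⨅ i, I ^ i = ⊥ := by
    simpa using IsHausdorff.iInf_pow_smul (I := I) (M := B) inferInstance
  have := Algebra.FormallyUnramified.ext_of_iInf (g₁ := f') (g₂ := g') I hI
    (fun x => Ideal.Quotient.eq.2 (h x))
  ext x
  exact AlgHom.congr_fun this x

/-- Existence of lifts along a framing. -/
theorem exists_framed_lift [Algebra.FormallySmooth (MvPolynomial (Fin d) ℤ) R] {B : Type*}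
    [CommRing B] (I : Ideal B) [IsAdicComplete I B] (b : Fin d → B) (f : R →+* B ⧸ I)
    (h : ∀ i, f (coord R i) = Ideal.Quotient.mk I (b i)) :
    ∃ F : R →+* B, (∀ i, F (coord R i) = b i) ∧ ∀ r, Ideal.Quotient.mk I (F r) = f r := by
  let _ := (MvPolynomial.eval₂Hom (Int.castRingHom B) b).toAlgebra
  have hP : (Ideal.Quotient.mk I).comp (MvPolynomial.eval₂Hom (Int.castRingHom B) b) =
      f.comp (algebraMap (MvPolynomial (Fin d) ℤ) R) :=
    MvPolynomial.ringHom_ext (by simp) (fun i => by simpa [coord] using (h i).symm)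
  let f' : R →ₐ[MvPolynomial (Fin d) ℤ] B ⧸ I :=
    { f with commutes' := fun x => (RingHom.congr_fun hP x).symm }
  obtain ⟨F, hF⟩ := Algebra.FormallySmooth.exists_mkₐ_comp_eq_of_isAdicComplete f'
  refine ⟨F, fun i => ?_, fun r => AlgHom.congr_fun hF r⟩
  refine (F.commutes (MvPolynomial.X i)).trans ?_
  exact MvPolynomial.eval₂Hom_X' _ _ _

end Lifting

section PowerSeriesHom
open PowerSeries
variable {R R' : Type*} [CommRing R] [CommRing R']

theorem powerSeries_hom_ext (f g : R⟦X⟧ →+* R'⟦X⟧) (hC : ∀ r, f (C r) = g (C r))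
    (hf : f X = X) (hg : g X = X) : f = g := by
  have key : ∀ (n : ℕ) (x : R⟦X⟧), (X : R'⟦X⟧) ^ n ∣ f x - g x := by
    intro n
    induction n with
    | zero => simp
    | succ n ih =>
      intro x
      rw [eq_X_mul_shift_add_const x]
      simp only [map_add, map_mul, hC, hf, hg, add_sub_add_right_eq_sub, ← mul_sub, pow_succ']
      exact mul_dvd_mul_left _ (ih _)
  ext x n
  have := X_pow_dvd_iff.1 (key (n + 1) x) n (Nat.lt_succ_self n)
  rwa [map_sub, sub_eq_zero] at this

theorem exists_powerSeries_hom (F : R →+* R'⟦X⟧) :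
    ∃ G : R⟦X⟧ →+* R'⟦X⟧, (∀ r, G (C r) = F r) ∧ G X = X := by
  let e : Polynomial R →+* R'⟦X⟧ := Polynomial.eval₂RingHom F X
  have he : ∀ (n : ℕ) (a : Polynomial R), Polynomial.X ^ n ∣ a →
      e a ∈ (Ideal.span {(X : R'⟦X⟧)}) ^ n := by
    rintro n a ⟨b, rfl⟩
    rw [map_mul, map_pow]
    refine Ideal.mul_mem_right _ _ (Ideal.pow_mem_pow ?_ _)
    simp [e]
  have hd : ∀ (n : ℕ) (a b : Polynomial R), (∀ m < n, a.coeff m = b.coeff m) →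
      Ideal.Quotient.mk ((Ideal.span {(X : R'⟦X⟧)}) ^ n) (e a) = Ideal.Quotient.mk _ (e b) := by
    intro n a b h
    rw [Ideal.Quotient.eq, ← map_sub]
    exact he n _ (Polynomial.X_pow_dvd_iff.2 fun m hm => by simp [h m hm])
  let f : (n : ℕ) → R⟦X⟧ →+* R'⟦X⟧ ⧸ (Ideal.span {(X : R'⟦X⟧)}) ^ n := fun n =>
    { toFun := fun x => Ideal.Quotient.mk _ (e (trunc n x))
      map_one' := by
        rw [← map_one (Ideal.Quotient.mk _), ← map_one e]
        refine hd _ _ _ fun m hm => ?_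
        rw [coeff_trunc, if_pos hm, coeff_one, Polynomial.coeff_one]
      map_mul' := fun x y => by
        rw [← map_mul, ← map_mul]
        refine hd _ _ _ fun m hm => ?_
        rw [coeff_trunc, if_pos hm, coeff_mul, Polynomial.coeff_mul]
        refine Finset.sum_congr rfl fun a ha => ?_
        have := Finset.HasAntidiagonal.mem_antidiagonal.1 ha
        rw [coeff_trunc, coeff_trunc, if_pos (by omega), if_pos (by omega)]
      map_zero' := by simp
      map_add' := fun x y => by simp }
  have hf : ∀ {m n : ℕ} (hle : m ≤ n), (Ideal.Quotient.factorPow _ hle).comp (f n) = f m := by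
    intro m n hle
    ext x
    refine hd _ _ _ fun k hk => ?_
    rw [coeff_trunc, coeff_trunc, if_pos hk, if_pos (by omega)]
  have hG := IsAdicComplete.mk_liftRingHom (Ideal.span {(X : R'⟦X⟧)}) f hf
  have huniq : ∀ x y : R'⟦X⟧, (∀ n, Ideal.Quotient.mk ((Ideal.span {(X : R'⟦X⟧)}) ^ n) x =
      Ideal.Quotient.mk _ y) → x = y := by
    intro x y h
    ext n
    have := Ideal.Quotient.eq.1 (h (n + 1))
    rw [Ideal.span_singleton_pow, Ideal.mem_span_singleton] at this
    have := X_pow_dvd_iff.1 this n (Nat.lt_succ_self n)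
    rwa [map_sub, sub_eq_zero] at this
  refine ⟨IsAdicComplete.liftRingHom _ f hf, fun r => huniq _ _ fun n => ?_,
    huniq _ _ fun n => ?_⟩
  · rw [hG]
    have : F r = e (Polynomial.C r) := by simp [e]
    rw [this]
    refine hd _ _ _ fun m hm => ?_
    rw [coeff_trunc, if_pos hm, coeff_C, Polynomial.coeff_C]
  · rw [hG]
    have : (X : R'⟦X⟧) = e Polynomial.X := by simp [e]
    refine Eq.trans ?_ (congrArg _ this.symm)
    refine hd _ _ _ fun m hm => ?_
    rw [coeff_trunc, if_pos hm, coeff_X, Polynomial.coeff_X]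
    simp [eq_comm]

end PowerSeriesHom

section QDeRham
open PowerSeries
variable {d : ℕ} (R : Type*) [CommRing R] [Algebra (MvPolynomial (Fin d) ℤ) R]

theorem exists_gamma [Algebra.Etale (MvPolynomial (Fin d) ℤ) R] (i : Fin d) :
    ∃ G : R⟦X⟧ →ₐ[ℤ⟦X⟧] R⟦X⟧,
      (∀ j, G (C (coord R j)) = if j = i then (1 + X) * C (coord R j) else C (coord R j)) ∧
      ∀ f, constantCoeff (G f) = constantCoeff f := by
  obtain ⟨F, hF, hF'⟩ := exists_framed_lift (R := R) (Ideal.span {(X : R⟦X⟧)})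
    (fun j => if j = i then (1 + X) * C (coord R j) else C (coord R j))
    ((Ideal.Quotient.mk _).comp C) (fun j => by
      rw [RingHom.comp_apply, Ideal.Quotient.eq, Ideal.mem_span_singleton]
      split_ifs
      · exact ⟨- C (coord R j), by ring⟩
      · simp)
  obtain ⟨G, hG, hGX⟩ := exists_powerSeries_hom F
  have hcomm : ∀ s : ℤ⟦X⟧, G (algebraMap ℤ⟦X⟧ R⟦X⟧ s) = algebraMap ℤ⟦X⟧ R⟦X⟧ s := by
    intro s
    refine RingHom.congr_fun (f := G.comp (algebraMap ℤ⟦X⟧ R⟦X⟧))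
      (powerSeries_hom_ext _ _ ?_ ?_ ?_) s
    · intro r; simp
    · simp [algebraMap_apply'', hGX]
    · simp [algebraMap_apply'']
  refine ⟨{ G with commutes' := hcomm }, fun j => (hG _).trans (hF j), fun f => ?_⟩
  change constantCoeff (G f) = constantCoeff f
  have hr : ∀ r, constantCoeff (F r) = r := fun r => by
    have := hF' r
    rw [RingHom.comp_apply, Ideal.Quotient.eq, Ideal.mem_span_singleton, X_dvd_iff] at this
    simpa [sub_eq_zero] using this
  rw [eq_X_mul_shift_add_const f]
  simp [hGX, hG, hr]

variable [Algebra.Etale (MvPolynomial (Fin d) ℤ) R]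

/-- The automorphism `γ_i` of `R[[q-1]]` over `ℤ[[q-1]]` (with `X = q - 1`, so `q = 1 + X`): it sends
`T_i` to `q T_i`, fixes `T_j` for `j ≠ i`, and is the identity mod `q - 1`. These properties determine
it, see `gamma_unique`. -/
noncomputable def gamma (i : Fin d) : R⟦X⟧ →ₐ[ℤ⟦X⟧] R⟦X⟧ := (exists_gamma R i).choose

theorem gamma_coord_self (i : Fin d) :
    gamma R i (C (coord R i)) = (1 + X) * C (coord R i) :=
  ((exists_gamma R i).choose_spec.1 i).trans (if_pos rfl)

theorem gamma_coord_of_ne {i j : Fin d} (h : j ≠ i) :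
    gamma R i (C (coord R j)) = C (coord R j) :=
  ((exists_gamma R i).choose_spec.1 j).trans (if_neg h)

theorem constantCoeff_gamma (i : Fin d) (f : R⟦X⟧) :
    constantCoeff (gamma R i f) = constantCoeff f :=
  (exists_gamma R i).choose_spec.2 f

variable {R} in
theorem algHom_X (G : R⟦X⟧ →ₐ[ℤ⟦X⟧] R⟦X⟧) : G X = X := by
  have := G.commutes X
  simpa [algebraMap_apply''] using this

variable {R} in
theorem mem_span_X_iff {R : Type*} [CommRing R] {f : R⟦X⟧} :
    f ∈ Ideal.span {(X : R⟦X⟧)} ↔ constantCoeff f = 0 := by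
  rw [Ideal.mem_span_singleton, X_dvd_iff]

theorem framed_powerSeries_hom_ext {R' : Type*} [CommRing R'] (f g : R⟦X⟧ →+* R'⟦X⟧)
    (hf : f X = X) (hg : g X = X) (hT : ∀ i : Fin d, f (C (coord R i)) = g (C (coord R i)))
    (hc : ∀ r : R, constantCoeff (f (C r)) = constantCoeff (g (C r))) : f = g := by
  refine powerSeries_hom_ext f g (fun r => ?_) hf hg
  refine RingHom.congr_fun (f := f.comp C) (g := g.comp C)
    (framed_hom_ext (d := d) (Ideal.span {(X : R'⟦X⟧)}) _ _ hT fun r => ?_) r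
  rw [mem_span_X_iff, map_sub, sub_eq_zero]
  exact hc r

theorem gamma_unique (i : Fin d) (G : R⟦X⟧ →ₐ[ℤ⟦X⟧] R⟦X⟧)
    (hi : G (C (coord R i)) = (1 + X) * C (coord R i))
    (hj : ∀ j, j ≠ i → G (C (coord R j)) = C (coord R j))
    (h0 : ∀ f, constantCoeff (G f) = constantCoeff f) : G = gamma R i := by
  have : (G : R⟦X⟧ →+* R⟦X⟧) = (gamma R i : R⟦X⟧ →+* R⟦X⟧) := by
    refine framed_powerSeries_hom_ext R (d := d) _ _ (algHom_X G) (algHom_X _) (fun j => ?_) fun r => ?_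
    · by_cases h : j = i
      · subst h; exact hi.trans (gamma_coord_self R j).symm
      · exact (hj j h).trans (gamma_coord_of_ne R h).symm
    · exact (h0 _).trans (constantCoeff_gamma R i _).symm
  exact AlgHom.ext fun x => RingHom.congr_fun this x

theorem gamma_comm (i j : Fin d) (f : R⟦X⟧) :
    gamma R i (gamma R j f) = gamma R j (gamma R i f) := by
  have hone : ∀ k : Fin d, gamma R k (1 + X) = 1 + X := fun k => by
    rw [map_add, map_one, algHom_X]
  refine RingHom.congr_fun (f := ((gamma R i).comp (gamma R j) : R⟦X⟧ →+* R⟦X⟧))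
    (g := ((gamma R j).comp (gamma R i) : R⟦X⟧ →+* R⟦X⟧))
    (framed_powerSeries_hom_ext R (d := d) _ _ (algHom_X ((gamma R i).comp (gamma R j)))
      (algHom_X ((gamma R j).comp (gamma R i))) (fun k => ?_) fun r => ?_) f
  · change gamma R i (gamma R j _) = gamma R j (gamma R i _)
    by_cases hi : k = i <;> by_cases hj : k = j
    · subst hi; subst hj; rfl
    · subst hi
      rw [gamma_coord_of_ne R hj, gamma_coord_self, map_mul, hone, gamma_coord_of_ne R hj]
    · subst hj
      rw [gamma_coord_of_ne R hi, gamma_coord_self, map_mul, hone, gamma_coord_of_ne R hi]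
    · rw [gamma_coord_of_ne R hj, gamma_coord_of_ne R hi, gamma_coord_of_ne R hj]
  · change constantCoeff (gamma R i (gamma R j _)) = constantCoeff (gamma R j (gamma R i _))
    simp only [constantCoeff_gamma]

theorem algebraMap_mem_nonZeroDivisors {a : MvPolynomial (Fin d) ℤ} (ha : a ≠ 0) :
    algebraMap (MvPolynomial (Fin d) ℤ) R a ∈ nonZeroDivisors R := by
  have : Module.Flat (MvPolynomial (Fin d) ℤ) R := inferInstance
  rw [mem_nonZeroDivisors_iff_right]
  intro x hx
  have hreg : IsSMulRegular (MvPolynomial (Fin d) ℤ) a := fun x y h =>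
    mul_left_cancel₀ ha h
  refine IsSMulRegular.of_flat (S := R) hreg (?_ : _ * x = _ * 0)
  rw [mul_comm, hx, mul_zero]

theorem coord_mem_nonZeroDivisors (i : Fin d) : coord R i ∈ nonZeroDivisors R :=
  algebraMap_mem_nonZeroDivisors R (MvPolynomial.X_ne_zero i)

theorem mem_nonZeroDivisors_of_constantCoeff {R : Type*} [CommRing R] {f : R⟦X⟧}
    (h : constantCoeff f ∈ nonZeroDivisors R) : f ∈ nonZeroDivisors R⟦X⟧ :=
  MvPowerSeries.mem_nonZeroDivisors_of_constantCoeff h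

theorem X_mem_nonZeroDivisors {R : Type*} [CommRing R] :
    (X : R⟦X⟧) ∈ nonZeroDivisors R⟦X⟧ := by
  rw [mem_nonZeroDivisors_iff_right]
  intro f hf
  ext n
  have := congrArg (coeff (n + 1)) hf
  simpa [coeff_succ_mul_X] using this

theorem denom_mem_nonZeroDivisors (i : Fin d) :
    (X : R⟦X⟧) * C (coord R i) ∈ nonZeroDivisors R⟦X⟧ :=
  mul_mem X_mem_nonZeroDivisors (mem_nonZeroDivisors_of_constantCoeff
    (by simpa using coord_mem_nonZeroDivisors R i))

theorem exists_del (i : Fin d) (f : R⟦X⟧) :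
    ∃ g : R⟦X⟧, X * C (coord R i) * g = gamma R i f - f := by
  let I := Ideal.span {coord R i}
  have h1 : (PowerSeries.map (Ideal.Quotient.mk I)).comp (gamma R i : R⟦X⟧ →+* R⟦X⟧) =
      PowerSeries.map (Ideal.Quotient.mk I) := by
    refine framed_powerSeries_hom_ext R (d := d) _ _ ?_ (by simp) (fun j => ?_) fun r => ?_
    · simp [algHom_X]
    · by_cases h : j = i
      · subst h
        have : Ideal.Quotient.mk I (coord R j) = 0 :=
          Ideal.Quotient.eq_zero_iff_mem.2 (Ideal.mem_span_singleton_self _)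
        simp [gamma_coord_self, this]
      · simp [gamma_coord_of_ne R h]
    · have := constantCoeff_gamma R i (C r)
      have h2 : constantCoeff (PowerSeries.map (Ideal.Quotient.mk I) (gamma R i (C r))) =
        Ideal.Quotient.mk I (constantCoeff (gamma R i (C r))) := rfl
      rw [RingHom.comp_apply]
      refine h2.trans ?_
      rw [this]; simp
  have h2 : ∀ n, coord R i ∣ coeff n (gamma R i f - f) := by
    intro n
    have := congrArg (coeff n) (RingHom.congr_fun h1 f)
    rw [← Ideal.mem_span_singleton, ← Ideal.Quotient.eq_zero_iff_mem, map_sub, map_sub,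
      sub_eq_zero]
    simpa using this
  choose a ha using h2
  refine ⟨mk fun n => a (n + 1), ?_⟩
  ext n
  cases n with
  | zero =>
    have : constantCoeff (gamma R i f - f) = 0 := by
      rw [map_sub, constantCoeff_gamma, sub_self]
    rw [coeff_zero_eq_constantCoeff_apply, coeff_zero_eq_constantCoeff_apply, this]
    simp
  | succ n => rw [mul_assoc, coeff_succ_X_mul, coeff_C_mul, coeff_mk, ha]

theorem denom_cancel {i : Fin d} {f g : R⟦X⟧}
    (h : X * C (coord R i) * f = X * C (coord R i) * g) : f = g :=
  (mul_cancel_left_mem_nonZeroDivisors (denom_mem_nonZeroDivisors R i)).1 h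

/-- The `q`-derivative `f ↦ (γ_i(f) - f) / (q T_i - T_i)`, see `qderiv_spec`. The denominator is a
non-zero-divisor. -/
noncomputable def qderiv (i : Fin d) : R⟦X⟧ →ₗ[ℤ⟦X⟧] R⟦X⟧ where
  toFun f := (exists_del R i f).choose
  map_add' f g := by
    apply denom_cancel R (i := i)
    rw [mul_add, (exists_del R i _).choose_spec, (exists_del R i _).choose_spec,
      (exists_del R i _).choose_spec, map_add]
    ring
  map_smul' s f := by
    apply denom_cancel R (i := i)
    rw [(exists_del R i _).choose_spec, RingHom.id_apply, mul_smul_comm,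
      (exists_del R i _).choose_spec, map_smul, smul_sub]

theorem qderiv_spec (i : Fin d) (f : R⟦X⟧) :
    ((1 + X) * C (coord R i) - C (coord R i)) * qderiv R i f = gamma R i f - f := by
  rw [← (exists_del R i f).choose_spec]
  change _ * (exists_del R i f).choose = _
  ring

theorem qderiv_spec' (i : Fin d) (f : R⟦X⟧) :
    X * C (coord R i) * qderiv R i f = gamma R i f - f := (exists_del R i f).choose_spec

theorem gamma_qderiv (i j : Fin d) (h : i ≠ j) (f : R⟦X⟧) :
    gamma R j (qderiv R i f) = qderiv R i (gamma R j f) := by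
  apply denom_cancel R (i := i)
  have := congrArg (gamma R j) (qderiv_spec' R i f)
  rw [map_mul, map_mul, algHom_X, gamma_coord_of_ne R h, map_sub] at this
  rw [this, qderiv_spec', gamma_comm]

theorem qderiv_comm (i j : Fin d) (f : R⟦X⟧) :
    qderiv R i (qderiv R j f) = qderiv R j (qderiv R i f) := by
  by_cases h : i = j
  · rw [h]
  apply denom_cancel R (i := i)
  apply denom_cancel R (i := j)
  rw [qderiv_spec', gamma_qderiv R j i (Ne.symm h), mul_sub, qderiv_spec', qderiv_spec',
    mul_left_comm, qderiv_spec', gamma_qderiv R i j h, mul_sub, qderiv_spec', qderiv_spec',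
    gamma_comm]
  ring

/-- The operators of the `q`-de Rham complex of a framed algebra `ℤ[T₁, …, T_d] → R`. -/
noncomputable def qData (d : ℕ) (R : Type*) [CommRing R] [Algebra (MvPolynomial (Fin d) ℤ) R]
    [Algebra.Etale (MvPolynomial (Fin d) ℤ) R] : TwistedDerivations ℤ⟦X⟧ R⟦X⟧ d where
  γ := gamma R
  del := qderiv R
  del_mul i f g := by
    apply denom_cancel R (i := i)
    rw [mul_add, ← mul_assoc, qderiv_spec', qderiv_spec', mul_left_comm, qderiv_spec', map_mul]
    ring
  γ_comm := gamma_comm R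
  γ_del := gamma_qderiv R
  del_comm := qderiv_comm R

/-- `Φ_p(q) ∈ ℤ[[q-1]]`. -/
noncomputable def cyclo (p : ℕ) : ℤ⟦X⟧ :=
  Polynomial.aeval (1 + X : ℤ⟦X⟧) (Polynomial.cyclotomic p ℤ)

theorem cyclo_mem_nonZeroDivisors (d : ℕ) (R : Type*) [CommRing R]
    [Algebra (MvPolynomial (Fin d) ℤ) R] [Algebra.Etale (MvPolynomial (Fin d) ℤ) R]
    (p : ℕ) [hp : Fact p.Prime] :
    algebraMap ℤ⟦X⟧ R⟦X⟧ (cyclo p) ∈ nonZeroDivisors R⟦X⟧ := by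
  apply mem_nonZeroDivisors_of_constantCoeff
  have h1 : constantCoeff (cyclo p) = (p : ℤ) := by
    rw [cyclo, ← Polynomial.eval_one_cyclotomic_prime (R := ℤ) (p := p),
      Polynomial.aeval_def, Polynomial.hom_eval₂]
    simp [Polynomial.eval₂_eq_eval_map]
  have h2 : constantCoeff (algebraMap ℤ⟦X⟧ R⟦X⟧ (cyclo p)) =
      algebraMap (MvPolynomial (Fin d) ℤ) R p := by
    refine (?_ : _ = algebraMap ℤ R (constantCoeff (cyclo p))).trans ?_
    · rfl
    · rw [h1]; simp
  rw [h2]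
  exact algebraMap_mem_nonZeroDivisors (d := d) R (Nat.cast_ne_zero.2 hp.out.ne_zero)

/-- The operators of the reduction of the `q`-de Rham complex mod `Φ_p(q)`. -/
noncomputable abbrev qDeRhamMod (d : ℕ) (R : Type*) [CommRing R]
    [Algebra (MvPolynomial (Fin d) ℤ) R] [Algebra.Etale (MvPolynomial (Fin d) ℤ) R] (p : ℕ) :
    TwistedDerivations ℤ⟦X⟧ (TwistedDerivations.Mod ℤ⟦X⟧ R⟦X⟧ (cyclo p)) d :=
  (qData d R).mod (cyclo p)

end QDeRham

section Kaehler
variable (d : ℕ) (R : Type*) [CommRing R] [Algebra (MvPolynomial (Fin d) ℤ) R]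
  [Algebra.Etale (MvPolynomial (Fin d) ℤ) R]

instance : IsScalarTower ℤ (MvPolynomial (Fin d) ℤ) R := inferInstance

/-- `dT_1, …, dT_d` is a basis of `Ω¹`. -/
noncomputable def kaehlerBasis : Module.Basis (Fin d) R Ω[R⁄ℤ] :=
  ((KaehlerDifferential.mvPolynomialBasis ℤ (Fin d)).baseChange R).map
    (KaehlerDifferential.tensorKaehlerEquivOfFormallyEtale ℤ (MvPolynomial (Fin d) ℤ) R)

theorem kaehlerBasis_apply (i : Fin d) :
    kaehlerBasis d R i = KaehlerDifferential.D ℤ R (coord R i) := by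
  rw [kaehlerBasis, Module.Basis.map_apply, Module.Basis.baseChange_apply,
    KaehlerDifferential.mvPolynomialBasis_apply]
  refine (KaehlerDifferential.mapBaseChange_tmul ℤ (MvPolynomial (Fin d) ℤ) R _ _).trans ?_
  rw [one_smul, KaehlerDifferential.map_D]
  rfl

/-- `⨁_{|I| = n} R dT_I = Ωⁿ_{R/ℤ}`. -/
noncomputable def formsEquiv (n : ℕ) :
    R ⊗[ℤ] ⋀[ℤ]^n (Fin d → ℤ) ≃ₗ[R] ⋀[R]^n Ω[R⁄ℤ] :=
  (((Pi.basisFun ℤ (Fin d)).exteriorPower n).baseChange R).equiv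
    ((kaehlerBasis d R).exteriorPower n) (Equiv.refl _)

/-- `⨁_{|I| = n} B dT_I = B ⊗_R Ωⁿ_{R/ℤ}`. -/
noncomputable def baseChangeFormsEquiv (B : Type*) [CommRing B] [Algebra R B] (n : ℕ) :
    B ⊗[ℤ] ⋀[ℤ]^n (Fin d → ℤ) ≃ₗ[B] B ⊗[R] ⋀[R]^n Ω[R⁄ℤ] :=
  (TensorProduct.AlgebraTensorModule.cancelBaseChange ℤ R B B (⋀[ℤ]^n (Fin d → ℤ))).symm ≪≫ₗ
    TensorProduct.AlgebraTensorModule.congr (LinearEquiv.refl B B) (formsEquiv d R n)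

theorem baseChangeFormsEquiv_apply (B : Type*) [CommRing B] [Algebra R B] (n : ℕ) (b : B)
    (s : Set.powersetCard (Fin d) n) :
    baseChangeFormsEquiv d R B n (b ⊗ₜ exteriorPower.ιMulti_family ℤ n
        (fun i : Fin d => (Pi.single i 1 : Fin d → ℤ)) s) =
      b ⊗ₜ exteriorPower.ιMulti_family R n
        (fun i : Fin d => KaehlerDifferential.D ℤ R (coord R i)) s := by
  have h1 : exteriorPower.ιMulti_family ℤ n (fun i : Fin d => (Pi.single i 1 : Fin d → ℤ)) s =
      (Pi.basisFun ℤ (Fin d)).exteriorPower n s := by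
    rw [exteriorPower.basis_apply]; congr 1; ext; simp
  have h2 : exteriorPower.ιMulti_family R n
      (fun i : Fin d => KaehlerDifferential.D ℤ R (coord R i)) s =
      (kaehlerBasis d R).exteriorPower n s := by
    rw [exteriorPower.basis_apply]; congr 1; ext; simp [kaehlerBasis_apply]
  have h3 : formsEquiv d R n (1 ⊗ₜ ((Pi.basisFun ℤ (Fin d)).exteriorPower n s)) =
      (kaehlerBasis d R).exteriorPower n s := by
    rw [formsEquiv, ← Module.Basis.baseChange_apply, Module.Basis.equiv_apply]; rfl
  rw [h1, h2, ← h3]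
  rfl

end Kaehler

section PadicCompletion
variable (p : ℕ) (R : Type*) [CommRing R]

/-- The `p`-adic completion `R̂`. -/
abbrev PadicCompletion : Type _ := AdicCompletion (Ideal.span {(p : R)}) R

/-- `R̂[ζ_p] = R̂[x]/Φ_p(x)`. -/
abbrev PadicCyclo : Type _ := AdjoinRoot (Polynomial.cyclotomic p (PadicCompletion p R))

/-- `ℤ_p[ζ_p]` -/
abbrev ZpZeta [Fact p.Prime] : Type := AdjoinRoot (Polynomial.cyclotomic p ℤ_[p])

theorem natCast_pow_eq_zero (n : ℕ) : ((p ^ n : ℕ) : R ⧸ (Ideal.span {(p : R)}) ^ n) = 0 := by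
  rw [← map_natCast (Ideal.Quotient.mk ((Ideal.span {(p : R)}) ^ n)),
    Ideal.Quotient.eq_zero_iff_mem, Ideal.span_singleton_pow, Ideal.mem_span_singleton]
  simp

/-- `ℤ/pⁿ → R/pⁿ` -/
noncomputable def zmodToQuot (n : ℕ) : ZMod (p ^ n) →+* R ⧸ (Ideal.span {(p : R)}) ^ n :=
  (Ideal.Quotient.lift (Ideal.span {((p ^ n : ℕ) : ℤ)}) (Int.castRingHom _) (by
      intro a ha
      obtain ⟨b, rfl⟩ := Ideal.mem_span_singleton.1 ha
      rw [map_mul, map_natCast, natCast_pow_eq_zero, zero_mul])).comp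
    ((Int.quotientSpanNatEquivZMod (p ^ n)).symm : ZMod (p ^ n) →+* _)

/-- The structure map `ℤ_p → R̂`. -/
noncomputable def padicIntToCompletion [Fact p.Prime] : ℤ_[p] →+* PadicCompletion p R :=
  AdicCompletion.liftRingHom _ (fun n => (zmodToQuot p R n).comp (PadicInt.toZModPow n)) (by
    intro m n hle
    rw [← PadicInt.zmod_cast_comp_toZModPow m n hle, ← RingHom.comp_assoc, ← RingHom.comp_assoc]
    congr 1
    exact RingHom.ext_zmod _ _)

/-- The extension of `f : A → B` to `A[ζ_p] → B[ζ_p]` by `ζ_p ↦ ζ_p`. -/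
noncomputable def cycloMap {A B : Type*} [CommRing A] [CommRing B] (p : ℕ) (f : A →+* B) :
    AdjoinRoot (Polynomial.cyclotomic p A) →+* AdjoinRoot (Polynomial.cyclotomic p B) :=
  AdjoinRoot.map f _ _ (by rw [Polynomial.map_cyclotomic])

/-- `φ : R̂ → R̂` is a lift of Frobenius that sends `T_i` to `T_i^p`. -/
structure IsFrobeniusLift (p d : ℕ) {R : Type*} [CommRing R] [Algebra (MvPolynomial (Fin d) ℤ) R]
    (φ : PadicCompletion p R →+* PadicCompletion p R) : Prop where
  coord : ∀ i : Fin d, φ (algebraMap R _ (coord R i)) = algebraMap R _ (coord R i) ^ p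
  frob : ∀ x, (p : PadicCompletion p R) ∣ φ x - x ^ p

/-- The `p`-adic topology. -/
abbrev padicTopology (p : ℕ) (M : Type*) [AddCommGroup M] : TopologicalSpace M :=
  (Ideal.span {(p : ℤ)}).adicModuleTopology M

/-- The base ring `R[[q-1]]/Φ_p(q)` of the reduced complex. -/
abbrev QuotCyclo (p : ℕ) (R : Type*) [CommRing R] : Type _ :=
  TwistedDerivations.Mod ℤ⟦X⟧ R⟦X⟧ (cyclo p)

/-- `q` in `R[[q-1]]/Φ_p(q)`. -/
noncomputable def qElt (p : ℕ) (R : Type*) [CommRing R] : QuotCyclo p R :=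
  Ideal.Quotient.mk _ (1 + PowerSeries.X)

/-- The boundary map for `0 → qΩ/Φ_p(q) → qΩ/Φ_p(q)² → qΩ/Φ_p(q) → 0`. -/
noncomputable def boundary (d p : ℕ) [Fact p.Prime] (R : Type*) [CommRing R]
    [Algebra (MvPolynomial (Fin d) ℤ) R] [Algebra.Etale (MvPolynomial (Fin d) ℤ) R] :
    (qDeRhamMod d R p).Cohomology →ₗ[ℤ⟦X⟧] (qDeRhamMod d R p).Cohomology :=
  (qData d R).bockstein (cyclo p) (cyclo_mem_nonZeroDivisors d R p)

end PadicCompletion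

end QDeRham

open QDeRham

/-!
Write `B = R[[q-1]]/Φ_p(q)`. Transporting `φ` along the identification `R̂[ζ_p] = B` gives an
endomorphism `F` of `B` that fixes `q`, sends `Tᵢ` to `Tᵢ ^ p` and is the Frobenius modulo `q - 1`
(`QuotCyclo.IsTwistedFrobenius`). As `q ^ p = 1` in `B`, the automorphisms `γᵢ` fix `Tᵢ ^ p`, and by
étaleness they fix the whole image of `F`; so the `q`-derivatives `∂ᵢ` are linear over that image
(`QuotCyclo.IsTwistedFrobenius.del_map_mul`).

The monomials `T ^ a` with `0 ≤ aᵢ < p` form a basis of `B` over the image of `F`, and `F` is injective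
(`QuotCyclo.expansion_bijective`). Modulo `q - 1` this says that they form a basis of `R/p` over its
Frobenius, for which étaleness over `ℤ[T₁, …, T_d]` is used
(`exists_sum_pow_mul_smallMonomial`, `eq_zero_of_sum_pow_mul_smallMonomial`), and one passes to `B` by
successive approximation (`bijective_of_bijective_mod`). The same lemma yields the identification
`R̂[ζ_p] = B`, since modulo `p` the polynomial `Φ_p(q)` is `(q - 1) ^ (p - 1)`.

In this basis `∂ᵢ(T ^ a) = [aᵢ]_q T ^ a / Tᵢ`, and the `q`-integers `[1]_q, …, [p-1]_q` are units of `B`.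
So in each variable the complex is the Koszul complex of an operator with kernel spanned by the
monomials with `aᵢ = 0` and cokernel by those with `aᵢ = p - 1`, and the `q`-integral is an explicit
contracting homotopy onto these (`TwistedDerivations.D_op_add_op_D`). Contracting the variables one at
a time shows that the classes of `∏_{i ∈ I} Tᵢ ^ (p - 1) dT_I` form a basis of the cohomology over the
image of `F` (`QuotCyclo.cohomologyEquiv`). This gives (i), and reduces (ii) and (iii) to a computation:
the boundary of `φ(Tᵢ) = Tᵢ ^ p` is the class of `Tᵢ ^ (p - 1) dTᵢ`, because `∂ᵢ(Tᵢ ^ p) = [p]_q Tᵢ ^ (p - 1)`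
and `[p]_q = Φ_p(q)`, and the products of these classes are the basis above. That the boundary is a
derivation on `H⁰` follows from the twisted Leibniz rule, as the `γᵢ` are trivial on `H⁰`; it kills
`ℤ_p[ζ_p]`, as it kills `q` and the integers and the cohomology is `p`-adically separated.
-/

open scoped TensorProduct PowerSeries
namespace QDeRham

/-! ### Nilpotent ideals and the Frobenius -/

theorem isHausdorff_of_isNilpotent {B : Type*} [CommRing B] {I : Ideal B} (h : IsNilpotent I) :
    IsHausdorff I B := by
  obtain ⟨n, hn⟩ := h
  refine ⟨fun x hx => ?_⟩
  have := hx n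
  rw [hn] at this
  simpa [SModEq.zero] using this

theorem isAdicComplete_of_isNilpotent {B : Type*} [CommRing B] {I : Ideal B}
    (h : IsNilpotent I) : IsAdicComplete I B := by
  have h1 := isHausdorff_of_isNilpotent h
  obtain ⟨n, hn⟩ := h
  refine { h1 with prec' := fun f hf => ⟨f n, fun m => ?_⟩ }
  rcases le_total m n with h | h
  · exact hf h
  · have := (hf h).symm
    rw [hn] at this
    rw [SModEq.sub_mem] at *
    simp only [Ideal.zero_eq_bot, Submodule.bot_smul, Submodule.mem_bot] at this
    rw [this]; exact zero_mem _

/-- The Frobenius `x ↦ x ^ p` of a ring in which `p = 0`. The zero ring is allowed. -/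
def frob (p : ℕ) [hp : Fact p.Prime] (k : Type*) [CommRing k] (h : (p : k) = 0) : k →+* k where
  toFun x := x ^ p
  map_one' := one_pow p
  map_mul' x y := mul_pow x y p
  map_zero' := zero_pow hp.out.ne_zero
  map_add' x y := by
    obtain ⟨r, hr⟩ := exists_add_pow_prime_eq hp.out x y
    rw [hr, h]; ring

@[simp] theorem frob_apply (p : ℕ) [Fact p.Prime] (k : Type*) [CommRing k] (h : (p : k) = 0)
    (x : k) : frob p k h x = x ^ p := rfl

/-! ### Coordinates modulo `p` over the Frobenius -/

section FrobeniusBasis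
variable {d : ℕ} {R : Type*} [CommRing R] [Algebra (MvPolynomial (Fin d) ℤ) R]
  [Algebra.Etale (MvPolynomial (Fin d) ℤ) R]

variable (d R) in
include d in
theorem finiteType_int : Algebra.FiniteType ℤ R :=
  Algebra.FiniteType.trans (S := MvPolynomial (Fin d) ℤ) inferInstance inferInstance

/-- A quotient `k` of `R` with `p = 0` is generated as a ring by the `p`-th powers and the coordinates.
If `A` is the subring they generate, then `k` is finite over `A`, and the diagonal ideal of `k ⊗_A k`
is nil because `p`-th powers come from `A`; by étaleness the two maps `k → k ⊗_A k` agree. So `A → k`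
is a finite epimorphism, hence surjective. -/
theorem closure_pow_coord_eq_top {p : ℕ} [hp : Fact p.Prime] {k : Type*} [CommRing k]
    (hk : (p : k) = 0) (π : R →+* k) (hπ : Function.Surjective π) :
    Subring.closure (Set.range (fun x : k => x ^ p) ∪
      Set.range (fun i : Fin d => π (coord R i))) = ⊤ := by
  set A := Subring.closure (Set.range (fun x : k => x ^ p) ∪
      Set.range (fun i : Fin d => π (coord R i))) with hA
  have hpow : ∀ x : k, x ^ p ∈ A := fun x => Subring.subset_closure (Or.inl ⟨x, rfl⟩)
  have hft : Algebra.FiniteType ℤ k := by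
    have := finiteType_int d R
    exact Algebra.FiniteType.of_surjective (R := ℤ) (A := R) π.toIntAlgHom hπ
  have : Algebra.FiniteType A k := Algebra.FiniteType.of_restrictScalars_finiteType ℤ A k
  have : Algebra.IsIntegral A k := ⟨fun x => IsIntegral.of_pow hp.out.pos (by
    exact isIntegral_algebraMap (x := (⟨x ^ p, hpow x⟩ : A)))⟩
  have : Module.Finite A k := Algebra.IsIntegral.finite
  have hpt : (p : k ⊗[A] k) = 0 := by
    have : (p : k ⊗[A] k) = Algebra.TensorProduct.includeLeft (R := A) (S := A) (p : k) := by simp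
    rw [this, hk, map_zero]
  have hnil : IsNilpotent (KaehlerDifferential.ideal A k) := by
    have hfg : (KaehlerDifferential.ideal A k).FG := KaehlerDifferential.ideal_fg A k
    rw [Ideal.FG.isNilpotent_iff_le_nilradical hfg, ← KaehlerDifferential.span_range_eq_ideal,
      Ideal.span_le]
    rintro _ ⟨x, rfl⟩
    refine ⟨p, ?_⟩
    have h1 := map_sub (frob p (k ⊗[A] k) hpt) (1 ⊗ₜ x) (x ⊗ₜ 1)
    simp only [frob_apply] at h1
    rw [h1, Algebra.TensorProduct.tmul_pow, Algebra.TensorProduct.tmul_pow, one_pow]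
    have : x ^ p = (⟨x ^ p, hpow x⟩ : A) • (1 : k) := by
      rw [Algebra.smul_def, mul_one]; rfl
    rw [this, TensorProduct.smul_tmul, sub_self]
    exact zero_mem _
  have hH := isHausdorff_of_isNilpotent hnil
  have hepi : Algebra.IsEpi A k := by
    rw [Algebra.isEpi_iff_forall_one_tmul_eq]
    intro a
    obtain ⟨r, rfl⟩ := hπ a
    have := framed_hom_ext (d := d) (KaehlerDifferential.ideal A k)
      ((Algebra.TensorProduct.includeRight (R := A) (A := k) (B := k) : k →+* k ⊗[A] k).comp π)
      ((Algebra.TensorProduct.includeLeft (R := A) (S := A) (A := k) (B := k) :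
        k →+* k ⊗[A] k).comp π) (fun i => ?_) (fun r => ?_)
    · exact RingHom.congr_fun this r
    · have hm : π (coord R i) ∈ A := Subring.subset_closure (Or.inr ⟨i, rfl⟩)
      have : π (coord R i) = (⟨_, hm⟩ : A) • (1 : k) := by
        rw [Algebra.smul_def, mul_one]; rfl
      change 1 ⊗ₜ[A] π (coord R i) = π (coord R i) ⊗ₜ[A] 1
      rw [this, TensorProduct.smul_tmul]
    · exact KaehlerDifferential.one_smul_sub_smul_one_mem_ideal A _
  have hs := (Algebra.isEpi_iff_surjective_algebraMap_of_finite (R := A) (A := k)).1 hepi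
  rw [eq_top_iff]
  intro x _
  obtain ⟨a, rfl⟩ := hs x
  exact a.2

/-- The monomial `∏ tᵢ ^ aᵢ` with exponents `0 ≤ aᵢ < p`. -/
def smallMonomial {k : Type*} [CommRing k] {p : ℕ} (t : Fin d → k) (a : Fin d → Fin p) : k :=
  ∏ i, t i ^ (a i : ℕ)

section NormalForm
variable {k : Type*} [CommRing k] (p : ℕ) [NeZero p] (t : Fin d → k)

/-- The normal form modulo the relations `Xᵢ ^ p = tᵢ`: a linear map that reads off coordinates in
the basis of monomials of `k[X₁, …, X_d]/(Xᵢ ^ p - tᵢ)` with all exponents below `p`. -/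
noncomputable def normalForm : MvPolynomial (Fin d) k →ₗ[k] ((Fin d → Fin p) → k) :=
  (MvPolynomial.basisMonomials (Fin d) k).constr k fun n =>
    Pi.single (fun i => Fin.ofNat p (n i)) (∏ i, t i ^ (n i / p))

theorem normalForm_monomial (n : Fin d →₀ ℕ) :
    normalForm p t (MvPolynomial.monomial n 1) =
      Pi.single (fun i => Fin.ofNat p (n i)) (∏ i, t i ^ (n i / p)) := by
  rw [normalForm]
  exact (MvPolynomial.basisMonomials (Fin d) k).constr_basis k _ n

theorem normalForm_eq_zero {f : MvPolynomial (Fin d) k}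
    (hf : f ∈ Ideal.span (Set.range fun i : Fin d =>
      (MvPolynomial.X i ^ p - MvPolynomial.C (t i) : MvPolynomial (Fin d) k))) :
    normalForm p t f = 0 := by
  have hp : 0 < p := Nat.pos_of_neZero p
  suffices ∀ g, normalForm p t (g * f) = 0 by simpa using this 1
  induction hf using Submodule.span_induction with
  | mem f hf =>
    obtain ⟨i, rfl⟩ := hf
    suffices normalForm p t ∘ₗ LinearMap.mulRight k
        (MvPolynomial.X i ^ p - MvPolynomial.C (t i) : MvPolynomial (Fin d) k) = 0 from
      fun g => LinearMap.congr_fun this g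
    refine (MvPolynomial.basisMonomials (Fin d) k).ext fun n => ?_
    have h1 : (MvPolynomial.monomial n (1 : k)) * MvPolynomial.X i ^ p =
        MvPolynomial.monomial (n + Finsupp.single i p) 1 := by
      rw [MvPolynomial.X_pow_eq_monomial, MvPolynomial.monomial_mul, one_mul]
    have h2 : (MvPolynomial.monomial n (1 : k)) * MvPolynomial.C (t i) =
        t i • MvPolynomial.monomial n 1 := by
      rw [mul_comm, MvPolynomial.C_mul']
    rw [MvPolynomial.coe_basisMonomials, LinearMap.comp_apply, LinearMap.mulRight_apply, mul_sub,
      h1, h2, map_sub, map_smul, normalForm_monomial, normalForm_monomial, LinearMap.zero_apply,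
      sub_eq_zero, ← Pi.single_smul]
    have h3 : (fun j => Fin.ofNat p ((n + Finsupp.single i p) j)) =
        fun j => Fin.ofNat p (n j) := by
      funext j
      by_cases h : j = i
      · subst h; ext; simp
      · simp [Finsupp.single_eq_of_ne h]
    rw [h3]
    congr 1
    rw [← Finset.mul_prod_erase _ _ (Finset.mem_univ i),
      ← Finset.mul_prod_erase (a := i) _ (fun j => t j ^ (n j / p)) (Finset.mem_univ i), smul_eq_mul,
      ← mul_assoc]
    congr 1
    · simp [Nat.add_div_right _ hp, pow_succ']
    · refine Finset.prod_congr rfl fun j hj => ?_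
      simp [Finsupp.single_eq_of_ne (Finset.ne_of_mem_erase hj)]
  | zero => simp
  | add f g _ _ hf hg => intro a; rw [mul_add, map_add, hf, hg, add_zero]
  | smul a f _ hf => intro g; rw [smul_eq_mul, ← mul_assoc]; exact hf _

theorem normalForm_C_mul_smallMonomial (c : k) (a : Fin d → Fin p) :
    normalForm p t (MvPolynomial.C c * smallMonomial MvPolynomial.X a) = Pi.single a c := by
  have h : smallMonomial (MvPolynomial.X : Fin d → MvPolynomial (Fin d) k) a =
      MvPolynomial.monomial (Finsupp.equivFunOnFinite.symm fun i => (a i : ℕ)) 1 := by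
    rw [smallMonomial, MvPolynomial.monomial_eq, MvPolynomial.C_1, one_mul, Finsupp.prod_fintype]
    · rfl
    · simp
  rw [h, MvPolynomial.C_mul', map_smul, normalForm_monomial, ← Pi.single_smul]
  congr 1
  · funext i; ext; simp
  · simp [Nat.div_eq_of_lt (a _).2]

end NormalForm

/-- Every element of `R/p` has the form `∑ c_a ^ p T ^ a` with exponents `aᵢ < p`. -/
theorem exists_sum_pow_mul_smallMonomial {p : ℕ} [hp : Fact p.Prime] {k : Type*} [CommRing k]
    (hk : (p : k) = 0) (π : R →+* k) (hπ : Function.Surjective π) (x : k) :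
    ∃ c : (Fin d → Fin p) → k,
      x = ∑ a, c a ^ p * smallMonomial (fun i => π (coord R i)) a := by
  have hp0 := hp.out.pos
  let t : Fin d → k := fun i => π (coord R i)
  let v : MvPolynomial (Fin d) k →+* k := MvPolynomial.eval₂Hom (frob p k hk) t
  have hv : Function.Surjective v := by
    rw [← RingHom.range_eq_top, eq_top_iff,
      ← closure_pow_coord_eq_top (d := d) hk π hπ, Subring.closure_le]
    rintro _ (⟨x, rfl⟩ | ⟨i, rfl⟩)
    · exact ⟨MvPolynomial.C x, by simp [v]⟩
    · exact ⟨MvPolynomial.X i, by simp [v, t]⟩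
  obtain ⟨f, rfl⟩ := hv x
  induction f using MvPolynomial.induction_on' with
  | monomial u b =>
    refine ⟨Pi.single (fun i => Fin.ofNat p (u i)) (b * ∏ i, t i ^ (u i / p)), ?_⟩
    rw [Finset.sum_eq_single (fun i => Fin.ofNat p (u i))]
    · simp only [v, MvPolynomial.coe_eval₂Hom, MvPolynomial.eval₂_monomial, frob_apply,
        Pi.single_eq_same, mul_pow, smallMonomial, mul_assoc]
      rw [← Finset.prod_pow, ← Finset.prod_mul_distrib, Finsupp.prod_fintype]
      · congr 1
        refine Finset.prod_congr rfl fun i _ => ?_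
        change _ = (t i ^ (u i / p)) ^ p * t i ^ (u i % p)
        rw [← pow_mul, ← pow_add, mul_comm, Nat.div_add_mod]
      · simp
    · intro a _ ha
      rw [Pi.single_eq_of_ne ha, zero_pow hp0.ne', zero_mul]
    · simp
  | add f g hf hg =>
    obtain ⟨c, hc⟩ := hf
    obtain ⟨e, he⟩ := hg
    refine ⟨c + e, ?_⟩
    rw [map_add, hc, he, ← Finset.sum_add_distrib]
    refine Finset.sum_congr rfl fun a _ => ?_
    have := map_add (frob p k hk) (c a) (e a)
    simp only [frob_apply] at this
    rw [Pi.add_apply, this, add_mul]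

/-- The coefficients in `∑ c_a ^ p T ^ a` are unique: the surjection `k[X]/(Xᵢ ^ p - Tᵢ) → k` that is
the Frobenius on `k` and sends `Xᵢ` to `Tᵢ` has nilpotent kernel, so by étaleness it has a section,
and the section is an inverse. -/
theorem eq_zero_of_sum_pow_mul_smallMonomial {p : ℕ} [hp : Fact p.Prime] {k : Type*} [CommRing k]
    (hk : (p : k) = 0) (π : R →+* k) (hπ : Function.Surjective π)
    (hπp : ∀ r, π r = 0 → (p : R) ∣ r) (c : (Fin d → Fin p) → k)
    (hc : ∑ a, c a ^ p * smallMonomial (fun i => π (coord R i)) a = 0) : c = 0 := by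
  have hp0 := hp.out.pos
  let t : Fin d → k := fun i => π (coord R i)
  let v : MvPolynomial (Fin d) k →+* k := MvPolynomial.eval₂Hom (frob p k hk) t
  have hv : Function.Surjective v := fun x => by
    obtain ⟨c, rfl⟩ := exists_sum_pow_mul_smallMonomial (d := d) hk π hπ x
    exact ⟨∑ a, MvPolynomial.C (c a) * smallMonomial MvPolynomial.X a, by
      simp [v, smallMonomial, t]⟩
  let J : Ideal (MvPolynomial (Fin d) k) := Ideal.span (Set.range fun i : Fin d =>
      (MvPolynomial.X i ^ p - MvPolynomial.C (t i) : MvPolynomial (Fin d) k))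
  let S := MvPolynomial (Fin d) k ⧸ J
  let m : MvPolynomial (Fin d) k →+* S := Ideal.Quotient.mk J
  have hm : Function.Surjective m := Ideal.Quotient.mk_surjective
  have hJ : ∀ f ∈ J, v f = 0 := by
    intro f hf
    change f ∈ RingHom.ker v
    refine (Ideal.span_le.2 ?_ : J ≤ RingHom.ker v) hf
    rintro _ ⟨i, rfl⟩
    simp [RingHom.mem_ker, v, t]
  let u : S →+* k := Ideal.Quotient.lift J v hJ
  have hum : ∀ f, u (m f) = v f := fun f => Ideal.Quotient.lift_mk J v hJ
  have hu : Function.Surjective u := fun x => by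
    obtain ⟨f, rfl⟩ := hv x
    exact ⟨m f, hum f⟩
  have hXp : ∀ i, m (MvPolynomial.X i) ^ p = m (MvPolynomial.C (t i)) := fun i => by
    rw [← map_pow]
    exact Ideal.Quotient.eq.2 (Ideal.subset_span ⟨i, rfl⟩)
  have hpS : (p : S) = 0 := by
    have : (p : S) = m (MvPolynomial.C (p : k)) := by simp
    rw [this, hk, map_zero, map_zero]
  -- the other composite of `u` with the structure map `k → S` is the Frobenius of `S`
  have hFr : ∀ s : S, s ^ p = m (MvPolynomial.C (u s)) := by
    intro s
    obtain ⟨f, rfl⟩ := hm s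
    rw [hum]
    refine RingHom.congr_fun (f := (frob p S hpS).comp m)
      (g := m.comp (MvPolynomial.C.comp v)) (MvPolynomial.ringHom_ext (fun r => ?_) fun i => ?_) f
    · simp [v]
    · simpa [v] using hXp i
  have : Algebra.FiniteType ℤ R := finiteType_int d R
  have : IsNoetherianRing R := Algebra.FiniteType.isNoetherianRing ℤ R
  have : IsNoetherianRing k := isNoetherianRing_of_surjective R k π hπ
  have hK : IsNilpotent (RingHom.ker u) := by
    rw [Ideal.FG.isNilpotent_iff_le_nilradical (IsNoetherian.noetherian _)]
    intro s hs
    exact ⟨p, by rw [hFr, RingHom.mem_ker.1 hs, map_zero, map_zero]; exact zero_mem _⟩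
  have := isAdicComplete_of_isNilpotent hK
  -- the inverse of `u`
  let ue : S ⧸ RingHom.ker u ≃+* k := RingHom.quotientKerEquivOfSurjective hu
  have hue : ∀ s, ue (Ideal.Quotient.mk _ s) = u s := fun s => rfl
  obtain ⟨w, hwX, hw⟩ := exists_framed_lift (R := R) (RingHom.ker u)
    (fun i => m (MvPolynomial.X i)) ((ue.symm : k →+* _).comp π) (fun i => by
      apply ue.injective
      rw [hue, hum]
      simp [v, t])
  have huw : ∀ r, u (w r) = π r := fun r => by
    rw [← hue, hw]; simp
  have hwp : ∀ r, w r ^ p = m (MvPolynomial.C (π r)) := by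
    refine fun r => RingHom.congr_fun (f := (frob p S hpS).comp w)
      (g := m.comp (MvPolynomial.C.comp π)) (framed_hom_ext (d := d) (RingHom.ker u) _ _
        (fun i => ?_) fun r => ?_) r
    · simpa [hwX] using hXp i
    · rw [RingHom.mem_ker, map_sub, sub_eq_zero]
      simp [huw, hum, v]
  have hker : ∀ r, π r = 0 → w r = 0 := fun r hr => by
    obtain ⟨a, rfl⟩ := hπp r hr
    rw [map_mul, map_natCast, hpS, zero_mul]
  let wk : k →+* S := RingHom.liftOfSurjective π hπ ⟨w, fun r hr => hker r hr⟩
  have hwk : ∀ r, wk (π r) = w r := fun r => RingHom.liftOfRightInverse_comp_apply _ _ _ _ r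
  have hwv : ∀ f, wk (v f) = m f := by
    refine fun f => RingHom.congr_fun (f := wk.comp v) (g := m)
      (MvPolynomial.ringHom_ext (fun r => ?_) fun i => ?_) f
    · obtain ⟨r, rfl⟩ := hπ r
      simp [v, hwk, hwp]
    · simp [v, t, hwk, hwX]
  let f : MvPolynomial (Fin d) k := ∑ a, MvPolynomial.C (c a) * smallMonomial MvPolynomial.X a
  have hf : v f = 0 := by
    rw [← hc]
    simp [v, f, smallMonomial, t]
  have hfJ : f ∈ J := by
    rw [← Ideal.Quotient.eq_zero_iff_mem]
    exact (hwv f).symm.trans (by rw [hf, map_zero])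
  have := normalForm_eq_zero p t hfJ
  rw [map_sum] at this
  simpa only [normalForm_C_mul_smallMonomial, Finset.univ_sum_single] using this

end FrobeniusBasis

/-! ### Successive approximation -/

section SuccessiveApproximation
variable {A A' : Type*} [CommRing A] [CommRing A'] {M N : Type*} [AddCommGroup M] [Module A M]
  [AddCommGroup N] [Module A' N]

/-- All series `∑ x ^ k • cₖ` converge in the `x`-adic topology. The limit is not required to be
unique. -/
def IsSeqComplete (x : A) (M : Type*) [AddCommGroup M] [Module A M] : Prop :=
  ∀ c : ℕ → M, ∃ l : M, ∀ n, ∃ y : M, l = ∑ k ∈ Finset.range n, x ^ k • c k + x ^ n • y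

/-- The `x`-adic topology is separated. -/
def IsSep (x : A) (M : Type*) [AddCommGroup M] [Module A M] : Prop :=
  ∀ m : M, (∀ n, ∃ y : M, m = x ^ n • y) → m = 0

theorem mem_span_singleton_pow_smul_top {x : A} {n : ℕ} {m : M} :
    m ∈ (Ideal.span {x} ^ n • ⊤ : Submodule A M) ↔ ∃ y : M, m = x ^ n • y := by
  rw [Ideal.span_singleton_pow, Submodule.ideal_span_singleton_smul,
    Submodule.mem_smul_pointwise_iff_exists]
  exact ⟨fun ⟨y, _, h⟩ => ⟨y, h.symm⟩, fun ⟨y, h⟩ => ⟨y, trivial, h.symm⟩⟩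

theorem isSep_iff {x : A} : IsSep x M ↔ IsHausdorff (Ideal.span {x}) M := by
  constructor
  · refine fun h => ⟨fun m hm => h m fun n => ?_⟩
    exact mem_span_singleton_pow_smul_top.1 (SModEq.zero.1 (hm n))
  · intro h m hm
    exact h.haus m fun n => SModEq.zero.2 (mem_span_singleton_pow_smul_top.2 (hm n))

theorem isSeqComplete_of_isPrecomplete {x : A} (h : IsPrecomplete (Ideal.span {x}) M) :
    IsSeqComplete x M := by
  intro c
  obtain ⟨l, hl⟩ := h.prec (f := fun n => ∑ k ∈ Finset.range n, x ^ k • c k) (by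
    intro m n hmn
    rw [SModEq.sub_mem, ← neg_sub, neg_mem_iff, ← Finset.sum_Ico_eq_sub _ hmn]
    refine sum_mem fun k hk => mem_span_singleton_pow_smul_top.2 ⟨x ^ (k - m) • c k, ?_⟩
    rw [smul_smul, ← pow_add, Nat.add_sub_cancel' (Finset.mem_Ico.1 hk).1])
  refine ⟨l, fun n => ?_⟩
  have := (hl n).symm
  rw [SModEq.sub_mem, mem_span_singleton_pow_smul_top] at this
  obtain ⟨y, hy⟩ := this
  exact ⟨y, by rw [← hy]; abel⟩

theorem isPrecomplete_of_isSeqComplete {x : A} (h : IsSeqComplete x M) :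
    IsPrecomplete (Ideal.span {x}) M := by
  refine ⟨fun f hf => ?_⟩
  have h1 : ∀ n, ∃ y : M, f (n + 1) - f n = x ^ n • y := fun n => by
    rw [← mem_span_singleton_pow_smul_top, ← SModEq.sub_mem]
    exact (hf (Nat.le_succ n)).symm
  choose c hc using h1
  obtain ⟨l, hl⟩ := h c
  refine ⟨f 0 + l, fun n => ?_⟩
  obtain ⟨y, hy⟩ := hl n
  simp only [← hc, Finset.sum_range_sub] at hy
  rw [SModEq.sub_mem, mem_span_singleton_pow_smul_top]
  refine ⟨-y, ?_⟩
  rw [hy, smul_neg]; abel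

theorem IsSeqComplete.pi {x : A} (h : IsSeqComplete x M) (κ : Type*) : IsSeqComplete x (κ → M) := by
  intro c
  choose l hl using fun j => h fun k => c k j
  choose y hy using hl
  refine ⟨l, fun n => ⟨fun j => y j n, ?_⟩⟩
  ext j
  simpa using hy j n

theorem IsSep.pi {x : A} (h : IsSep x M) (κ : Type*) : IsSep x (κ → M) := by
  intro m hm
  choose y hy using hm
  ext j
  exact h _ fun n => ⟨y n j, congrFun (hy n) j⟩

theorem IsSeqComplete.equiv {x : A} (h : IsSeqComplete x M) {M' : Type*} [AddCommGroup M']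
    [Module A M'] (e : M ≃ₗ[A] M') : IsSeqComplete x M' := by
  intro c
  obtain ⟨l, hl⟩ := h fun k => e.symm (c k)
  refine ⟨e l, fun n => ?_⟩
  obtain ⟨y, hy⟩ := hl n
  exact ⟨e y, by rw [hy]; simp⟩

theorem IsSep.equiv {x : A} (h : IsSep x M) {M' : Type*} [AddCommGroup M']
    [Module A M'] (e : M ≃ₗ[A] M') : IsSep x M' := by
  intro m hm
  rw [← e.symm.map_eq_zero_iff]
  refine h _ fun n => ?_
  obtain ⟨y, rfl⟩ := hm n
  exact ⟨e.symm y, by simp⟩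

/-- Successive approximation: an additive map that intertwines `x` with `y` and is bijective modulo
`x` and `y` is bijective, if the source is complete and the target separated and `y`-torsion-free. -/
theorem bijective_of_bijective_mod {x : A} {y : A'} (Ψ : M →+ N) (hΨ : ∀ m, Ψ (x • m) = y • Ψ m)
    (hM : IsSeqComplete x M) (hM' : IsSep x M) (hN : IsSep y N) (hy : ∀ n : N, y • n = 0 → n = 0)
    (surj : ∀ n, ∃ m n', n = Ψ m + y • n') (inj : ∀ m n', Ψ m = y • n' → ∃ m', m = x • m') :
    Function.Bijective Ψ := by
  have hpow : ∀ n m, Ψ (x ^ n • m) = y ^ n • Ψ m := by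
    intro n
    induction n with
    | zero => simp
    | succ n ih => intro m; rw [pow_succ, mul_smul, ih, hΨ, pow_succ, mul_smul]
  constructor
  · refine (injective_iff_map_eq_zero Ψ).2 fun m hm => hM' m fun n => ?_
    have : ∃ m', m = x ^ n • m' ∧ Ψ m' = 0 := by
      induction n with
      | zero => exact ⟨m, by simp, hm⟩
      | succ n ih =>
        obtain ⟨m', h1, h2⟩ := ih
        obtain ⟨m'', rfl⟩ := inj m' 0 (by rw [h2, smul_zero])
        exact ⟨m'', by rw [h1, pow_succ, mul_smul], hy _ (by rw [← hΨ, h2])⟩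
    obtain ⟨m', h, -⟩ := this
    exact ⟨m', h⟩
  · intro b
    choose c r hcr using surj
    obtain ⟨l, hl⟩ := hM fun k => c (r^[k] b)
    refine ⟨l, ?_⟩
    rw [← sub_eq_zero]
    refine hN _ fun n => ?_
    obtain ⟨z, hz⟩ := hl n
    have h1 : b = Ψ (∑ k ∈ Finset.range n, x ^ k • c (r^[k] b)) + y ^ n • r^[n] b := by
      clear hz
      induction n with
      | zero => simp
      | succ n ih =>
        rw [Finset.sum_range_succ, map_add, hpow, add_assoc, pow_succ, mul_smul, ← smul_add,
          Function.iterate_succ_apply', ← hcr]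
        exact ih
    refine ⟨Ψ z - r^[n] b, ?_⟩
    rw [hz, map_add, hpow, smul_sub, eq_sub_iff_add_eq, add_comm, ← add_sub_assoc, sub_eq_iff_eq_add,
      ← add_assoc]
    nth_rewrite 3 [h1]
    abel

end SuccessiveApproximation

/-! ### The `p`-adic completion -/

section Completion
variable {p : ℕ} {R : Type*} [CommRing R]

theorem PadicCompletion.isAdicComplete :
    IsAdicComplete (Ideal.span {(p : R)}) (PadicCompletion p R) :=
  AdicCompletion.isAdicComplete ((Submodule.fg_span_singleton _))

theorem isSeqComplete_natCast {M : Type*} [AddCommGroup M] {A A' : Type*} [CommRing A]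
    [CommRing A'] [Module A M] [Module A' M] (h : IsSeqComplete (p : A) M) :
    IsSeqComplete (p : A') M := by
  simpa only [IsSeqComplete, ← Nat.cast_pow, Nat.cast_smul_eq_nsmul] using h

theorem isSep_natCast {M : Type*} [AddCommGroup M] {A A' : Type*} [CommRing A]
    [CommRing A'] [Module A M] [Module A' M] (h : IsSep (p : A) M) :
    IsSep (p : A') M := by
  simpa only [IsSep, ← Nat.cast_pow, Nat.cast_smul_eq_nsmul] using h

theorem PadicCompletion.isSeqComplete :
    IsSeqComplete (p : PadicCompletion p R) (PadicCompletion p R) :=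
  isSeqComplete_natCast (A := R)
    (isSeqComplete_of_isPrecomplete PadicCompletion.isAdicComplete.toIsPrecomplete)

theorem PadicCompletion.isSep : IsSep (p : PadicCompletion p R) (PadicCompletion p R) :=
  isSep_natCast (A := R) (isSep_iff.2 PadicCompletion.isAdicComplete.toIsHausdorff)

instance : IsAdicComplete (Ideal.span {(p : PadicCompletion p R)}) (PadicCompletion p R) where
  toIsHausdorff := isSep_iff.1 PadicCompletion.isSep
  toIsPrecomplete := isPrecomplete_of_isSeqComplete PadicCompletion.isSeqComplete

/-- `R` is dense in `R̂`. -/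
theorem PadicCompletion.exists_eq_add (n : ℕ) (x : PadicCompletion p R) :
    ∃ (r : R) (y : PadicCompletion p R), x = algebraMap R _ r + (p : PadicCompletion p R) ^ n * y := by
  obtain ⟨r, hr⟩ := Ideal.Quotient.mk_surjective (AdicCompletion.evalₐ (Ideal.span {(p : R)}) n x)
  have h : x - algebraMap R _ r ∈ (AdicCompletion.eval (Ideal.span {(p : R)}) R n).ker := by
    rw [LinearMap.mem_ker, map_sub, sub_eq_zero]
    have h0 : Ideal.span {(p : R)} ^ n ≤ Ideal.span {(p : R)} ^ n • ⊤ := by simp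
    have := congrArg (Ideal.Quotient.factor h0) hr
    rw [AdicCompletion.factor_evalₐ_eq_eval] at this
    rw [← this]
    rfl
  rw [← AdicCompletion.pow_smul_top_eq_ker_eval (Submodule.fg_span_singleton _),
    mem_span_singleton_pow_smul_top] at h
  obtain ⟨y, hy⟩ := h
  refine ⟨r, y, ?_⟩
  rw [← sub_eq_iff_eq_add', hy, Algebra.smul_def]
  simp

theorem PadicCompletion.hom_ext {A : Type*} [CommRing A] (J : Ideal A) [IsHausdorff J A]
    (hp : (p : A) ∈ J) {f g : PadicCompletion p R →+* A}
    (h : ∀ r, f (algebraMap R _ r) = g (algebraMap R _ r)) : f = g := by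
  ext x
  rw [← sub_eq_zero]
  refine IsHausdorff.haus (I := J) inferInstance _ fun n => ?_
  obtain ⟨r, y, rfl⟩ := PadicCompletion.exists_eq_add n x
  rw [SModEq.zero, map_add, map_add, h, add_sub_add_left_eq_sub, map_mul, map_mul, map_pow,
    map_pow, map_natCast, map_natCast, ← mul_sub, smul_eq_mul, Ideal.mul_top]
  exact Ideal.mul_mem_right _ _ (Ideal.pow_mem_pow hp n)

theorem PadicCompletion.exists_lift {A : Type*} [CommRing A] (J : Ideal A) [IsAdicComplete J A]
    (hp : (p : A) ∈ J) (F : R →+* A) :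
    ∃ G : PadicCompletion p R →+* A, ∀ r, G (algebraMap R _ r) = F r := by
  have hF : ∀ n, ∀ a ∈ Ideal.span {(p : R)} ^ n, ((Ideal.Quotient.mk (J ^ n)).comp F) a = 0 := by
    intro n a ha
    rw [Ideal.span_singleton_pow] at ha
    obtain ⟨b, rfl⟩ := Ideal.mem_span_singleton.1 ha
    rw [RingHom.comp_apply, Ideal.Quotient.eq_zero_iff_mem, map_mul, map_pow, map_natCast]
    exact Ideal.mul_mem_right _ _ (Ideal.pow_mem_pow hp n)
  let f : (n : ℕ) → PadicCompletion p R →+* A ⧸ J ^ n := fun n =>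
    (Ideal.Quotient.lift (Ideal.span {(p : R)} ^ n) _ (hF n)).comp
      (AdicCompletion.evalₐ (Ideal.span {(p : R)}) n : PadicCompletion p R →+* _)
  have hfr : ∀ n r, f n (algebraMap R _ r) = Ideal.Quotient.mk _ (F r) := fun n r =>
    congrArg (Ideal.Quotient.lift (Ideal.span {(p : R)} ^ n) _ (hF n))
      (AlgHom.commutes (AdicCompletion.evalₐ (Ideal.span {(p : R)}) n) r)
  have hf : ∀ {m n : ℕ} (hle : m ≤ n), (Ideal.Quotient.factorPow J hle).comp (f n) = f m := by
    intro m n hle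
    ext x
    obtain ⟨r, y, rfl⟩ := PadicCompletion.exists_eq_add n x
    have h0 : ∀ k ≤ n, f k ((p : PadicCompletion p R) ^ n) = 0 := fun k hk => by
      rw [map_pow, map_natCast, ← map_natCast (Ideal.Quotient.mk (J ^ k)), ← map_pow,
        Ideal.Quotient.eq_zero_iff_mem]
      exact Ideal.pow_le_pow_right hk (Ideal.pow_mem_pow hp n)
    rw [RingHom.comp_apply, map_add, map_add (f m), map_mul (f n), h0 n le_rfl, map_mul (f m),
      h0 m hle, hfr, hfr]
    simp
  refine ⟨IsAdicComplete.liftRingHom J f hf, fun r => ?_⟩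
  exact congrFun (IsHausdorff.funext' (R := R) J
    (f := fun r => IsAdicComplete.liftRingHom J f hf (algebraMap R _ r)) (g := F) fun n r =>
      (IsAdicComplete.mk_liftRingHom J f hf n _).trans (hfr n r)) r

end Completion

/-! ### The ring `R[[q-1]]/Φ_p(q)` -/

section CycloSeries
open PowerSeries

theorem constantCoeff_cyclo (p : ℕ) [hp : Fact p.Prime] : constantCoeff (cyclo p) = (p : ℤ) := by
  rw [cyclo, ← Polynomial.eval_one_cyclotomic_prime (R := ℤ) (p := p),
    Polynomial.aeval_def, Polynomial.hom_eval₂]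
  simp [Polynomial.eval₂_eq_eval_map]

theorem X_mul_cyclo (p : ℕ) [hp : Fact p.Prime] :
    (X : ℤ⟦X⟧) * cyclo p = (1 + X) ^ p - 1 := by
  have := congrArg (Polynomial.aeval (1 + X : ℤ⟦X⟧)) (Polynomial.cyclotomic_prime_mul_X_sub_one ℤ p)
  simp only [map_mul, map_sub, map_pow, Polynomial.aeval_X, map_one] at this
  rw [← this, cyclo]; ring

theorem exists_cyclo_eq_X_pow_add (p : ℕ) [hp : Fact p.Prime] :
    ∃ r : ℤ⟦X⟧, cyclo p = X ^ (p - 1) + (p : ℤ⟦X⟧) * r := by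
  obtain ⟨r, hr⟩ : ∃ r : ℤ⟦X⟧, (1 + X : ℤ⟦X⟧) ^ p = 1 ^ p + X ^ p + (p : ℤ⟦X⟧) * 1 * X * r :=
    ⟨_, add_pow_prime_eq hp.out 1 X⟩
  refine ⟨r, mul_left_cancel₀ (X_ne_zero : (X : ℤ⟦X⟧) ≠ 0) ?_⟩
  rw [X_mul_cyclo, hr, mul_add, ← pow_succ', Nat.sub_add_cancel hp.out.one_le]
  ring

theorem exists_cyclo_eq_add_X_mul (p : ℕ) [hp : Fact p.Prime] :
    ∃ r : ℤ⟦X⟧, cyclo p = (p : ℤ⟦X⟧) + X * r := by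
  refine ⟨mk fun n => coeff (n + 1) (cyclo p), ?_⟩
  have := eq_X_mul_shift_add_const (cyclo p)
  rw [constantCoeff_cyclo] at this
  rw [add_comm, map_natCast] at this
  exact this
end CycloSeries

section Quot
open PowerSeries
variable {p : ℕ} {R : Type*} [CommRing R]

namespace QuotCyclo

/-- The projection `R[[q-1]] → R[[q-1]]/Φ_p(q)`. -/
noncomputable abbrev mk (p : ℕ) (R : Type*) [CommRing R] : R⟦X⟧ →+* QuotCyclo p R :=
  Ideal.Quotient.mk _

/-- The class of `q - 1` in `R[[q-1]]/Φ_p(q)`. -/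
noncomputable def x (p : ℕ) (R : Type*) [CommRing R] : QuotCyclo p R := mk p R X

theorem mk_surjective : Function.Surjective (mk p R) := Ideal.Quotient.mk_surjective

theorem mk_eq_zero_iff {f : R⟦X⟧} :
    mk p R f = 0 ↔ ∃ g, f = algebraMap ℤ⟦X⟧ R⟦X⟧ (cyclo p) * g := by
  rw [Ideal.Quotient.eq_zero_iff_mem, Ideal.mem_span_singleton]
  rfl

theorem mk_cyclo : mk p R (algebraMap ℤ⟦X⟧ R⟦X⟧ (cyclo p)) = 0 :=
  mk_eq_zero_iff.2 ⟨1, by rw [mul_one]⟩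

theorem algebraMap_X' : algebraMap ℤ⟦X⟧ R⟦X⟧ X = X := by simp [algebraMap_apply'']

theorem qElt_eq : qElt p R = 1 + x p R := by simp [qElt, x]

variable [hp : Fact p.Prime]

theorem constantCoeff_algebraMap_cyclo :
    constantCoeff (algebraMap ℤ⟦X⟧ R⟦X⟧ (cyclo p)) = (p : R) := by
  refine (?_ : _ = algebraMap ℤ R (constantCoeff (cyclo p))).trans ?_
  · rfl
  · rw [constantCoeff_cyclo]; simp

/-- `p` divides `(q - 1) ^ (p - 1)`; together with `exists_natCast_eq` this says that the `p`-adic and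
the `(q-1)`-adic topologies agree. -/
theorem exists_x_pow_eq : ∃ r : QuotCyclo p R, x p R ^ (p - 1) = p * r := by
  obtain ⟨r, hr⟩ := exists_cyclo_eq_X_pow_add p
  have := congrArg (fun s => mk p R (algebraMap ℤ⟦X⟧ R⟦X⟧ s)) hr
  simp only [map_add, map_mul, map_pow, map_natCast, mk_cyclo, algebraMap_X'] at this
  exact ⟨-(mk p R (algebraMap ℤ⟦X⟧ R⟦X⟧ r)), by
    rw [mul_neg, eq_neg_iff_add_eq_zero]; exact this.symm⟩

theorem exists_natCast_eq : ∃ r : QuotCyclo p R, (p : QuotCyclo p R) = x p R * r := by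
  obtain ⟨r, hr⟩ := exists_cyclo_eq_add_X_mul p
  have := congrArg (fun s => mk p R (algebraMap ℤ⟦X⟧ R⟦X⟧ s)) hr
  simp only [map_add, map_mul, map_natCast, mk_cyclo, algebraMap_X'] at this
  exact ⟨-(mk p R (algebraMap ℤ⟦X⟧ R⟦X⟧ r)), by
    rw [mul_neg, eq_neg_iff_add_eq_zero]; exact this.symm⟩

theorem natCast_mem_span_x : (p : QuotCyclo p R) ∈ Ideal.span {x p R} :=
  Ideal.mem_span_singleton.2 exists_natCast_eq

theorem qElt_pow : qElt p R ^ p = 1 := by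
  have := congrArg (fun s => mk p R (algebraMap ℤ⟦X⟧ R⟦X⟧ s)) (X_mul_cyclo p)
  simp only [map_sub, map_mul, map_one, map_add, map_pow, mk_cyclo, algebraMap_X', mul_zero] at this
  rw [qElt_eq]
  exact (sub_eq_zero.1 this.symm)

omit hp in
theorem isSeqComplete_x : IsSeqComplete (x p R) (QuotCyclo p R) := by
  intro c
  choose f hf using fun k => mk_surjective (c k)
  have h : IsPrecomplete (Ideal.span {(X : R⟦X⟧)}) R⟦X⟧ := inferInstance
  obtain ⟨l, hl⟩ := isSeqComplete_of_isPrecomplete h f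
  refine ⟨mk p R l, fun n => ?_⟩
  obtain ⟨y, hy⟩ := hl n
  refine ⟨mk p R y, ?_⟩
  rw [hy]
  simp only [smul_eq_mul, map_add, map_sum, map_mul, map_pow, hf, x]

/-- The reduction `R[[q-1]]/Φ_p(q) → R/p` modulo `q - 1`. -/
noncomputable def eps (p : ℕ) [hp : Fact p.Prime] (R : Type*) [CommRing R] :
    QuotCyclo p R →+* R ⧸ Ideal.span {(p : R)} :=
  Ideal.Quotient.lift _ ((Ideal.Quotient.mk _).comp constantCoeff) (by
    intro a ha
    obtain ⟨b, rfl⟩ := Ideal.mem_span_singleton.1 ha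
    rw [RingHom.comp_apply, map_mul, constantCoeff_algebraMap_cyclo,
      Ideal.Quotient.eq_zero_iff_mem]
    exact Ideal.mul_mem_right _ _ (Ideal.mem_span_singleton_self _))

theorem eps_mk (f : R⟦X⟧) : eps p R (mk p R f) = Ideal.Quotient.mk _ (constantCoeff f) := rfl

theorem eps_eq_zero_iff {b : QuotCyclo p R} : eps p R b = 0 ↔ ∃ c, b = x p R * c := by
  constructor
  · obtain ⟨f, rfl⟩ := mk_surjective b
    intro h
    rw [eps_mk, Ideal.Quotient.eq_zero_iff_mem, Ideal.mem_span_singleton] at h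
    obtain ⟨r, hr⟩ := h
    obtain ⟨s, hs⟩ := exists_natCast_eq (p := p) (R := R)
    rw [eq_X_mul_shift_add_const f, hr, map_mul C, map_natCast, map_add, map_mul, map_mul,
      map_natCast, hs]
    exact ⟨_ + s * mk p R (C r), by rw [mul_add, mul_assoc]; rfl⟩
  · rintro ⟨c, rfl⟩
    rw [map_mul, x, eps_mk]; simp

end QuotCyclo
end Quot

section QuotEtale
open PowerSeries
variable {p : ℕ} [hp : Fact p.Prime] (d : ℕ) {R : Type*} [CommRing R]
  [Algebra (MvPolynomial (Fin d) ℤ) R] [Algebra.Etale (MvPolynomial (Fin d) ℤ) R]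
namespace QuotCyclo

include d

theorem natCast_mem_nonZeroDivisors : (p : R) ∈ nonZeroDivisors R := by
  have := algebraMap_mem_nonZeroDivisors (d := d) R (Nat.cast_ne_zero.2 hp.out.ne_zero)
  simpa using this

theorem x_mul_cancel {b : QuotCyclo p R} (h : x p R * b = 0) : b = 0 := by
  obtain ⟨f, rfl⟩ := mk_surjective b
  rw [x, ← map_mul, mk_eq_zero_iff] at h
  obtain ⟨g, hg⟩ := h
  have h0 := congrArg constantCoeff hg
  rw [map_mul, map_mul, constantCoeff_X, zero_mul, constantCoeff_algebraMap_cyclo] at h0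
  have h1 : constantCoeff g = 0 :=
    (mul_left_mem_nonZeroDivisors_eq_zero_iff
      (natCast_mem_nonZeroDivisors (R := R) (p := p) d)).1 h0.symm
  obtain ⟨g', rfl⟩ := X_dvd_iff.2 h1
  rw [mul_left_comm] at hg
  exact mk_eq_zero_iff.2 ⟨g', (mul_cancel_left_mem_nonZeroDivisors
    (X_mem_nonZeroDivisors (R := R))).1 hg⟩

/-- `Φ_p(q) R[[q-1]]` is closed for the `(q-1)`-adic topology, because multiplication by `Φ_p(q)` is
injective modulo `q - 1`: approximate quotients by `Φ_p(q)` converge. -/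
theorem isSep_x : IsSep (x p R) (QuotCyclo p R) := by
  intro b hb
  obtain ⟨f, rfl⟩ := mk_surjective b
  have h1 : ∀ n, ∃ g, X ^ n ∣ f - algebraMap ℤ⟦X⟧ R⟦X⟧ (cyclo p) * g := by
    intro n
    obtain ⟨y, hy⟩ := hb n
    obtain ⟨y, rfl⟩ := mk_surjective y
    rw [x, smul_eq_mul, ← map_pow, ← map_mul, ← sub_eq_zero, ← map_sub, mk_eq_zero_iff] at hy
    obtain ⟨g, hg⟩ := hy
    exact ⟨g, y, by rw [← hg]; ring⟩
  choose g hg using h1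
  have hreg : ∀ n (h : R⟦X⟧), X ^ n ∣ algebraMap ℤ⟦X⟧ R⟦X⟧ (cyclo p) * h → X ^ n ∣ h := by
    intro n
    induction n with
    | zero => simp
    | succ n ih =>
      intro h hn
      obtain ⟨h', rfl⟩ := ih h ((pow_dvd_pow _ n.le_succ).trans hn)
      obtain ⟨e, he⟩ := hn
      have : algebraMap ℤ⟦X⟧ R⟦X⟧ (cyclo p) * h' = X * e :=
        (mul_cancel_left_mem_nonZeroDivisors (pow_mem (X_mem_nonZeroDivisors (R := R)) n)).1
          (by rw [mul_left_comm, he, pow_succ, mul_assoc])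
      have h0 := congrArg constantCoeff this
      rw [map_mul, map_mul, constantCoeff_X, zero_mul, constantCoeff_algebraMap_cyclo] at h0
      have h1 : constantCoeff h' = 0 :=
        (mul_left_mem_nonZeroDivisors_eq_zero_iff
          (natCast_mem_nonZeroDivisors (R := R) (p := p) d)).1 h0
      rw [pow_succ]
      exact mul_dvd_mul_left _ (X_dvd_iff.2 h1)
  have hc : ∀ m n, m ≤ n → X ^ m ∣ g n - g m := by
    intro m n hmn
    apply hreg
    have := dvd_sub (hg m) ((pow_dvd_pow _ hmn).trans (hg n))
    rwa [sub_sub_sub_cancel_left, ← mul_sub] at this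
  refine mk_eq_zero_iff.2 ⟨PowerSeries.mk fun n => coeff n (g (n + 1)), ?_⟩
  have hl : ∀ n, X ^ n ∣ g n - PowerSeries.mk fun n => coeff n (g (n + 1)) := by
    intro n
    rw [X_pow_dvd_iff]
    intro m hm
    have := X_pow_dvd_iff.1 (hc (m + 1) n hm) m (Nat.lt_succ_self m)
    rw [map_sub] at this ⊢
    rwa [coeff_mk]
  ext n
  have h2 : X ^ (n + 1) ∣ f - algebraMap ℤ⟦X⟧ R⟦X⟧ (cyclo p) *
      PowerSeries.mk fun n => coeff n (g (n + 1)) := by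
    have := dvd_add (hg (n + 1)) (Dvd.dvd.mul_left (hl (n + 1)) (algebraMap ℤ⟦X⟧ R⟦X⟧ (cyclo p)))
    rwa [mul_sub, sub_add_sub_cancel] at this
  have := X_pow_dvd_iff.1 h2 n (Nat.lt_succ_self n)
  rwa [map_sub, sub_eq_zero] at this

theorem isAdicComplete_x : IsAdicComplete (Ideal.span {x p R}) (QuotCyclo p R) where
  toIsHausdorff := isSep_iff.1 (isSep_x d)
  toIsPrecomplete := isPrecomplete_of_isSeqComplete isSeqComplete_x

theorem natCast_mul_cancel {b : QuotCyclo p R} (h : (p : QuotCyclo p R) * b = 0) : b = 0 := by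
  obtain ⟨r, hr⟩ := exists_x_pow_eq (p := p) (R := R)
  have h1 : x p R ^ (p - 1) * b = 0 := by rw [hr, mul_right_comm, h, zero_mul]
  generalize p - 1 = n at h1
  induction n with
  | zero => simpa using h1
  | succ n ih => exact ih (x_mul_cancel d (by rw [← mul_assoc, ← pow_succ']; exact h1))

theorem isSep_natCast_self : IsSep (p : QuotCyclo p R) (QuotCyclo p R) := by
  intro b hb
  refine isSep_x d b fun n => ?_
  obtain ⟨y, hy⟩ := hb n
  obtain ⟨r, hr⟩ := exists_natCast_eq (p := p) (R := R)
  exact ⟨r ^ n * y, by rw [hy, hr, smul_eq_mul, smul_eq_mul, mul_pow, mul_assoc]⟩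

/-- `Tᵢ` is a non-zero-divisor on `R/p`, by flatness over `ℤ[T₁, …, T_d]`. -/
theorem natCast_dvd_of_dvd_coord_mul (i : Fin d) {a : R} (h : (p : R) ∣ coord R i * a) :
    (p : R) ∣ a := by
  obtain ⟨b, hb⟩ := h
  have : Module.Flat (MvPolynomial (Fin d) ℤ) R := inferInstance
  have h0 : ∑ j : Fin 2, (![MvPolynomial.X i, -(p : MvPolynomial (Fin d) ℤ)] : Fin 2 → _) j •
      (![a, b] : Fin 2 → R) j = 0 := by
    simp only [Fin.sum_univ_two, Matrix.cons_val_zero, Matrix.cons_val_one, Algebra.smul_def,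
      map_neg, map_natCast, neg_mul, ← hb]
    exact add_neg_cancel _
  obtain ⟨k, e, y, h1, h2⟩ := Module.Flat.isTrivialRelation_of_sum_smul_eq_zero
    (R := MvPolynomial (Fin d) ℤ) (M := R) h0
  have h3 : ∀ j, (p : MvPolynomial (Fin d) ℤ) ∣ e 0 j := by
    intro j
    have h := h2 j
    simp only [Fin.sum_univ_two, Matrix.cons_val_zero, Matrix.cons_val_one, neg_mul] at h
    have hd : (p : MvPolynomial (Fin d) ℤ) ∣ MvPolynomial.X i * e 0 j :=
      ⟨e 1 j, add_neg_eq_zero.1 h⟩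
    have hC : (p : MvPolynomial (Fin d) ℤ) = MvPolynomial.C (p : ℤ) := by simp
    have hprime : Prime (p : MvPolynomial (Fin d) ℤ) := by
      rw [hC, MvPolynomial.prime_C_iff]
      exact Nat.prime_iff_prime_int.1 hp.out
    refine (hprime.dvd_or_dvd hd).resolve_left fun hX => ?_
    rw [hC, MvPolynomial.C_dvd_iff_dvd_coeff] at hX
    have := hX (Finsupp.single i 1)
    rw [MvPolynomial.coeff_X, if_pos rfl] at this
    exact (Nat.prime_iff_prime_int.1 hp.out).not_dvd_one this
  have h4 := h1 0
  simp only [Matrix.cons_val_zero] at h4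
  rw [h4]
  refine Finset.dvd_sum fun j _ => ?_
  obtain ⟨c, hc⟩ := h3 j
  exact ⟨c • y j, by rw [hc, Algebra.smul_def, Algebra.smul_def, map_mul, map_natCast, mul_assoc]⟩

theorem coord_mul_cancel (i : Fin d) {b : QuotCyclo p R}
    (h : mk p R (C (coord R i)) * b = 0) : b = 0 := by
  refine isSep_x d b fun n => ?_
  suffices ∃ y, b = x p R ^ n • y ∧ mk p R (C (coord R i)) * y = 0 by
    obtain ⟨y, hy, -⟩ := this
    exact ⟨y, hy⟩
  induction n with
  | zero => exact ⟨b, by simp, h⟩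
  | succ n ih =>
    obtain ⟨y, hy, hy'⟩ := ih
    obtain ⟨z, rfl⟩ : ∃ z, y = x p R * z := by
      rw [← eps_eq_zero_iff]
      have h1 := congrArg (eps p R) hy'
      obtain ⟨r, hr⟩ := Ideal.Quotient.mk_surjective (eps p R y)
      rw [map_mul, eps_mk, constantCoeff_C, ← hr, ← map_mul, map_zero,
        Ideal.Quotient.eq_zero_iff_mem, Ideal.mem_span_singleton] at h1
      rw [← hr, Ideal.Quotient.eq_zero_iff_mem, Ideal.mem_span_singleton]
      exact natCast_dvd_of_dvd_coord_mul d i h1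
    refine ⟨z, by rw [hy, smul_eq_mul, smul_eq_mul, pow_succ, mul_assoc], x_mul_cancel d ?_⟩
    rw [mul_left_comm]; exact hy'

end QuotCyclo
end QuotEtale

/-! ### The lift of Frobenius -/

section FrobeniusLift
variable {p : ℕ} [hp : Fact p.Prime] {d : ℕ} {R : Type*} [CommRing R]
  [Algebra (MvPolynomial (Fin d) ℤ) R] [Algebra.Etale (MvPolynomial (Fin d) ℤ) R]

variable (p d R) in
/-- The composite of `R → R̂/p` with the Frobenius lifts to `R̂`, with prescribed values on the
coordinates, by étaleness; the lift extends to `R̂` by completeness. -/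
theorem exists_isFrobeniusLift :
    ∃ φ : PadicCompletion p R →+* PadicCompletion p R, IsFrobeniusLift p d φ := by
  let Rh := PadicCompletion p R
  let I := Ideal.span {(p : Rh)}
  have hpI : (p : Rh) ∈ I := Ideal.mem_span_singleton_self _
  have hk : (p : Rh ⧸ I) = 0 := by
    rw [← map_natCast (Ideal.Quotient.mk I)]
    exact Ideal.Quotient.eq_zero_iff_mem.2 hpI
  obtain ⟨F, hF, hF'⟩ := exists_framed_lift (R := R) I
    (fun i : Fin d => algebraMap R Rh (coord R i) ^ p)
    ((frob p _ hk).comp ((Ideal.Quotient.mk I).comp (algebraMap R Rh)))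
    (fun i => (map_pow (Ideal.Quotient.mk I) _ _).symm)
  obtain ⟨φ, hφ⟩ := PadicCompletion.exists_lift I hpI F
  refine ⟨φ, fun i => by rw [hφ, hF], fun x => ?_⟩
  obtain ⟨r, y, rfl⟩ := PadicCompletion.exists_eq_add 1 x
  rw [← Ideal.mem_span_singleton, ← Ideal.Quotient.eq, map_pow]
  change _ = frob p _ hk _
  have hy : ∀ z : Rh, Ideal.Quotient.mk I ((p : Rh) ^ 1 * z) = 0 := fun z => by
    rw [pow_one, map_mul, map_natCast, hk, zero_mul]
  have hφy : φ ((p : Rh) ^ 1 * y) = (p : Rh) ^ 1 * φ y := by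
    rw [map_mul, map_pow, map_natCast]
  rw [map_add, map_add, map_add (Ideal.Quotient.mk _), hφy]
  refine (congrArg₂ (· + ·) (congrArg _ (hφ r)) (hy _)).trans ?_
  refine Eq.trans ?_ (congrArg (frob p _ hk) (congrArg₂ (· + ·) rfl (hy y))).symm
  rw [add_zero, add_zero]
  exact hF' r

omit hp in
theorem IsFrobeniusLift.unique {φ φ' : PadicCompletion p R →+* PadicCompletion p R}
    (h : IsFrobeniusLift p d φ) (h' : IsFrobeniusLift p d φ') : φ' = φ := by
  let I := Ideal.span {(p : PadicCompletion p R)}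
  refine PadicCompletion.hom_ext I (Ideal.mem_span_singleton_self _) fun r => ?_
  refine RingHom.congr_fun (f := φ'.comp (algebraMap R _)) (g := φ.comp (algebraMap R _))
    (framed_hom_ext (d := d) I _ _ (fun i => ?_) fun r => ?_) r
  · exact (h'.coord i).trans (h.coord i).symm
  · rw [Ideal.mem_span_singleton]
    have := dvd_sub (h'.frob (algebraMap R _ r)) (h.frob (algebraMap R _ r))
    rwa [sub_sub_sub_cancel_right] at this

end FrobeniusLift

/-! ### The identification `R̂[ζ_p] = R[[q-1]]/Φ_p(q)` -/

section Identification
open PowerSeries QuotCyclo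
variable {p : ℕ} [hp : Fact p.Prime] (d : ℕ) {R : Type*} [CommRing R]

omit hp in
theorem PadicCyclo.isSeqComplete :
    IsSeqComplete (p : PadicCompletion p R) (PadicCyclo p R) := by
  have e := (AdjoinRoot.powerBasis'
    (Polynomial.cyclotomic.monic p (PadicCompletion p R))).basis.equivFun
  exact (PadicCompletion.isSeqComplete.pi _).equiv e.symm

omit hp in
theorem PadicCyclo.isSep : IsSep (p : PadicCompletion p R) (PadicCyclo p R) := by
  have e := (AdjoinRoot.powerBasis'
    (Polynomial.cyclotomic.monic p (PadicCompletion p R))).basis.equivFun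
  exact (PadicCompletion.isSep.pi _).equiv e.symm

omit hp in
variable (p R) in
/-- `q` is a root of `Φ_p` in `R[[q-1]]/Φ_p(q)`. -/
theorem cyclo_eval_qElt (f : PadicCompletion p R →+* QuotCyclo p R) :
    (Polynomial.cyclotomic p (PadicCompletion p R)).eval₂ f (qElt p R) = 0 := by
  have h1 : (Polynomial.cyclotomic p (PadicCompletion p R)).eval₂ f (qElt p R) =
      (Polynomial.cyclotomic p ℤ).eval₂ (Int.castRingHom _) (qElt p R) := by
    rw [← Polynomial.map_cyclotomic_int, Polynomial.eval₂_map]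
    congr 1
    exact RingHom.ext_int _ _
  have h2 : mk p R (algebraMap ℤ⟦X⟧ R⟦X⟧ (cyclo p)) =
      (Polynomial.cyclotomic p ℤ).eval₂ (Int.castRingHom _) (qElt p R) := by
    refine (Polynomial.hom_eval₂ (Polynomial.cyclotomic p ℤ) (algebraMap ℤ ℤ⟦X⟧)
      ((mk p R).comp (algebraMap ℤ⟦X⟧ R⟦X⟧)) (1 + X)).trans ?_
    congr 1
    · exact RingHom.ext_int _ _
    · rw [map_add, map_one, RingHom.comp_apply, algebraMap_X']; rfl
  rw [h1, ← h2, mk_cyclo]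

omit hp in
theorem algebraMap_quotCyclo (r : R) : algebraMap R (QuotCyclo p R) r = mk p R (C r) := rfl

variable [Algebra (MvPolynomial (Fin d) ℤ) R] [Algebra.Etale (MvPolynomial (Fin d) ℤ) R]

include d in
/-- A map `R̂[ζ_p] → R[[q-1]]/Φ_p(q)` over `R` with `ζ_p ↦ q`. -/
theorem exists_padicCyclo_hom : ∃ f : PadicCyclo p R →ₐ[R] QuotCyclo p R,
    f (AdjoinRoot.root _) = qElt p R := by
  have := isAdicComplete_x (p := p) (R := R) d
  obtain ⟨g, hg⟩ := PadicCompletion.exists_lift (p := p) (Ideal.span {x p R}) natCast_mem_span_x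
    (algebraMap R (QuotCyclo p R))
  refine ⟨{ AdjoinRoot.lift g (qElt p R) (cyclo_eval_qElt p R g) with
    commutes' := fun r => ?_ }, AdjoinRoot.lift_root (cyclo_eval_qElt p R g)⟩
  exact (AdjoinRoot.lift_of (cyclo_eval_qElt p R g)).trans (hg r)

include d in
theorem padicCyclo_hom_ext {f g : PadicCyclo p R →ₐ[R] QuotCyclo p R}
    (hf : f (AdjoinRoot.root _) = qElt p R) (hg : g (AdjoinRoot.root _) = qElt p R) : f = g := by
  have := isAdicComplete_x (p := p) (R := R) d
  have h : (f : PadicCyclo p R →+* QuotCyclo p R).comp (AdjoinRoot.of _) =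
      (g : PadicCyclo p R →+* QuotCyclo p R).comp (AdjoinRoot.of _) := by
    refine PadicCompletion.hom_ext (Ideal.span {x p R}) natCast_mem_span_x fun r => ?_
    exact (f.commutes r).trans (g.commutes r).symm
  refine AlgHom.ext fun y => ?_
  induction y using AdjoinRoot.induction_on with
  | ih P =>
  induction P using Polynomial.induction_on' with
  | add P Q h1 h2 => rw [map_add, map_add, map_add, h1, h2]
  | monomial n a =>
    rw [← Polynomial.C_mul_X_pow_eq_monomial, map_mul, map_pow, AdjoinRoot.mk_X, map_mul, map_mul,
      map_pow, map_pow, hf, hg]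
    congr 1
    exact RingHom.congr_fun h a

omit hp in
theorem padicCyclo_hom_aeval {f : PadicCyclo p R →ₐ[R] QuotCyclo p R}
    (hf : f (AdjoinRoot.root _) = qElt p R) (P : Polynomial R) :
    f (Polynomial.aeval (AdjoinRoot.root _ - 1) P) = mk p R P := by
  rw [← Polynomial.aeval_algHom_apply, map_sub, hf, map_one, qElt_eq, add_sub_cancel_left]
  induction P using Polynomial.induction_on' with
  | add P Q h1 h2 => rw [map_add, h1, h2, Polynomial.coe_add, map_add]
  | monomial n a =>
    rw [← Polynomial.C_mul_X_pow_eq_monomial, Polynomial.coe_mul, Polynomial.coe_pow,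
      Polynomial.coe_C, Polynomial.coe_X, map_mul, map_mul, map_pow, map_pow, Polynomial.aeval_C,
      Polynomial.aeval_X]
    rfl

/-- Surjectivity of the comparison modulo `p`: there `(q - 1) ^ (p - 1)` vanishes, so truncating a power
series to a polynomial of degree below `p - 1` does not change its class. -/
theorem padicCyclo_hom_surj {f : PadicCyclo p R →ₐ[R] QuotCyclo p R}
    (hf : f (AdjoinRoot.root _) = qElt p R) (b : QuotCyclo p R) :
    ∃ m b', b = f m + (p : QuotCyclo p R) * b' := by
  obtain ⟨s, rfl⟩ := mk_surjective b
  obtain ⟨r, hr⟩ := exists_x_pow_eq (p := p) (R := R)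
  refine ⟨Polynomial.aeval (AdjoinRoot.root _ - 1) (trunc (p - 1) s),
    r * mk p R (PowerSeries.mk fun i => coeff (i + (p - 1)) s), ?_⟩
  rw [padicCyclo_hom_aeval hf, ← mul_assoc, ← hr, x, ← map_pow, ← map_mul, ← map_add]
  congr 1
  rw [add_comm]
  exact eq_X_pow_mul_shift_add_trunc (p - 1) s

/-- Injectivity of the comparison modulo `p`, where `Φ_p(q)` becomes `(q - 1) ^ (p - 1)`. -/
theorem padicCyclo_hom_inj {f : PadicCyclo p R →ₐ[R] QuotCyclo p R}
    (hf : f (AdjoinRoot.root _) = qElt p R) (m : PadicCyclo p R) (b' : QuotCyclo p R)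
    (h : f m = (p : QuotCyclo p R) * b') :
    ∃ m', m = (p : PadicCompletion p R) • m' := by
  let ζ : PadicCyclo p R := AdjoinRoot.root _
  let pb := AdjoinRoot.powerBasis' (Polynomial.cyclotomic.monic p (PadicCompletion p R))
  have hdim : pb.dim ≤ p - 1 := by
    rw [AdjoinRoot.powerBasis'_dim]
    nontriviality PadicCompletion p R
    rw [Polynomial.natDegree_cyclotomic, Nat.totient_prime hp.out]
  choose r y hry using fun k => PadicCompletion.exists_eq_add 1 (pb.basis.repr m k)
  let Q : Polynomial R := ∑ k : Fin pb.dim, Polynomial.C (r k) * Polynomial.X ^ (k : ℕ)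
  let P : Polynomial R := Q.comp (Polynomial.X + 1)
  have hQdeg : Q.natDegree ≤ p - 2 :=
    Polynomial.natDegree_sum_le_of_forall_le _ _ fun k _ =>
      (Polynomial.natDegree_C_mul_X_pow_le _ _).trans (by have := k.2; omega)
  have hPdeg : P.natDegree ≤ p - 2 := by
    refine Polynomial.natDegree_comp_le.trans ?_
    have : (Polynomial.X + 1 : Polynomial R).natDegree ≤ 1 := by compute_degree
    calc _ ≤ (p - 2) * 1 := Nat.mul_le_mul hQdeg this
      _ = _ := mul_one _
  have hm : m = Polynomial.aeval (ζ - 1) P + (p : PadicCyclo p R) * ∑ k, y k • ζ ^ (k : ℕ) := by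
    rw [Polynomial.aeval_comp]
    simp only [map_add, Polynomial.aeval_X, map_one, sub_add_cancel, Q, map_sum, map_mul,
      Polynomial.aeval_C, map_pow]
    rw [Finset.mul_sum, ← Finset.sum_add_distrib]
    conv_lhs => rw [← pb.basis.sum_repr m]
    refine Finset.sum_congr rfl fun k _ => ?_
    rw [hry, pb.basis_eq_pow, add_smul, pow_one, mul_smul, Algebra.smul_def (algebraMap R _ (r k)),
      Algebra.smul_def (p : PadicCompletion p R), map_natCast]
    rfl
  have hP : ∃ b, mk p R P = (p : QuotCyclo p R) * b := by
    refine ⟨b' - f (∑ k, y k • ζ ^ (k : ℕ)), ?_⟩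
    rw [← padicCyclo_hom_aeval hf, mul_sub, ← h, hm, map_add, map_mul, map_natCast]
    exact (add_sub_cancel_right _ _).symm
  have hPcoeff : ∀ i, (p : R) ∣ P.coeff i := by
    intro i
    by_cases hi : i < p - 1
    · obtain ⟨b, hb⟩ := hP
      obtain ⟨b, rfl⟩ := mk_surjective b
      rw [← map_natCast (mk p R), ← map_mul, ← sub_eq_zero, ← map_sub, mk_eq_zero_iff] at hb
      obtain ⟨g, hg⟩ := hb
      obtain ⟨s, hs⟩ := exists_cyclo_eq_X_pow_add p
      have h1 : (P : R⟦X⟧) = (p : R⟦X⟧) * (b + algebraMap ℤ⟦X⟧ R⟦X⟧ s * g) + X ^ (p - 1) * g := by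
        rw [sub_eq_iff_eq_add] at hg
        rw [hg, hs, map_add, map_mul, map_pow, map_natCast, algebraMap_X']
        ring
      have h2 := congrArg (coeff i) h1
      rw [Polynomial.coeff_coe, map_add, coeff_X_pow_mul', if_neg (by omega), add_zero,
        ← map_natCast (C (R := R)), coeff_C_mul] at h2
      exact ⟨_, h2⟩
    · have := hp.out.two_le
      rw [Polynomial.coeff_eq_zero_of_natDegree_lt (by omega)]
      exact dvd_zero _
  obtain ⟨P', hP'⟩ := (Polynomial.C_dvd_iff_dvd_coeff _ _).2 hPcoeff
  refine ⟨Polynomial.aeval (ζ - 1) P' + ∑ k, y k • ζ ^ (k : ℕ), ?_⟩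
  rw [hm, hP', map_mul, Polynomial.aeval_C, map_natCast, ← mul_add,
    Algebra.smul_def (p : PadicCompletion p R), map_natCast]

include d in
/-- The identification `R̂[ζ_p] = R[[q-1]]/Φ_p(q)`. -/
theorem exists_padicCyclo_equiv : ∃ ι : PadicCyclo p R ≃ₐ[R] QuotCyclo p R,
    ι (AdjoinRoot.root _) = qElt p R := by
  obtain ⟨f, hf⟩ := exists_padicCyclo_hom (p := p) (R := R) d
  have hbij : Function.Bijective (f : PadicCyclo p R →+ QuotCyclo p R) := by
    refine bijective_of_bijective_mod (x := (p : PadicCompletion p R)) (y := (p : QuotCyclo p R))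
      _ (fun m => ?_) PadicCyclo.isSeqComplete PadicCyclo.isSep (isSep_natCast_self d)
      (fun b hb => natCast_mul_cancel d hb) (padicCyclo_hom_surj hf) (padicCyclo_hom_inj hf)
    change f ((p : PadicCompletion p R) • m) = _
    rw [Algebra.smul_def, map_natCast, map_mul, map_natCast]
    rfl
  exact ⟨AlgEquiv.ofBijective f hbij, hf⟩

end Identification

/-! ### The twisted Frobenius and expansions in monomials -/

section
open PowerSeries

theorem cycloMap_of {A B : Type*} [CommRing A] [CommRing B] (p : ℕ) (f : A →+* B) (a : A) :
    cycloMap p f (AdjoinRoot.of _ a) = AdjoinRoot.of _ (f a) :=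
  AdjoinRoot.map_of f (Polynomial.cyclotomic p A) (Polynomial.cyclotomic p B)
    (by rw [Polynomial.map_cyclotomic]) a

theorem cycloMap_root {A B : Type*} [CommRing A] [CommRing B] (p : ℕ) (f : A →+* B) :
    cycloMap p f (AdjoinRoot.root _) = AdjoinRoot.root _ :=
  AdjoinRoot.map_root f (Polynomial.cyclotomic p A) (Polynomial.cyclotomic p B)
    (by rw [Polynomial.map_cyclotomic])

namespace QuotCyclo

/-- The class of `Tᵢ` in `R[[q-1]]/Φ_p(q)`. -/
noncomputable def T (p : ℕ) {d : ℕ} (R : Type*) [CommRing R] [Algebra (MvPolynomial (Fin d) ℤ) R]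
    (i : Fin d) : QuotCyclo p R := mk p R (C (coord R i))

section
variable {p : ℕ} [hp : Fact p.Prime] {d : ℕ} {R : Type*} [CommRing R]
  [Algebra (MvPolynomial (Fin d) ℤ) R]

/-- An endomorphism of `R[[q-1]]/Φ_p(q)` that fixes `q`, sends `Tᵢ` to `Tᵢ ^ p` and is the Frobenius
modulo `q - 1`. -/
structure IsTwistedFrobenius (d : ℕ) [Algebra (MvPolynomial (Fin d) ℤ) R]
    (F : QuotCyclo p R →+* QuotCyclo p R) : Prop where
  map_x : F (x p R) = x p R
  map_T : ∀ i : Fin d, F (T p R i) = T p R i ^ p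
  eps_map : ∀ b, eps p R (F b) = eps p R b ^ p

/-- The Frobenius lift `φ` on `R̂[ζ_p]` gives a twisted Frobenius on `R[[q-1]]/Φ_p(q)`. -/
theorem isTwistedFrobenius {φ : PadicCompletion p R →+* PadicCompletion p R}
    (hφ : IsFrobeniusLift p d φ) (ι : PadicCyclo p R ≃ₐ[R] QuotCyclo p R)
    (hι : ι (AdjoinRoot.root _) = qElt p R) :
    IsTwistedFrobenius d ((ι : PadicCyclo p R →+* QuotCyclo p R).comp
      ((cycloMap p φ).comp (ι.symm : QuotCyclo p R →+* PadicCyclo p R))) := by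
  have hof : ∀ z : PadicCompletion p R, cycloMap p φ (AdjoinRoot.of _ z) =
      AdjoinRoot.of _ (φ z) := cycloMap_of p φ
  have halg : ∀ r, ι.symm (mk p R (C r)) = AdjoinRoot.of _ (algebraMap R _ r) := fun r =>
    ι.symm.commutes r
  have halg' : ∀ r, ι (AdjoinRoot.of _ (algebraMap R _ r)) = mk p R (C r) := fun r =>
    ι.commutes r
  set F := (ι : PadicCyclo p R →+* QuotCyclo p R).comp
      ((cycloMap p φ).comp (ι.symm : QuotCyclo p R →+* PadicCyclo p R)) with hF
  have hFa : ∀ b, F b = ι (cycloMap p φ (ι.symm b)) := fun _ => rfl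
  have hx : F (x p R) = x p R := by
    have h1 : ι.symm (qElt p R) = AdjoinRoot.root _ := by rw [← hι, AlgEquiv.symm_apply_apply]
    have h2 : F (qElt p R) = qElt p R := by
      rw [hFa, h1, ← hι]
      exact congrArg ι (cycloMap_root p φ)
    rw [qElt_eq, map_add, map_one] at h2
    exact add_left_cancel h2
  refine ⟨hx, fun i => ?_, fun b => ?_⟩
  · rw [hFa, T, halg, hof, hφ.coord, map_pow, map_pow, halg']
  · obtain ⟨f, rfl⟩ := mk_surjective b
    rw [eq_X_mul_shift_add_const f]
    have hX : eps p R (x p R) = 0 := eps_eq_zero_iff.2 ⟨1, (mul_one _).symm⟩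
    have hX' : eps p R (mk p R X) = 0 := hX
    have hFX : F (mk p R X) = mk p R X := hx
    simp only [map_add, map_mul, hFX, hX', zero_mul, zero_add]
    obtain ⟨z, hz⟩ := hφ.frob (algebraMap R _ (constantCoeff f))
    rw [hFa, halg, hof, sub_eq_iff_eq_add.1 hz, map_add, map_add, map_add, map_mul, map_natCast,
      map_mul, map_natCast, map_mul, map_natCast, map_pow, map_pow, map_pow, halg']
    have : ((p : ℕ) : R ⧸ Ideal.span {(p : R)}) = 0 := by
      rw [← map_natCast (Ideal.Quotient.mk _)]
      exact Ideal.Quotient.eq_zero_iff_mem.2 (Ideal.mem_span_singleton_self _)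
    rw [this, zero_mul, zero_add]

/-- The monomials `T ^ a` with exponents `0 ≤ aᵢ < p`. -/
noncomputable def mono (p : ℕ) {d : ℕ} (R : Type*) [CommRing R]
    [Algebra (MvPolynomial (Fin d) ℤ) R] (a : Fin d → Fin p) : QuotCyclo p R :=
  smallMonomial (T p R) a

/-- `(c_a) ↦ ∑ F(c_a) T ^ a` -/
noncomputable def expansion (F : QuotCyclo p R →+* QuotCyclo p R) :
    ((Fin d → Fin p) → QuotCyclo p R) →+ QuotCyclo p R where
  toFun c := ∑ a, F (c a) * mono p R a
  map_zero' := by simp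
  map_add' c e := by simp [add_mul, Finset.sum_add_distrib]

variable [Algebra.Etale (MvPolynomial (Fin d) ℤ) R]

omit [Algebra.Etale (MvPolynomial (Fin d) ℤ) R] in
theorem eps_mono (a : Fin d → Fin p) : eps p R (mono p R a) =
    smallMonomial (fun i => Ideal.Quotient.mk (Ideal.span {(p : R)}) (coord R i)) a := by
  simp only [mono, smallMonomial, map_prod, map_pow, T, eps_mk, constantCoeff_C]

/-- The monomials `T ^ a` with exponents below `p` form a basis of `R[[q-1]]/Φ_p(q)` over the image
of `F`, and `F` is injective: modulo `q - 1` this is the corresponding fact for the Frobenius of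
`R/p`. -/
theorem expansion_bijective {F : QuotCyclo p R →+* QuotCyclo p R} (hF : IsTwistedFrobenius d F) :
    Function.Bijective (expansion (d := d) F) := by
  have hk : ((p : ℕ) : R ⧸ Ideal.span {(p : R)}) = 0 := by
    rw [← map_natCast (Ideal.Quotient.mk _)]
    exact Ideal.Quotient.eq_zero_iff_mem.2 (Ideal.mem_span_singleton_self _)
  have heps : ∀ c : (Fin d → Fin p) → QuotCyclo p R, eps p R (expansion F c) =
      ∑ a, eps p R (c a) ^ p *
        smallMonomial (fun i => Ideal.Quotient.mk (Ideal.span {(p : R)}) (coord R i)) a := by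
    intro c
    change eps p R (∑ a, F (c a) * mono p R a) = _
    simp only [map_sum, map_mul, eps_mono, hF.eps_map]
  refine bijective_of_bijective_mod (x := x p R) (y := x p R) _ (fun c => ?_)
    (isSeqComplete_x.pi _) ((isSep_x d).pi _) (isSep_x d) (fun b hb => x_mul_cancel d hb)
    (fun b => ?_) (fun c b h => ?_)
  · change ∑ a, F (x p R * c a) * mono p R a = x p R * ∑ a, F (c a) * mono p R a
    simp only [map_mul, hF.map_x, Finset.mul_sum, mul_assoc]
  · obtain ⟨c, hc⟩ := exists_sum_pow_mul_smallMonomial (d := d) hk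
      (Ideal.Quotient.mk (Ideal.span {(p : R)})) Ideal.Quotient.mk_surjective (eps p R b)
    choose r hr using fun a => Ideal.Quotient.mk_surjective (c a)
    have : eps p R (b - expansion F fun a => mk p R (C (r a))) = 0 := by
      rw [map_sub, heps, hc, sub_eq_zero]
      refine Finset.sum_congr rfl fun a _ => ?_
      rw [eps_mk, constantCoeff_C, hr]
    obtain ⟨b', hb'⟩ := eps_eq_zero_iff.1 this
    exact ⟨_, b', sub_eq_iff_eq_add'.1 hb'⟩
  · have h0 := eq_zero_of_sum_pow_mul_smallMonomial (d := d) hk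
      (Ideal.Quotient.mk (Ideal.span {(p : R)})) Ideal.Quotient.mk_surjective
      (fun r hr => Ideal.mem_span_singleton.1 (Ideal.Quotient.eq_zero_iff_mem.1 hr))
      (fun a => eps p R (c a)) (by
        rw [← heps, h]
        exact eps_eq_zero_iff.2 ⟨b, rfl⟩)
    choose c' hc' using fun a => eps_eq_zero_iff.1 (congrFun h0 a)
    exact ⟨c', funext hc'⟩

omit hp [Algebra (MvPolynomial (Fin d) ℤ) R] [Algebra.Etale (MvPolynomial (Fin d) ℤ) R] in
/-- Ring maps out of `R[[q-1]]/Φ_p(q)` to a separated ring are determined on `R` and `q`. -/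
theorem hom_ext {A : Type*} [CommRing A] {y : A} (hy : IsSep y A) {f g : QuotCyclo p R →+* A}
    (hf : f (x p R) = y) (hg : g (x p R) = y)
    (h : ∀ r, f (mk p R (C r)) = g (mk p R (C r))) : f = g := by
  have key : ∀ (n : ℕ) (s : R⟦X⟧), ∃ c, f (mk p R s) - g (mk p R s) = y ^ n • c := by
    intro n
    induction n with
    | zero => intro s; exact ⟨_, by rw [pow_zero, one_smul]⟩
    | succ n ih =>
      intro s
      obtain ⟨c, hc⟩ := ih (PowerSeries.mk fun i => coeff (i + 1) s)
      refine ⟨c, ?_⟩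
      rw [eq_X_mul_shift_add_const s]
      simp only [map_add, map_mul, h]
      have hf' : f (mk p R X) = y := hf
      have hg' : g (mk p R X) = y := hg
      rw [hf', hg', add_sub_add_right_eq_sub, ← mul_sub, hc, pow_succ', smul_eq_mul, smul_eq_mul,
        mul_assoc]
  refine RingHom.ext fun b => ?_
  obtain ⟨s, rfl⟩ := mk_surjective b
  rw [← sub_eq_zero]
  exact hy _ fun n => key n s

omit hp in
theorem gamma_mk (i : Fin d) (f : R⟦X⟧) :
    (qDeRhamMod d R p).γ i (mk p R f) = mk p R (gamma R i f) := rfl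

omit hp in
theorem del_mk (i : Fin d) (f : R⟦X⟧) :
    (qDeRhamMod d R p).del i (mk p R f) = mk p R (qderiv R i f) := rfl

omit hp in
theorem gamma_x (i : Fin d) : (qDeRhamMod d R p).γ i (x p R) = x p R := by
  rw [x, gamma_mk, algHom_X]

omit hp in
theorem gamma_T_self (i : Fin d) : (qDeRhamMod d R p).γ i (T p R i) = qElt p R * T p R i := by
  rw [T, gamma_mk, gamma_coord_self, map_mul]; rfl

omit hp in
theorem gamma_T_of_ne {i j : Fin d} (h : j ≠ i) : (qDeRhamMod d R p).γ i (T p R j) = T p R j := by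
  rw [T, gamma_mk, gamma_coord_of_ne R h]

theorem eps_gamma (i : Fin d) (b : QuotCyclo p R) :
    eps p R ((qDeRhamMod d R p).γ i b) = eps p R b := by
  obtain ⟨f, rfl⟩ := mk_surjective b
  rw [gamma_mk, eps_mk, eps_mk, constantCoeff_gamma]

omit hp in
theorem x_mul_T_mul_del (i : Fin d) (b : QuotCyclo p R) :
    x p R * T p R i * (qDeRhamMod d R p).del i b = (qDeRhamMod d R p).γ i b - b := by
  obtain ⟨f, rfl⟩ := mk_surjective b
  rw [gamma_mk, del_mk, ← map_sub, ← qderiv_spec', map_mul, map_mul]; rfl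

theorem x_mul_T_cancel {i : Fin d} {b c : QuotCyclo p R}
    (h : x p R * T p R i * b = x p R * T p R i * c) : b = c := by
  rw [← sub_eq_zero, ← mul_sub, mul_assoc] at h
  exact sub_eq_zero.1 (coord_mul_cancel d i (x_mul_cancel d h))

/-- The `γᵢ` act trivially on the image of `F`: they fix `F(Tⱼ) = Tⱼ ^ p` because `q ^ p = 1`, and they
are trivial modulo `q - 1`, so the étale lifting property applies. -/
theorem IsTwistedFrobenius.gamma_map {F : QuotCyclo p R →+* QuotCyclo p R}
    (hF : IsTwistedFrobenius d F) (i : Fin d) (b : QuotCyclo p R) :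
    (qDeRhamMod d R p).γ i (F b) = F b := by
  have := isAdicComplete_x (p := p) (R := R) d
  let G : QuotCyclo p R →+* QuotCyclo p R := (qDeRhamMod d R p).γ i
  refine RingHom.congr_fun (f := G.comp F) (g := F) (hom_ext (isSep_x d) (y := x p R) ?_ hF.map_x
    fun r => ?_) b
  · rw [RingHom.comp_apply, hF.map_x]; exact gamma_x i
  · refine RingHom.congr_fun (f := (G.comp F).comp ((QuotCyclo.mk p R).comp C))
      (g := F.comp ((QuotCyclo.mk p R).comp C)) (framed_hom_ext (d := d) (Ideal.span {x p R}) _ _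
      (fun j => ?_) fun r => ?_) r
    · change (qDeRhamMod d R p).γ i (F (T p R j)) = F (T p R j)
      rw [hF.map_T, map_pow]
      by_cases h : j = i
      · subst h; rw [gamma_T_self, mul_pow, qElt_pow, one_mul]
      · rw [gamma_T_of_ne h]
    · rw [Ideal.mem_span_singleton]
      change x p R ∣ (qDeRhamMod d R p).γ i (F _) - F _
      obtain ⟨c, hc⟩ := eps_eq_zero_iff.1
        (show eps p R ((qDeRhamMod d R p).γ i (F (QuotCyclo.mk p R (C r))) -
        F (QuotCyclo.mk p R (C r))) = 0 by rw [map_sub, eps_gamma, sub_self])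
      exact ⟨c, hc⟩

theorem IsTwistedFrobenius.del_map {F : QuotCyclo p R →+* QuotCyclo p R}
    (hF : IsTwistedFrobenius d F) (i : Fin d) (b : QuotCyclo p R) :
    (qDeRhamMod d R p).del i (F b) = 0 := by
  apply x_mul_T_cancel (i := i)
  rw [x_mul_T_mul_del, hF.gamma_map, sub_self, mul_zero]

theorem IsTwistedFrobenius.del_map_mul {F : QuotCyclo p R →+* QuotCyclo p R}
    (hF : IsTwistedFrobenius d F) (i : Fin d) (b c : QuotCyclo p R) :
    (qDeRhamMod d R p).del i (F b * c) = F b * (qDeRhamMod d R p).del i c := by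
  rw [TwistedDerivations.del_mul, hF.del_map, zero_mul, zero_add]

end
end QuotCyclo

end

/-! ### `q`-derivatives and `q`-integrals of monomials -/

namespace QuotCyclo

section Exponents
variable {p d : ℕ}

/-- The exponent `a` with `aᵢ` lowered by one. -/
def down (i : Fin d) (a : Fin d → Fin p) : Fin d → Fin p :=
  Function.update a i ⟨a i - 1, (Nat.sub_le _ _).trans_lt (a i).2⟩

/-- The exponent `a` with `aᵢ` raised by one. -/
def up (i : Fin d) (a : Fin d → Fin p) (h : (a i : ℕ) + 1 < p) : Fin d → Fin p :=
  Function.update a i ⟨a i + 1, h⟩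

theorem up_self (i : Fin d) (a : Fin d → Fin p) (h) : ((up i a h) i : ℕ) = a i + 1 := by
  simp [up]

theorem down_self (i : Fin d) (a : Fin d → Fin p) : ((down i a) i : ℕ) = a i - 1 := by
  simp [down]

theorem up_of_ne {i j : Fin d} (hj : j ≠ i) (a : Fin d → Fin p) (h) : (up i a h) j = a j := by
  simp [up, hj]

theorem down_of_ne {i j : Fin d} (hj : j ≠ i) (a : Fin d → Fin p) : (down i a) j = a j := by
  simp [down, hj]

end Exponents

section QInt
variable {p : ℕ} {R : Type*} [CommRing R]

variable (p R) in
/-- The `q`-integer `1 + q + ⋯ + q ^ (n - 1)`. -/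
noncomputable def qInt (n : ℕ) : QuotCyclo p R := ∑ k ∈ Finset.range n, qElt p R ^ k

theorem x_mul_qInt (n : ℕ) : x p R * qInt p R n = qElt p R ^ n - 1 := by
  rw [qInt, ← mul_geom_sum, qElt_eq, add_sub_cancel_left]

/-- The `q`-integer of `n` reduces to `n` modulo `q - 1`, hence is a unit if `n` is prime to `p`. -/
theorem isUnit_qInt [hp : Fact p.Prime] {n : ℕ} (h0 : n ≠ 0) (hn : n < p)
    (hc : IsAdicComplete (Ideal.span {x p R}) (QuotCyclo p R)) : IsUnit (qInt p R n) := by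
  have hX : eps p R (x p R) = 0 := eps_eq_zero_iff.2 ⟨1, (mul_one _).symm⟩
  have hcop : IsCoprime (n : ℤ) (p : ℤ) :=
    Nat.isCoprime_iff_coprime.2 ((hp.out.coprime_iff_not_dvd.2
      (Nat.not_dvd_of_pos_of_lt (Nat.pos_of_ne_zero h0) hn)).symm)
  obtain ⟨m, l, hml⟩ := hcop
  have hpk : ((p : ℕ) : R ⧸ Ideal.span {(p : R)}) = 0 := by
    rw [← map_natCast (Ideal.Quotient.mk _)]
    exact Ideal.Quotient.eq_zero_iff_mem.2 (Ideal.mem_span_singleton_self _)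
  have h1 : eps p R (qInt p R n * m - 1) = 0 := by
    have := congrArg (Int.cast : ℤ → R ⧸ Ideal.span {(p : R)}) hml
    push_cast at this
    rw [hpk, mul_zero, add_zero] at this
    rw [map_sub, map_mul, map_intCast, map_one, ← this, qInt, map_sum]
    simp only [map_pow, qElt_eq, map_add, map_one, hX, add_zero, one_pow, Finset.sum_const,
      Finset.card_range, nsmul_eq_mul, mul_one]
    ring
  obtain ⟨c, hc'⟩ := eps_eq_zero_iff.1 h1
  have hj : x p R ∈ Ideal.jacobson (⊥ : Ideal (QuotCyclo p R)) :=
    IsAdicComplete.le_jacobson_bot _ (Ideal.mem_span_singleton_self _)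
  have := Ideal.mem_jacobson_bot.1 hj c
  rw [← hc', sub_add_cancel] at this
  exact isUnit_of_mul_isUnit_left this

end QInt

section
variable {p : ℕ} [hp : Fact p.Prime] {d : ℕ} {R : Type*} [CommRing R]
  [Algebra (MvPolynomial (Fin d) ℤ) R]

theorem IsTwistedFrobenius.map_qInt {F : QuotCyclo p R →+* QuotCyclo p R}
    (hF : IsTwistedFrobenius d F) (n : ℕ) : F (qInt p R n) = qInt p R n := by
  simp only [qInt, map_sum, map_pow, qElt_eq, map_add, map_one, hF.map_x]

omit hp in
theorem mono_update (a : Fin d → Fin p) (i : Fin d) (n : Fin p) :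
    mono p R (Function.update a i n) =
      T p R i ^ (n : ℕ) * ∏ j ∈ Finset.univ.erase i, T p R j ^ (a j : ℕ) := by
  rw [mono, smallMonomial, ← Finset.mul_prod_erase _ _ (Finset.mem_univ i), Function.update_self]
  congr 1
  refine Finset.prod_congr rfl fun j hj => ?_
  rw [Function.update_of_ne (Finset.ne_of_mem_erase hj)]

omit hp in
theorem mono_eq (a : Fin d → Fin p) (i : Fin d) :
    mono p R a = T p R i ^ (a i : ℕ) * ∏ j ∈ Finset.univ.erase i, T p R j ^ (a j : ℕ) := by
  rw [← mono_update, Function.update_eq_self]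

variable [Algebra.Etale (MvPolynomial (Fin d) ℤ) R]

theorem del_eq_zero_of_gamma_eq {i : Fin d} {b : QuotCyclo p R}
    (h : (qDeRhamMod d R p).γ i b = b) : (qDeRhamMod d R p).del i b = 0 := by
  apply x_mul_T_cancel (i := i)
  rw [x_mul_T_mul_del, h, sub_self, mul_zero]

theorem del_T_pow_succ (i : Fin d) (n : ℕ) :
    (qDeRhamMod d R p).del i (T p R i ^ (n + 1)) = qInt p R (n + 1) * T p R i ^ n := by
  apply x_mul_T_cancel (i := i)
  rw [x_mul_T_mul_del, map_pow, gamma_T_self, mul_pow]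
  calc _ = (qElt p R ^ (n + 1) - 1) * T p R i ^ (n + 1) := by ring
    _ = _ := by rw [← x_mul_qInt]; ring

theorem del_T_pow_mul_prod (i : Fin d) (n : ℕ) (a : Fin d → Fin p) :
    (qDeRhamMod d R p).del i (T p R i ^ (n + 1) *
        ∏ j ∈ Finset.univ.erase i, T p R j ^ (a j : ℕ)) =
      qInt p R (n + 1) * (T p R i ^ n * ∏ j ∈ Finset.univ.erase i, T p R j ^ (a j : ℕ)) := by
  have h : (qDeRhamMod d R p).γ i (∏ j ∈ Finset.univ.erase i, T p R j ^ (a j : ℕ)) =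
      ∏ j ∈ Finset.univ.erase i, T p R j ^ (a j : ℕ) := by
    rw [map_prod]
    refine Finset.prod_congr rfl fun j hj => ?_
    rw [map_pow, gamma_T_of_ne (Finset.ne_of_mem_erase hj)]
  rw [TwistedDerivations.del_mul, h, del_eq_zero_of_gamma_eq h, mul_zero, add_zero, del_T_pow_succ,
    mul_assoc]

theorem del_mono_of_eq_zero {i : Fin d} {a : Fin d → Fin p} (h : (a i : ℕ) = 0) :
    (qDeRhamMod d R p).del i (mono p R a) = 0 := by
  apply del_eq_zero_of_gamma_eq
  rw [mono_eq a i, h, pow_zero, one_mul, map_prod]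
  refine Finset.prod_congr rfl fun j hj => ?_
  rw [map_pow, gamma_T_of_ne (Finset.ne_of_mem_erase hj)]

theorem del_mono {i : Fin d} {a : Fin d → Fin p} (h : (a i : ℕ) ≠ 0) :
    (qDeRhamMod d R p).del i (mono p R a) = qInt p R (a i) * mono p R (down i a) := by
  obtain ⟨n, hn⟩ := Nat.exists_eq_succ_of_ne_zero h
  have hn' : (a i : ℕ) - 1 = n := by omega
  have hd : mono p R (down i a) = T p R i ^ ((a i : ℕ) - 1) *
      ∏ j ∈ Finset.univ.erase i, T p R j ^ (a j : ℕ) := mono_update _ _ _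
  rw [mono_eq a i, hd, hn', hn, Nat.succ_eq_add_one, del_T_pow_mul_prod]

section Coefficients
variable {F : QuotCyclo p R →+* QuotCyclo p R} (hF : IsTwistedFrobenius d F)

include hF in
theorem IsTwistedFrobenius.del_mono {i : Fin d} {a : Fin d → Fin p} (h : (a i : ℕ) ≠ 0) :
    (qDeRhamMod d R p).del i (mono p R a) = F (qInt p R (a i)) * mono p R (down i a) := by
  rw [hF.map_qInt, QuotCyclo.del_mono h]

/-- Every `b` has a unique expansion `b = ∑ F(c_a) T ^ a`. -/
noncomputable def expansionEquiv : ((Fin d → Fin p) → QuotCyclo p R) ≃+ QuotCyclo p R :=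
  AddEquiv.ofBijective (expansion F) (expansion_bijective hF)

/-- The coefficient `c_a` in the expansion `b = ∑ F(c_a) T ^ a`. -/
noncomputable def fcoeff (a : Fin d → Fin p) : QuotCyclo p R →+ QuotCyclo p R :=
  (Pi.evalAddMonoidHom (fun _ => QuotCyclo p R) a).comp (expansionEquiv hF).symm.toAddMonoidHom

theorem sum_fcoeff (b : QuotCyclo p R) : ∑ a, F (fcoeff hF a b) * mono p R a = b :=
  (expansionEquiv hF).apply_symm_apply b

theorem fcoeff_sum (c : (Fin d → Fin p) → QuotCyclo p R) (a : Fin d → Fin p) :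
    fcoeff hF a (∑ a, F (c a) * mono p R a) = c a :=
  congrFun ((expansionEquiv hF).symm_apply_apply c) a

theorem fcoeff_mul_mono (c : QuotCyclo p R) (a e : Fin d → Fin p) :
    fcoeff hF a (F c * mono p R e) = if a = e then c else 0 := by
  have : F c * mono p R e = ∑ a, F ((Pi.single e c : (Fin d → Fin p) → QuotCyclo p R) a) *
      mono p R a := by
    rw [Finset.sum_eq_single e]
    · rw [Pi.single_eq_same]
    · intro a _ ha; rw [Pi.single_eq_of_ne ha, map_zero, zero_mul]
    · simp
  rw [this, fcoeff_sum, Pi.single_apply]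

theorem ext_fcoeff {b c : QuotCyclo p R} (h : ∀ a, fcoeff hF a b = fcoeff hF a c) : b = c := by
  rw [← sum_fcoeff hF b, ← sum_fcoeff hF c]
  simp only [h]

include hF in
/-- Additive maps that are linear over the image of `F` are determined by their values on the
monomials `T ^ a`. -/
theorem addHom_ext {f g : QuotCyclo p R →+ QuotCyclo p R}
    (hf : ∀ c b, f (F c * b) = F c * f b) (hg : ∀ c b, g (F c * b) = F c * g b)
    (h : ∀ a : Fin d → Fin p, f (mono p R a) = g (mono p R a)) (b : QuotCyclo p R) :
    f b = g b := by
  rw [← sum_fcoeff hF b, map_sum, map_sum]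
  exact Finset.sum_congr rfl fun a _ => by rw [hf, hg, h]

/-- The map that is linear over the image of `F` and sends `T ^ a` to `V a`. -/
noncomputable def ofMono (V : (Fin d → Fin p) → QuotCyclo p R) : QuotCyclo p R →+ QuotCyclo p R where
  toFun b := ∑ a, F (fcoeff hF a b) * V a
  map_zero' := by simp
  map_add' b c := by simp [add_mul, Finset.sum_add_distrib]

theorem fcoeff_mul (c b : QuotCyclo p R) (a : Fin d → Fin p) :
    fcoeff hF a (F c * b) = c * fcoeff hF a b := by
  conv_lhs => rw [← sum_fcoeff hF b, Finset.mul_sum]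
  simp only [← mul_assoc, ← map_mul]
  rw [fcoeff_sum]

theorem ofMono_mul (V : (Fin d → Fin p) → QuotCyclo p R) (c b : QuotCyclo p R) :
    ofMono hF V (F c * b) = F c * ofMono hF V b := by
  change ∑ a, _ = F c * ∑ a, _
  simp only [fcoeff_mul, map_mul, Finset.mul_sum, mul_assoc]

theorem ofMono_mono (V : (Fin d → Fin p) → QuotCyclo p R) (e : Fin d → Fin p) :
    ofMono hF V (mono p R e) = V e := by
  change ∑ a, _ = _
  have h : ∀ a, fcoeff hF a (mono p R e) = if a = e then 1 else 0 := fun a => by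
    rw [← fcoeff_mul_mono hF, map_one, one_mul]
  rw [Finset.sum_eq_single e]
  · rw [h, if_pos rfl, map_one, one_mul]
  · intro a _ ha; rw [h, if_neg ha, map_zero, zero_mul]
  · simp

open Classical in
/-- The projection onto the span of the monomials `T ^ a` for which `P a` holds. -/
noncomputable def proj (P : (Fin d → Fin p) → Prop) : QuotCyclo p R →+ QuotCyclo p R :=
  ofMono hF fun a => if P a then mono p R a else 0

open Classical in
theorem fcoeff_proj (P : (Fin d → Fin p) → Prop) (a : Fin d → Fin p) (b : QuotCyclo p R) :
    fcoeff hF a (proj hF P b) = if P a then fcoeff hF a b else 0 := by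
  change fcoeff hF a (∑ e, F (fcoeff hF e b) * (if P e then mono p R e else 0)) = _
  rw [map_sum, Finset.sum_eq_single a]
  · split_ifs
    · rw [fcoeff_mul_mono, if_pos rfl]
    · rw [mul_zero, map_zero]
  · intro e _ he
    split_ifs
    · rw [fcoeff_mul_mono, if_neg he.symm]
    · rw [mul_zero, map_zero]
  · simp

/-- The `q`-integral in the variable `Tᵢ`: it sends `T ^ a` to `[aᵢ + 1]_q⁻¹ T ^ a Tᵢ` if
`aᵢ + 1 < p` and to `0` if `aᵢ = p - 1`. -/
noncomputable def qIntegral (i : Fin d) : QuotCyclo p R →+ QuotCyclo p R :=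
  ofMono hF fun a => if h : (a i : ℕ) + 1 < p then
    Ring.inverse (qInt p R (a i + 1)) * mono p R (up i a h) else 0

include hF in
theorem map_inverse_qInt {n : ℕ} (h0 : n ≠ 0) (hn : n < p) :
    F (Ring.inverse (qInt p R n)) = Ring.inverse (qInt p R n) := by
  have hu := isUnit_qInt (R := R) h0 hn (isAdicComplete_x d)
  refine hu.mul_left_cancel ?_
  rw [Ring.mul_inverse_cancel _ hu]
  nth_rewrite 1 [← hF.map_qInt n]
  rw [← map_mul, Ring.mul_inverse_cancel _ hu, map_one]

theorem qIntegral_mono {i : Fin d} {a : Fin d → Fin p} (h : (a i : ℕ) + 1 < p) :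
    qIntegral hF i (mono p R a) =
      F (Ring.inverse (qInt p R (a i + 1))) * mono p R (up i a h) := by
  rw [qIntegral, ofMono_mono, dif_pos h, map_inverse_qInt hF (Nat.succ_ne_zero _) h]

theorem qIntegral_mono_of_eq {i : Fin d} {a : Fin d → Fin p} (h : (a i : ℕ) + 1 = p) :
    qIntegral hF i (mono p R a) = 0 := by
  rw [qIntegral, ofMono_mono, dif_neg h.not_lt]

theorem qIntegral_mul (i : Fin d) (c b : QuotCyclo p R) :
    qIntegral hF i (F c * b) = F c * qIntegral hF i b := ofMono_mul _ _ _ _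

/-- The `q`-integral inverts `∂ᵢ` up to the monomials without `Tᵢ`. -/
theorem qIntegral_del (i : Fin d) (b : QuotCyclo p R) :
    qIntegral hF i ((qDeRhamMod d R p).del i b) = b - proj hF (fun a => (a i : ℕ) = 0) b := by
  refine addHom_ext hF (f := (qIntegral hF i).comp ((qDeRhamMod d R p).del i).toAddMonoidHom)
    (g := AddMonoidHom.id _ - proj hF (fun a => (a i : ℕ) = 0)) (fun c b => ?_) (fun c b => ?_)
    (fun a => ?_) b
  · simp [hF.del_map_mul, qIntegral_mul]
  · simp [proj, ofMono_mul, mul_sub]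
  · simp only [AddMonoidHom.comp_apply, LinearMap.toAddMonoidHom_coe, AddMonoidHom.sub_apply,
      AddMonoidHom.id_apply, proj, ofMono_mono]
    by_cases h : (a i : ℕ) = 0
    · rw [del_mono_of_eq_zero h, map_zero, if_pos h, sub_self]
    · have h1 : ((down i a) i : ℕ) + 1 = a i := by rw [down_self]; omega
      have h2 : ((down i a) i : ℕ) + 1 < p := h1.trans_lt (a i).2
      rw [hF.del_mono h, if_neg h, sub_zero, qIntegral_mul, qIntegral_mono hF h2,
        ← mul_assoc, ← map_mul, h1,
        Ring.mul_inverse_cancel _ (isUnit_qInt h (a i).2 (isAdicComplete_x d)), map_one, one_mul]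
      congr 1
      funext j
      by_cases hj : j = i
      · subst hj; ext; rw [up_self, h1]
      · rw [up_of_ne hj, down_of_ne hj]

/-- `∂ᵢ` inverts the `q`-integral up to the monomials with exponent `p - 1` in `Tᵢ`, which are not
`q`-derivatives. -/
theorem del_qIntegral (i : Fin d) (b : QuotCyclo p R) :
    (qDeRhamMod d R p).del i (qIntegral hF i b) =
      b - proj hF (fun a => (a i : ℕ) + 1 = p) b := by
  refine addHom_ext hF (f := ((qDeRhamMod d R p).del i).toAddMonoidHom.comp (qIntegral hF i))
    (g := AddMonoidHom.id _ - proj hF (fun a => (a i : ℕ) + 1 = p)) (fun c b => ?_) (fun c b => ?_)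
    (fun a => ?_) b
  · simp [hF.del_map_mul, qIntegral_mul]
  · simp [proj, ofMono_mul, mul_sub]
  · simp only [AddMonoidHom.comp_apply, LinearMap.toAddMonoidHom_coe, AddMonoidHom.sub_apply,
      AddMonoidHom.id_apply, proj, ofMono_mono]
    by_cases h : (a i : ℕ) + 1 = p
    · rw [qIntegral_mono_of_eq hF h, map_zero, if_pos h, sub_self]
    · have h2 : (a i : ℕ) + 1 < p := lt_of_le_of_ne (a i).2 h
      rw [qIntegral_mono hF h2, if_neg h, sub_zero, hF.del_map_mul,
        hF.del_mono (by rw [up_self]; omega), ← mul_assoc, ← map_mul, up_self,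
        Ring.inverse_mul_cancel _ (isUnit_qInt (Nat.succ_ne_zero _) h2 (isAdicComplete_x d)), map_one,
        one_mul]
      congr 1
      funext j
      by_cases hj : j = i
      · subst hj; ext; rw [down_self, up_self, Nat.add_sub_cancel]
      · rw [down_of_ne hj, up_of_ne hj]

theorem del_qIntegral_of_ne {i j : Fin d} (hij : j ≠ i) (b : QuotCyclo p R) :
    (qDeRhamMod d R p).del j (qIntegral hF i b) = qIntegral hF i ((qDeRhamMod d R p).del j b) := by
  refine addHom_ext hF (f := ((qDeRhamMod d R p).del j).toAddMonoidHom.comp (qIntegral hF i))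
    (g := (qIntegral hF i).comp ((qDeRhamMod d R p).del j).toAddMonoidHom) (fun c b => ?_)
    (fun c b => ?_) (fun a => ?_) b
  · simp [hF.del_map_mul, qIntegral_mul]
  · simp [hF.del_map_mul, qIntegral_mul]
  · simp only [AddMonoidHom.comp_apply, LinearMap.toAddMonoidHom_coe]
    by_cases hi : (a i : ℕ) + 1 = p <;> by_cases hj : (a j : ℕ) = 0
    · rw [qIntegral_mono_of_eq hF hi, map_zero, del_mono_of_eq_zero hj, map_zero]
    · rw [qIntegral_mono_of_eq hF hi, map_zero, hF.del_mono hj, qIntegral_mul,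
        qIntegral_mono_of_eq hF (by rwa [down_of_ne hij.symm]), mul_zero]
    · have hi : (a i : ℕ) + 1 < p := lt_of_le_of_ne (a i).2 hi
      rw [qIntegral_mono hF hi, hF.del_map_mul, del_mono_of_eq_zero hj,
        del_mono_of_eq_zero (by rwa [up_of_ne hij]), mul_zero, map_zero]
    · have hi : (a i : ℕ) + 1 < p := lt_of_le_of_ne (a i).2 hi
      have hi' : ((down j a) i : ℕ) + 1 < p := by rwa [down_of_ne hij.symm]
      rw [qIntegral_mono hF hi, hF.del_map_mul, hF.del_mono hj,
        hF.del_mono (by rwa [up_of_ne hij]), qIntegral_mul, qIntegral_mono hF hi', up_of_ne hij,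
        mul_left_comm, down_of_ne hij.symm]
      have : down j (up i a hi) = up i (down j a) hi' := by
        funext k
        by_cases hki : k = i
        · subst hki; ext; rw [down_of_ne hij.symm, up_self, up_self, down_of_ne hij.symm]
        · by_cases hkj : k = j
          · subst hkj; ext; rw [down_self, up_of_ne hij, up_of_ne hij, down_self]
          · rw [down_of_ne hkj, up_of_ne hki, up_of_ne hki, down_of_ne hkj]
      rw [this]

theorem fcoeff_del {i : Fin d} {a : Fin d → Fin p} (h : (a i : ℕ) + 1 = p) (b : QuotCyclo p R) :
    fcoeff hF a ((qDeRhamMod d R p).del i b) = 0 := by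
  rw [← sum_fcoeff hF b, map_sum, map_sum]
  refine Finset.sum_eq_zero fun e _ => ?_
  rw [hF.del_map_mul]
  by_cases he : (e i : ℕ) = 0
  · rw [del_mono_of_eq_zero he, mul_zero, map_zero]
  · rw [hF.del_mono he, ← mul_assoc, ← map_mul, fcoeff_mul_mono, if_neg]
    rintro rfl
    rw [down_self] at h
    have := (e i).2
    omega

end Coefficients
end
end QuotCyclo

/-! ### The exterior algebra of forms -/

namespace FormAlgebra
variable {d : ℕ}

/-- The elements of `s`, in increasing order. -/
def idx {n : ℕ} (s : Set.powersetCard (Fin d) n) : List (Fin d) :=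
  List.ofFn (Set.powersetCard.ofFinEmbEquiv.symm s)

theorem mem_idx {n : ℕ} (s : Set.powersetCard (Fin d) n) (i : Fin d) :
    i ∈ idx s ↔ i ∈ (s : Finset (Fin d)) := by
  rw [idx, List.mem_ofFn']
  exact Set.powersetCard.mem_range_ofFinEmbEquiv_symm_iff_mem s i

theorem nodup_idx {n : ℕ} (s : Set.powersetCard (Fin d) n) : (idx s).Nodup :=
  List.nodup_ofFn.2 (Set.powersetCard.ofFinEmbEquiv.symm s).injective

/-- The basis `dT_I = dT_{i₁} ∧ ⋯ ∧ dT_{iₙ}` of the algebra of forms, where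
`I = {i₁ < ⋯ < iₙ}`. -/
noncomputable def basis (d : ℕ) : Module.Basis (Finset (Fin d)) ℤ (FormAlgebra d) :=
  (Pi.basisFun ℤ (Fin d)).ExteriorAlgebra

theorem basis_eq_ιMulti_family {n : ℕ} (s : Set.powersetCard (Fin d) n) :
    basis d s = (exteriorPower.ιMulti_family ℤ n
      (fun i : Fin d => (Pi.single i 1 : Fin d → ℤ)) s : ⋀[ℤ]^n (Fin d → ℤ)) := by
  rw [basis, ExteriorAlgebra.basis_apply_powersetCard, exteriorPower.ιMulti_family_apply_coe]
  congr 1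
  ext
  simp

theorem basis_eq_prod {n : ℕ} (s : Set.powersetCard (Fin d) n) :
    basis d s = ((idx s).map dT).prod := by
  rw [basis_eq_ιMulti_family, exteriorPower.ιMulti_family_apply_coe, ExteriorAlgebra.ιMulti_family,
    ExteriorAlgebra.ιMulti_apply, idx, List.map_ofFn]
  rfl

/-- The coefficient of `dT_I`. -/
noncomputable def formCoord (I : Finset (Fin d)) : FormAlgebra d →ₗ[ℤ] ℤ := (basis d).coord I

theorem formCoord_basis (I J : Finset (Fin d)) :
    formCoord I (basis d J) = if J = I then 1 else 0 := by
  simp [formCoord, Finsupp.single_apply]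

theorem sum_formCoord (ω : FormAlgebra d) : ∑ I, formCoord I ω • basis d I = ω :=
  (basis d).sum_repr ω

theorem formCoord_of_mem {n : ℕ} {ω : FormAlgebra d} (h : ω ∈ ⋀[ℤ]^n (Fin d → ℤ))
    {I : Finset (Fin d)} (hI : I.card ≠ n) : formCoord I ω = 0 := by
  have h1 := ((Pi.basisFun ℤ (Fin d)).exteriorPower n).sum_repr ⟨ω, h⟩
  have h2 := congrArg (Subtype.val) h1
  simp only [AddSubmonoidClass.coe_finsetSum, SetLike.val_smul] at h2
  rw [← h2, map_sum]
  refine Finset.sum_eq_zero fun s _ => ?_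
  rw [map_smul, ← ExteriorAlgebra.basis_eq_coe_basis]
  change _ • formCoord I (basis d s) = 0
  rw [formCoord_basis, if_neg, smul_zero]
  rintro rfl
  exact hI s.2

theorem basis_mem (I : Finset (Fin d)) : basis d I ∈ ⋀[ℤ]^I.card (Fin d → ℤ) := by
  have := basis_eq_ιMulti_family (⟨I, rfl⟩ : Set.powersetCard (Fin d) I.card)
  change basis d I = _ at this
  rw [this]
  exact Subtype.mem _

/-- The contraction with the vector field dual to `dT_i`. -/
noncomputable def contract (i : Fin d) : FormAlgebra d →ₗ[ℤ] FormAlgebra d :=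
  CliffordAlgebra.contractLeft (LinearMap.proj i)

theorem contract_dT_mul (i j : Fin d) (ω : FormAlgebra d) :
    contract i (dT j * ω) = (if j = i then ω else 0) - dT j * contract i ω := by
  refine (CliffordAlgebra.contractLeft_ι_mul _ _ _).trans ?_
  congr 1
  by_cases h : j = i
  · subst h; simp
  · simp [h]

theorem contract_one (i : Fin d) : contract i 1 = 0 :=
  CliffordAlgebra.contractLeft_one (Q := (0 : QuadraticForm ℤ (Fin d → ℤ))) _

/-- The operator `ω ↦ dT_i ∧ ι_i ω`, the projection onto the span of the `dT_I` with `i ∈ I`. -/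
noncomputable def numOp (i : Fin d) : FormAlgebra d →ₗ[ℤ] FormAlgebra d :=
  LinearMap.mulLeft ℤ (dT i) ∘ₗ contract i

theorem numOp_apply (i : Fin d) (ω : FormAlgebra d) : numOp i ω = dT i * contract i ω := rfl

theorem numOp_dT_mul_self (i : Fin d) (ω : FormAlgebra d) : numOp i (dT i * ω) = dT i * ω := by
  rw [numOp_apply, contract_dT_mul, if_pos rfl, mul_sub, ← mul_assoc, dT_mul_self, zero_mul,
    sub_zero]

theorem numOp_dT_mul_of_ne {i j : Fin d} (h : j ≠ i) (ω : FormAlgebra d) :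
    numOp i (dT j * ω) = dT j * numOp i ω := by
  rw [numOp_apply, contract_dT_mul, if_neg h, zero_sub, mul_neg, ← mul_assoc, numOp_apply,
    ← mul_assoc, ← neg_mul, neg_eq_of_add_eq_zero_right (dT_anticomm i j)]

theorem numOp_prod (i : Fin d) (l : List (Fin d)) :
    numOp i (l.map dT).prod = if i ∈ l then (l.map dT).prod else 0 := by
  induction l with
  | nil => simp [numOp_apply, contract_one]
  | cons j l ih =>
    rw [List.map_cons, List.prod_cons]
    by_cases h : j = i
    · subst h; rw [numOp_dT_mul_self, if_pos List.mem_cons_self]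
    · rw [numOp_dT_mul_of_ne h, ih]
      have : i ∈ j :: l ↔ i ∈ l := by simp [Ne.symm h]
      rw [mul_ite, mul_zero]
      simp only [this]

theorem numOp_basis (i : Fin d) (I : Finset (Fin d)) :
    numOp i (basis d I) = if i ∈ I then basis d I else 0 := by
  have h1 := basis_eq_prod (⟨I, rfl⟩ : Set.powersetCard (Fin d) I.card)
  have h2 := mem_idx (⟨I, rfl⟩ : Set.powersetCard (Fin d) I.card) i
  change basis d I = _ at h1
  change _ ↔ i ∈ I at h2
  simp only [h1, numOp_prod, h2]

theorem formCoord_numOp (i : Fin d) (I : Finset (Fin d)) (ω : FormAlgebra d) :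
    formCoord I (numOp i ω) = if i ∈ I then formCoord I ω else 0 := by
  have : formCoord I ∘ₗ numOp i = if i ∈ I then formCoord I else 0 := by
    refine (basis d).ext fun J => ?_
    rw [LinearMap.comp_apply, numOp_basis]
    by_cases hJ : i ∈ J <;> by_cases hI : i ∈ I
    · rw [if_pos hJ, if_pos hI]
    · rw [if_pos hJ, if_neg hI, formCoord_basis, if_neg (by rintro rfl; exact hI hJ)]; rfl
    · rw [if_neg hJ, if_pos hI, formCoord_basis, if_neg (by rintro rfl; exact hJ hI), map_zero]
    · rw [if_neg hJ, if_neg hI, map_zero]; rfl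
  have := LinearMap.congr_fun this ω
  rw [LinearMap.comp_apply] at this
  rw [this]
  split_ifs <;> rfl

theorem formCoord_dT_mul {i : Fin d} {I : Finset (Fin d)} (h : i ∉ I) (ω : FormAlgebra d) :
    formCoord I (dT i * ω) = 0 := by
  rw [← numOp_dT_mul_self, formCoord_numOp, if_neg h]

end FormAlgebra

/-! ### Coefficients of forms, and homotopies in one variable -/

namespace TwistedDerivations
open FormAlgebra
variable {S B : Type*} [CommRing S] [CommRing B] [Algebra S B] {d : ℕ}
  (q : TwistedDerivations S B d)

/-- The operator `f ω ↦ φ(f) ψ(ω)`. -/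
noncomputable def op (φ : B →+ B) (ψ : FormAlgebra d →ₗ[ℤ] FormAlgebra d) : q.Forms →+ q.Forms :=
  (TensorProduct.map φ.toIntLinearMap ψ :
    B ⊗[ℤ] FormAlgebra d →ₗ[ℤ] B ⊗[ℤ] FormAlgebra d).toAddMonoidHom

theorem op_form (φ : B →+ B) (ψ : FormAlgebra d →ₗ[ℤ] FormAlgebra d) (b : B) (ω : FormAlgebra d) :
    q.op φ ψ (q.form b ω) = q.form (φ b) (ψ ω) := rfl

/-- The coefficient of `dT_I` in a form. -/
noncomputable def coef (I : Finset (Fin d)) : q.Forms →ₗ[B] B :=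
  ((TensorProduct.AlgebraTensorModule.rid ℤ B B).toLinearMap ∘ₗ
    TensorProduct.AlgebraTensorModule.map LinearMap.id (formCoord I) :
      B ⊗[ℤ] FormAlgebra d →ₗ[B] B)

theorem coef_form (I : Finset (Fin d)) (b : B) (ω : FormAlgebra d) :
    q.coef I (q.form b ω) = formCoord I ω • b := rfl

theorem coef_form_basis (I J : Finset (Fin d)) (b : B) :
    q.coef I (q.form b (basis d J)) = if J = I then b else 0 := by
  rw [coef_form, formCoord_basis]
  split_ifs <;> simp

theorem form_zsmul (n : ℤ) (b : B) (ω : FormAlgebra d) :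
    q.form b (n • ω) = q.form (n • b) ω := (TensorProduct.smul_tmul n b ω).symm

theorem zero_form (ω : FormAlgebra d) : q.form 0 ω = 0 := TensorProduct.zero_tmul _ _

theorem sub_form (b c : B) (ω : FormAlgebra d) : q.form (b - c) ω = q.form b ω - q.form c ω :=
  TensorProduct.sub_tmul _ _ _

theorem form_sub (b : B) (ω η : FormAlgebra d) : q.form b (ω - η) = q.form b ω - q.form b η :=
  TensorProduct.tmul_sub _ _ _

theorem form_sum {α : Type*} (s : Finset α) (b : B) (f : α → FormAlgebra d) :
    q.form b (∑ k ∈ s, f k) = ∑ k ∈ s, q.form b (f k) := TensorProduct.tmul_sum _ _ _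

theorem sum_coef (x : q.Forms) : ∑ I, q.form (q.coef I x) (basis d I) = x := by
  induction x using form_induction with
  | h0 => simp [zero_form]
  | hf b ω =>
    conv_rhs => rw [← sum_formCoord ω, form_sum]
    refine Finset.sum_congr rfl fun I _ => ?_
    rw [coef_form, form_zsmul]
  | ha x y hx hy =>
    simp only [map_add, add_form, Finset.sum_add_distrib, hx, hy]

theorem ext_coef {x y : q.Forms} (h : ∀ I, q.coef I x = q.coef I y) : x = y := by
  rw [← q.sum_coef x, ← q.sum_coef y]
  simp only [h]

theorem coef_sum_form (c : Finset (Fin d) → B) (I : Finset (Fin d)) :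
    q.coef I (∑ J, q.form (c J) (basis d J)) = c I := by
  simp [map_sum, coef_form_basis]

theorem coef_of_mem_degree {n : ℕ} {x : q.Forms} (hx : x ∈ q.degree n) {I : Finset (Fin d)}
    (hI : I.card ≠ n) : q.coef I x = 0 := by
  obtain ⟨y, rfl⟩ := hx
  induction y using TensorProduct.induction_on with
  | zero => simp
  | tmul b ω => rw [degreeIncl_tmul, coef_form, formCoord_of_mem ω.2 hI, zero_smul]
  | add y z hy hz => rw [map_add, map_add, hy, hz, add_zero]

theorem form_mem_degree {n : ℕ} (b : B) {ω : FormAlgebra d} (h : ω ∈ ⋀[ℤ]^n (Fin d → ℤ)) :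
    q.form b ω ∈ q.degree n := ⟨b ⊗ₜ ⟨ω, h⟩, rfl⟩

theorem sum_form_mem_degree {n : ℕ} {c : Finset (Fin d) → B} (hc : ∀ I, I.card ≠ n → c I = 0) :
    ∑ I, q.form (c I) (basis d I) ∈ q.degree n := by
  refine sum_mem fun I _ => ?_
  by_cases h : I.card = n
  · subst h; exact q.form_mem_degree _ (basis_mem I)
  · rw [hc I h, zero_form]; exact zero_mem _

/-- The part `dT_i ∧ ∂ᵢ` of the differential has a homotopy inverse up to projections: if `h` is an
inverse of `∂ᵢ` up to the projections `1 - e` and `1 - e'`, and commutes with the other `∂ⱼ`, then the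
operator `h ⊗ ι_i` is a homotopy from the identity to the projection given by `e` on the forms without
`dT_i` and by `e'` on the multiples of `dT_i`. -/
theorem D_op_add_op_D {i : Fin d} {h e e' : B →+ B} (h1 : ∀ b, h (q.del i b) = b - e b)
    (h2 : ∀ b, q.del i (h b) = b - e' b) (h3 : ∀ j ≠ i, ∀ b, q.del j (h b) = h (q.del j b))
    (x : q.Forms) :
    q.D (q.op h (contract i) x) + q.op h (contract i) (q.D x) =
      x - (q.op e (LinearMap.id - numOp i) x + q.op e' (numOp i) x) := by
  induction x using form_induction with
  | h0 => simp
  | hf b ω =>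
    rw [op_form, D_form, D_form, map_sum, ← Finset.sum_add_distrib, Finset.sum_eq_single i]
    · rw [op_form, contract_dT_mul, if_pos rfl, h1, h2, op_form, op_form]
      simp only [LinearMap.sub_apply, LinearMap.id_apply, sub_form, form_sub, numOp_apply]
      abel
    · intro j _ hj
      rw [op_form, contract_dT_mul, if_neg hj, zero_sub, form_neg, h3 j hj, add_neg_cancel]
    · simp
  | ha x y hx hy =>
    simp only [map_add] at *
    rw [add_add_add_comm, hx, hy]
    abel

/-- The coefficients of the projection in `D_op_add_op_D`. -/
theorem coef_op_add_op {e e' : B →+ B} (i : Fin d) (I : Finset (Fin d)) (x : q.Forms) :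
    q.coef I (q.op e (LinearMap.id - numOp i) x + q.op e' (numOp i) x) =
      if i ∈ I then e' (q.coef I x) else e (q.coef I x) := by
  induction x using form_induction with
  | h0 => simp
  | hf b ω =>
    rw [op_form, op_form, map_add, coef_form, coef_form, LinearMap.sub_apply, map_sub,
      formCoord_numOp, coef_form, LinearMap.id_apply]
    split_ifs
    · rw [sub_self, zero_smul, zero_add, map_zsmul]
    · rw [sub_zero, zero_smul, add_zero, map_zsmul]
  | ha x y hx hy =>
    rw [map_add (q.op e _), map_add (q.op e' _), add_add_add_comm, map_add, hx, hy, map_add]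
    split_ifs <;> rw [map_add]

theorem coef_wedge_of_notMem {i : Fin d} {I : Finset (Fin d)} (h : i ∉ I) (φ : B →ₗ[S] B)
    (x : q.Forms) : q.coef I (q.wedge i φ x) = 0 := by
  induction x using form_induction with
  | h0 => simp
  | hf b ω => rw [wedge_form, coef_form, formCoord_dT_mul h, zero_smul]
  | ha x y hx hy => rw [map_add, map_add, hx, hy, add_zero]

theorem coef_wedge (i : Fin d) (I : Finset (Fin d)) (φ : B →ₗ[S] B) (x : q.Forms) :
    ∃ y, q.coef I (q.wedge i φ x) = φ y := by
  induction x using form_induction with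
  | h0 => exact ⟨0, by simp⟩
  | hf b ω => exact ⟨formCoord I (dT i * ω) • b, by rw [wedge_form, coef_form, map_zsmul]⟩
  | ha x y hx hy =>
    obtain ⟨x', hx⟩ := hx
    obtain ⟨y', hy⟩ := hy
    exact ⟨x' + y', by rw [map_add, map_add, hx, hy, map_add]⟩

end TwistedDerivations

/-! ### The cohomology of the complex modulo `Φ_p(q)` -/

namespace FormAlgebra

theorem dT_mul_basis {d : ℕ} {i : Fin d} {I : Finset (Fin d)} (h : i ∈ I) :
    dT i * basis d I = 0 := by
  have := numOp_basis i I
  rw [if_pos h] at this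
  rw [← this, numOp_apply, ← mul_assoc, dT_mul_self, zero_mul]

theorem basis_empty (d : ℕ) : basis d ∅ = 1 :=
  basis_eq_prod (⟨∅, rfl⟩ : Set.powersetCard (Fin d) 0)

end FormAlgebra

namespace TwistedDerivations
variable {S B : Type*} [CommRing S] [CommRing B] [Algebra S B] {d : ℕ}
  {q : TwistedDerivations S B d}

theorem cls_add {x y : q.Forms} (hx : q.D x = 0) (hy : q.D y = 0) (h : q.D (x + y) = 0) :
    q.cls (x + y) h = q.cls x hx + q.cls y hy := rfl

theorem cls_mul {x y : q.Forms} (hx : q.D x = 0) (hy : q.D y = 0) (h : q.D (x * y) = 0) :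
    q.cls (x * y) h = q.cls x hx * q.cls y hy := rfl

theorem cls_congr {x y : q.Forms} (e : x = y) (hx : q.D x = 0) (hy : q.D y = 0) :
    q.cls x hx = q.cls y hy := by subst e; rfl

theorem cls_eq_cls_iff {x y : q.Forms} {hx : q.D x = 0} {hy : q.D y = 0} :
    q.cls x hx = q.cls y hy ↔ ∃ z, q.D z = x - y := Ideal.Quotient.eq

theorem exists_cls (x : q.Cohomology) : ∃ z hz, q.cls z hz = x := by
  obtain ⟨⟨z, hz⟩, rfl⟩ := Ideal.Quotient.mk_surjective x
  exact ⟨z, hz, rfl⟩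

end TwistedDerivations

namespace QuotCyclo
open FormAlgebra
variable {p : ℕ} [hp : Fact p.Prime] {d : ℕ} {R : Type*} [CommRing R]
  [Algebra (MvPolynomial (Fin d) ℤ) R] [Algebra.Etale (MvPolynomial (Fin d) ℤ) R]

/-- The exponent of `∏_{i ∈ I} Tᵢ ^ (p - 1)`. -/
def topExp (p : ℕ) [hp : Fact p.Prime] (I : Finset (Fin d)) : Fin d → Fin p := fun i =>
  if i ∈ I then ⟨p - 1, Nat.sub_lt hp.out.pos one_pos⟩ else ⟨0, hp.out.pos⟩

theorem topExp_of_mem {i : Fin d} {I : Finset (Fin d)} (h : i ∈ I) :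
    (topExp p I i : ℕ) + 1 = p := by
  rw [topExp, if_pos h]
  exact Nat.sub_add_cancel hp.out.one_le

theorem topExp_of_notMem {i : Fin d} {I : Finset (Fin d)} (h : i ∉ I) :
    (topExp p I i : ℕ) = 0 := by
  rw [topExp, if_neg h]

/-- The form `∑_I F(c_I) (∏_{i ∈ I} Tᵢ ^ (p - 1)) dT_I`. -/
noncomputable def topForm (F : QuotCyclo p R →+* QuotCyclo p R) :
    (Finset (Fin d) → QuotCyclo p R) →+ (qDeRhamMod d R p).Forms where
  toFun c := ∑ I, (qDeRhamMod d R p).form (F (c I) * mono p R (topExp p I)) (basis d I)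
  map_zero' := by simp [TwistedDerivations.zero_form]
  map_add' c c' := by
    simp [add_mul, TwistedDerivations.add_form, Finset.sum_add_distrib]

theorem topForm_apply (F : QuotCyclo p R →+* QuotCyclo p R) (c : Finset (Fin d) → QuotCyclo p R) :
    topForm F c =
      ∑ I, (qDeRhamMod d R p).form (F (c I) * mono p R (topExp p I)) (basis d I) := rfl

theorem coef_topForm (F : QuotCyclo p R →+* QuotCyclo p R) (c : Finset (Fin d) → QuotCyclo p R)
    (I : Finset (Fin d)) :
    (qDeRhamMod d R p).coef I (topForm F c) = F (c I) * mono p R (topExp p I) := by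
  rw [topForm_apply]
  exact TwistedDerivations.coef_sum_form _ _ _

theorem topForm_mem_degree (F : QuotCyclo p R →+* QuotCyclo p R) {n : ℕ}
    {c : Finset (Fin d) → QuotCyclo p R} (hc : ∀ I, I.card ≠ n → c I = 0) :
    topForm F c ∈ (qDeRhamMod d R p).degree n := by
  rw [topForm_apply]
  apply TwistedDerivations.sum_form_mem_degree (q := qDeRhamMod d R p)
    (c := fun I => F (c I) * mono p R (topExp p I))
  intro I hI
  rw [hc I hI, map_zero, zero_mul]

variable {F : QuotCyclo p R →+* QuotCyclo p R} (hF : IsTwistedFrobenius d F)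

include hF in
theorem D_topForm (c : Finset (Fin d) → QuotCyclo p R) :
    (qDeRhamMod d R p).D (topForm F c) = 0 := by
  rw [topForm_apply, map_sum]
  refine Finset.sum_eq_zero fun I _ => ?_
  rw [TwistedDerivations.D_form]
  refine Finset.sum_eq_zero fun j _ => ?_
  by_cases hj : j ∈ I
  · rw [dT_mul_basis hj, TwistedDerivations.form_zero]
  · rw [hF.del_map_mul, del_mono_of_eq_zero (topExp_of_notMem hj), mul_zero,
      TwistedDerivations.zero_form]

/-- The coefficient of `(∏_{i ∈ I} Tᵢ ^ (p - 1)) dT_I` in a form. -/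
noncomputable def topCoeff (I : Finset (Fin d)) : (qDeRhamMod d R p).Forms →+ QuotCyclo p R :=
  (fcoeff hF (topExp p I)).comp ((qDeRhamMod d R p).coef I).toAddMonoidHom

theorem topCoeff_apply (I : Finset (Fin d)) (x : (qDeRhamMod d R p).Forms) :
    topCoeff hF I x = fcoeff hF (topExp p I) ((qDeRhamMod d R p).coef I x) := rfl

theorem topCoeff_topForm (c : Finset (Fin d) → QuotCyclo p R) (I : Finset (Fin d)) :
    topCoeff hF I (topForm F c) = c I := by
  rw [topCoeff_apply, coef_topForm, fcoeff_mul_mono, if_pos rfl]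

/-- Coboundaries have no top coefficients: the coefficient of `dT_I` in a coboundary is a sum of
`∂ᵢ`-derivatives with `i ∈ I`, and these do not involve `Tᵢ ^ (p - 1)`. -/
theorem topCoeff_D (I : Finset (Fin d)) (x : (qDeRhamMod d R p).Forms) :
    topCoeff hF I ((qDeRhamMod d R p).D x) = 0 := by
  rw [TwistedDerivations.D, LinearMap.sum_apply, map_sum]
  refine Finset.sum_eq_zero fun i _ => ?_
  rw [topCoeff_apply]
  by_cases hi : i ∈ I
  · obtain ⟨y, hy⟩ := (qDeRhamMod d R p).coef_wedge i I ((qDeRhamMod d R p).del i) x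
    rw [hy, fcoeff_del hF (topExp_of_mem hi)]
  · rw [TwistedDerivations.coef_wedge_of_notMem _ hi, map_zero]

/-- Every cocycle is cohomologous to one in which the coefficient of `dT_I` involves only the
monomials `T ^ a` with `aᵢ = p - 1` for `i ∈ I ∩ s` and `aᵢ = 0` for `i ∈ s \ I`: contract the
complex along the variables in `s`, one at a time. -/
theorem exists_reduced (s : Finset (Fin d)) (z : (qDeRhamMod d R p).Forms)
    (hz : (qDeRhamMod d R p).D z = 0) :
    ∃ z' y, z = z' + (qDeRhamMod d R p).D y ∧
      ∀ i ∈ s, ∀ (I : Finset (Fin d)) (a : Fin d → Fin p), a i ≠ topExp p I i →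
        fcoeff hF a ((qDeRhamMod d R p).coef I z') = 0 := by
  classical
  induction s using Finset.induction_on with
  | empty => exact ⟨z, 0, by simp, by simp⟩
  | insert i s _ ih =>
    obtain ⟨z', y, rfl, h⟩ := ih
    have hz' : (qDeRhamMod d R p).D z' = 0 := by
      rwa [map_add, TwistedDerivations.D_D, add_zero] at hz
    have key := (qDeRhamMod d R p).D_op_add_op_D (qIntegral_del hF i) (del_qIntegral hF i)
      (fun j hj => del_qIntegral_of_ne hF hj) z'
    rw [hz', map_zero, add_zero] at key
    refine ⟨(qDeRhamMod d R p).op (proj hF fun a => (a i : ℕ) = 0) (LinearMap.id - numOp i) z' +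
      (qDeRhamMod d R p).op (proj hF fun a => (a i : ℕ) + 1 = p) (numOp i) z',
      y + (qDeRhamMod d R p).op (qIntegral hF i) (contract i) z',
      ?_, fun j hj I a ha => ?_⟩
    rotate_left
    · rw [TwistedDerivations.coef_op_add_op]
      by_cases hjs : j ∈ s
      · have h0 := h j hjs I a ha
        split_ifs <;> rw [fcoeff_proj] <;> split_ifs <;> first | exact h0 | rfl
      · obtain rfl : j = i := (Finset.mem_insert.1 hj).resolve_right hjs
        by_cases hI : j ∈ I
        · rw [if_pos hI, fcoeff_proj, if_neg]
          intro h
          exact ha (Fin.ext (Nat.add_right_cancel (h.trans (topExp_of_mem hI).symm)))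
        · rw [if_neg hI, fcoeff_proj, if_neg]
          intro h
          exact ha (Fin.ext (h.trans (topExp_of_notMem hI).symm))
    · rw [map_add, key]
      abel

theorem exists_eq_topForm_add (z : (qDeRhamMod d R p).Forms) (hz : (qDeRhamMod d R p).D z = 0) :
    ∃ y, z = topForm F (fun I => topCoeff hF I z) + (qDeRhamMod d R p).D y := by
  obtain ⟨z', y, rfl, h⟩ := exists_reduced hF Finset.univ z hz
  refine ⟨y, congrArg (· + _) (TwistedDerivations.ext_coef _ fun I => ext_fcoeff hF fun a => ?_)⟩
  rw [coef_topForm, fcoeff_mul_mono, map_add, topCoeff_D, add_zero, topCoeff_apply]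
  split_ifs with ha
  · rw [ha]
  · obtain ⟨i, hi⟩ := Function.ne_iff.1 ha
    exact h i (Finset.mem_univ i) I a hi

/-- The classes of the forms `∑_I F(c_I) (∏_{i ∈ I} Tᵢ ^ (p - 1)) dT_I` are all of the cohomology,
and each class comes from a unique family `c`. -/
noncomputable def cohomologyEquiv :
    (Finset (Fin d) → QuotCyclo p R) ≃+ (qDeRhamMod d R p).Cohomology :=
  AddEquiv.ofBijective
    (({ toFun c := (qDeRhamMod d R p).cls (topForm F c) (D_topForm hF c)
        map_zero' := TwistedDerivations.cls_eq_zero_iff.2 ⟨0, by simp⟩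
        map_add' c c' := by
          rw [← TwistedDerivations.cls_add (h := by simp [D_topForm hF])]
          exact TwistedDerivations.cls_congr (map_add _ _ _) _ _ } :
      (Finset (Fin d) → QuotCyclo p R) →+ (qDeRhamMod d R p).Cohomology)) (by
    constructor
    · intro c c' h
      obtain ⟨y, hy⟩ := TwistedDerivations.cls_eq_cls_iff.1 h
      funext I
      rw [← topCoeff_topForm hF c, ← topCoeff_topForm hF c', ← sub_eq_zero, ← map_sub, ← hy,
        topCoeff_D]
    · intro x
      obtain ⟨z, hz, rfl⟩ := TwistedDerivations.exists_cls x
      obtain ⟨y, hy⟩ := exists_eq_topForm_add hF z hz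
      refine ⟨fun I => topCoeff hF I z, TwistedDerivations.cls_eq_cls_iff.2 ⟨-y, ?_⟩⟩
      rw [map_neg, neg_eq_iff_eq_neg, neg_sub, eq_sub_iff_add_eq', ← hy])

/-- `Hⁿ` corresponds to the families supported on the subsets with `n` elements. -/
theorem cohomologyEquiv_mem_H_iff {n : ℕ} {c : Finset (Fin d) → QuotCyclo p R} :
    cohomologyEquiv hF c ∈ (qDeRhamMod d R p).H n ↔ ∀ I, I.card ≠ n → c I = 0 := by
  constructor
  · intro h I hI
    obtain ⟨z, hz, hd, he⟩ := (TwistedDerivations.mem_H _).1 h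
    obtain ⟨y, hy⟩ := TwistedDerivations.cls_eq_cls_iff.1 he.symm
    have h1 := topCoeff_D hF I y
    rw [hy, map_sub, topCoeff_topForm, sub_eq_zero, topCoeff_apply,
      TwistedDerivations.coef_of_mem_degree _ hd hI, map_zero] at h1
    exact h1
  · intro h
    exact (TwistedDerivations.mem_H _).2 ⟨_, D_topForm hF c, topForm_mem_degree F h, rfl⟩

include hF in
/-- The cohomology is `p`-adically separated. -/
theorem cohomology_eq_zero_of_forall_pow {m : (qDeRhamMod d R p).Cohomology}
    (h : ∀ n : ℕ, ∃ y, m = p ^ n • y) : m = 0 := by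
  obtain ⟨c, rfl⟩ := (cohomologyEquiv hF).surjective m
  have h0 : c = 0 := by
    funext I
    refine isSep_natCast_self d _ fun n => ?_
    obtain ⟨y, hy⟩ := h n
    obtain ⟨c', rfl⟩ := (cohomologyEquiv hF).surjective y
    rw [← map_nsmul, (cohomologyEquiv hF).apply_eq_iff_eq] at hy
    exact ⟨c' I, by rw [hy, Pi.smul_apply, nsmul_eq_mul, Nat.cast_pow, smul_eq_mul]⟩
  rw [h0, map_zero]

end QuotCyclo

/-! ### Degree zero, and the boundary map -/

namespace QuotCyclo
open FormAlgebra TwistedDerivations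
variable {p : ℕ} [hp : Fact p.Prime] {d : ℕ} {R : Type*} [CommRing R]
  [Algebra (MvPolynomial (Fin d) ℤ) R] [Algebra.Etale (MvPolynomial (Fin d) ℤ) R]
  {F : QuotCyclo p R →+* QuotCyclo p R} (hF : IsTwistedFrobenius d F)

include hF in
theorem D_form_map (b : QuotCyclo p R) :
    (qDeRhamMod d R p).D ((qDeRhamMod d R p).form (F b) 1) = 0 := by
  rw [D_form]
  refine Finset.sum_eq_zero fun i _ => ?_
  rw [hF.del_map, zero_form]

/-- The ring homomorphism to the cohomology that sends `b` to the class of the cocycle `F(b)` of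
degree `0`. -/
noncomputable def const : QuotCyclo p R →+* (qDeRhamMod d R p).Cohomology where
  toFun b := (qDeRhamMod d R p).cls ((qDeRhamMod d R p).form (F b) 1) (D_form_map hF b)
  map_one' := (cls_congr (by rw [map_one]; rfl) _ (D_one _)).trans rfl
  map_mul' a b := by
    rw [← cls_mul (h := by rw [form_mul_form, ← map_mul]; exact D_form_map hF _)]
    exact cls_congr (by rw [form_mul_form, map_mul]) _ _
  map_zero' := TwistedDerivations.cls_eq_zero_iff.2 ⟨0, by simp [zero_form]⟩
  map_add' a b := by
    rw [← cls_add (h := by rw [← add_form, ← map_add]; exact D_form_map hF _)]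
    exact cls_congr (by rw [← add_form, map_add]) _ _

theorem const_apply (b : QuotCyclo p R) :
    const hF b = (qDeRhamMod d R p).cls ((qDeRhamMod d R p).form (F b) 1) (D_form_map hF b) := rfl

theorem const_eq_cohomologyEquiv (b : QuotCyclo p R) :
    const hF b = cohomologyEquiv hF (Pi.single ∅ b) := by
  refine cls_congr (ext_coef _ fun I => ?_) _ _
  rw [coef_topForm, ← basis_empty, coef_form_basis]
  by_cases h : I = ∅
  · subst h
    have : mono p R (topExp p (∅ : Finset (Fin d))) = 1 := by
      simp [mono, smallMonomial, topExp]
    rw [if_pos rfl, Pi.single_eq_same, this, mul_one]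
  · rw [if_neg (Ne.symm h), Pi.single_eq_of_ne h, map_zero, zero_mul]

theorem const_injective : Function.Injective (const hF) := by
  intro a b h
  rw [const_eq_cohomologyEquiv, const_eq_cohomologyEquiv] at h
  simpa using congrFun ((cohomologyEquiv hF).injective h) ∅

theorem range_const : Set.range (const hF) = ((qDeRhamMod d R p).H 0 : Set _) := by
  ext x
  constructor
  · rintro ⟨b, rfl⟩
    rw [const_eq_cohomologyEquiv]
    refine (cohomologyEquiv_mem_H_iff hF).2 fun I hI => Pi.single_eq_of_ne ?_ _
    rintro rfl
    exact hI rfl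
  · intro hx
    obtain ⟨c, rfl⟩ := (cohomologyEquiv hF).surjective x
    refine ⟨c ∅, ?_⟩
    rw [const_eq_cohomologyEquiv]
    congr 1
    funext I
    by_cases h : I = ∅
    · subst h; rw [Pi.single_eq_same]
    · rw [Pi.single_eq_of_ne h, (cohomologyEquiv_mem_H_iff hF).1 hx I (by simpa using h)]

theorem const_mul_cohomologyEquiv (b : QuotCyclo p R) (c : Finset (Fin d) → QuotCyclo p R) :
    const hF b * cohomologyEquiv hF c = cohomologyEquiv hF (fun I => b * c I) := by
  refine (cls_mul _ _ (by rw [D_mul, D_form_map hF, D_topForm hF]; simp)).symm.trans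
    (cls_congr ?_ _ _)
  rw [topForm_apply, topForm_apply, Finset.mul_sum]
  refine Finset.sum_congr rfl fun I _ => ?_
  rw [form_mul_form, map_mul, mul_assoc]

include hF in
theorem leftMul_smul (b : QuotCyclo p R) (ω : FormAlgebra d) (x : (qDeRhamMod d R p).Forms) :
    (qDeRhamMod d R p).leftMul ω (F b • x) = F b • (qDeRhamMod d R p).leftMul ω x := by
  induction ω using FormAlgebra.induction generalizing x with
  | one => simp
  | gen i => rw [leftMul_dT, mulDT_smul, hF.gamma_map]
  | add a b ha hb => simp [ha, hb]
  | neg a ha => simp [ha]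
  | mul a b ha hb => simp [ha, hb]

/-- Classes of degree `0` are central, because the `γᵢ` fix the image of `F`. -/
theorem const_mul_comm (b : QuotCyclo p R) (x : (qDeRhamMod d R p).Cohomology) :
    const hF b * x = x * const hF b := by
  obtain ⟨z, hz, rfl⟩ := exists_cls x
  have h : (qDeRhamMod d R p).form (F b) 1 * z = z * (qDeRhamMod d R p).form (F b) 1 := by
    clear hz
    induction z using form_induction with
    | h0 => simp
    | hf c ω =>
      have h1 : (qDeRhamMod d R p).form (F b) 1 = F b • (qDeRhamMod d R p).form 1 1 := by
        rw [smul_form, mul_one]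
      rw [form_mul_form, form_mul, h1, leftMul_smul hF, leftMul_form, mul_one, smul_form,
        smul_form, mul_one, mul_comm]
    | ha x y hx hy => rw [mul_add, add_mul, hx, hy]
  rw [const_apply, ← cls_mul (h := by rw [D_mul, D_form_map hF, hz]; simp),
    ← cls_mul (h := by rw [D_mul, D_form_map hF, hz]; simp)]
  exact cls_congr h _ _

omit hp in
/-- If `∇_q f = Φ_p(q) ∑ᵢ gᵢ dTᵢ`, this identity holds modulo `Φ_p(q)²`, and `∑ᵢ gᵢ dTᵢ` is a cocycle
modulo `Φ_p(q)`. -/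
theorem D_form_eq_smul_and_D_sum_form_eq_zero (hc : algebraMap ℤ⟦X⟧ R⟦X⟧ (cyclo p) ∈ nonZeroDivisors R⟦X⟧) {f : R⟦X⟧}
    {g : Fin d → R⟦X⟧} (hg : ∀ i, qderiv R i f = algebraMap ℤ⟦X⟧ R⟦X⟧ (cyclo p) * g i) :
    ((qData d R).mod (cyclo p ^ 2)).D
        (((qData d R).mod (cyclo p ^ 2)).form (Ideal.Quotient.mk _ f) 1) =
      cyclo p • ∑ i, ((qData d R).mod (cyclo p ^ 2)).form (Ideal.Quotient.mk _ (g i)) (dT i) ∧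
    (qDeRhamMod d R p).D (∑ i, (qDeRhamMod d R p).form (mk p R (g i)) (dT i)) = 0 := by
  have h1 : ((qData d R).mod (cyclo p ^ 2)).D
        (((qData d R).mod (cyclo p ^ 2)).form (Ideal.Quotient.mk _ f) 1) =
      cyclo p • ∑ i, ((qData d R).mod (cyclo p ^ 2)).form (Ideal.Quotient.mk _ (g i)) (dT i) := by
    rw [D_form, Finset.smul_sum]
    refine Finset.sum_congr rfl fun i _ => ?_
    have : ((qData d R).mod (cyclo p ^ 2)).del i (Ideal.Quotient.mk _ f) =
        cyclo p • Ideal.Quotient.mk _ (g i) := by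
      refine (congrArg (Ideal.Quotient.mk _) (hg i)).trans ?_
      rw [← Algebra.smul_def]
      rfl
    rw [this, mul_one]
    rfl
  refine ⟨h1, ?_⟩
  have h2 := red_eq_zero_of_smul (qData d R) (cyclo p) hc
    (((qData d R).mod (cyclo p ^ 2)).D
      (∑ i, ((qData d R).mod (cyclo p ^ 2)).form (Ideal.Quotient.mk _ (g i)) (dT i)))
    (by rw [← map_smul, ← h1, D_D])
  rw [red_D, map_sum] at h2
  exact h2

/-- If `f` lifts a class in `H⁰` and `∇_q f = Φ_p(q) ∑ᵢ gᵢ dTᵢ`, then `∑ᵢ gᵢ dTᵢ` represents its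
boundary. -/
theorem boundary_const {b : QuotCyclo p R} {f : R⟦X⟧} {g : Fin d → R⟦X⟧} (hf : mk p R f = F b)
    (hg : ∀ i, qderiv R i f = algebraMap ℤ⟦X⟧ R⟦X⟧ (cyclo p) * g i)
    (h : (qDeRhamMod d R p).D (∑ i, (qDeRhamMod d R p).form (mk p R (g i)) (dT i)) = 0) :
    boundary d p R (const hF b) =
      (qDeRhamMod d R p).cls (∑ i, (qDeRhamMod d R p).form (mk p R (g i)) (dT i)) h := by
  have hc := cyclo_mem_nonZeroDivisors d R p
  refine (bockstein_eq_iff (qData d R) (cyclo p) hc _ _).2 ?_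
  have hw : (qDeRhamMod d R p).D ((qDeRhamMod d R p).form (mk p R f) 1) = 0 := by
    rw [hf]; exact D_form_map hF b
  refine ⟨((qData d R).mod (cyclo p ^ 2)).form (Ideal.Quotient.mk _ f) 1,
    ∑ i, ((qData d R).mod (cyclo p ^ 2)).form (Ideal.Quotient.mk _ (g i)) (dT i), hw, ?_, ?_,
    (D_form_eq_smul_and_D_sum_form_eq_zero hc hg).1, ?_⟩
  · rw [map_sum]; exact h
  · exact cls_congr (by rw [← hf]; rfl) _ _
  · exact cls_congr (map_sum _ _ _) _ _

include hF in
theorem exists_qderiv_eq (b : QuotCyclo p R) : ∃ (f : R⟦X⟧) (g : Fin d → R⟦X⟧), mk p R f = F b ∧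
    ∀ i, qderiv R i f = algebraMap ℤ⟦X⟧ R⟦X⟧ (cyclo p) * g i := by
  obtain ⟨f, hf⟩ := mk_surjective (F b)
  have h : ∀ i : Fin d, ∃ g, qderiv R i f = algebraMap ℤ⟦X⟧ R⟦X⟧ (cyclo p) * g := fun i => by
    rw [← mk_eq_zero_iff, ← del_mk (p := p) i f, hf, hF.del_map]
  choose g hg using h
  exact ⟨f, g, hf, hg⟩

theorem dT_mem (i : Fin d) : dT i ∈ ⋀[ℤ]^1 (Fin d → ℤ) := by
  change _ ∈ LinearMap.range (ExteriorAlgebra.ι ℤ) ^ 1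
  rw [pow_one]
  exact ⟨_, rfl⟩

theorem boundary_const_mem (b : QuotCyclo p R) :
    boundary d p R (const hF b) ∈ (qDeRhamMod d R p).H 1 := by
  obtain ⟨f, g, hf, hg⟩ := exists_qderiv_eq hF b
  have h := (D_form_eq_smul_and_D_sum_form_eq_zero (cyclo_mem_nonZeroDivisors d R p) hg).2
  rw [boundary_const hF hf hg h]
  exact (mem_H _).2 ⟨_, h, sum_mem fun i _ => form_mem_degree _ _ (dT_mem i), rfl⟩

/-- On `H⁰` the boundary map is a derivation, because the `γᵢ` act trivially on `H⁰`. -/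
theorem boundary_const_mul (a b : QuotCyclo p R) :
    boundary d p R (const hF (a * b)) =
      const hF a * boundary d p R (const hF b) + const hF b * boundary d p R (const hF a) := by
  have hc := cyclo_mem_nonZeroDivisors d R p
  obtain ⟨f, g, hf, hg⟩ := exists_qderiv_eq hF a
  obtain ⟨f', g', hf', hg'⟩ := exists_qderiv_eq hF b
  have h := (D_form_eq_smul_and_D_sum_form_eq_zero hc hg).2
  have h' := (D_form_eq_smul_and_D_sum_form_eq_zero hc hg').2
  have hg'' : ∀ i, qderiv R i (f * f') =
      algebraMap ℤ⟦X⟧ R⟦X⟧ (cyclo p) * (f * g' i + gamma R i f' * g i) := fun i => by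
    have := (qData d R).del_mul i f f'
    change qderiv R i (f * f') = qderiv R i f * gamma R i f' + f * qderiv R i f' at this
    rw [this, hg, hg']
    ring
  have h'' := (D_form_eq_smul_and_D_sum_form_eq_zero hc hg'').2
  rw [boundary_const hF hf hg h, boundary_const hF hf' hg' h',
    boundary_const hF (by rw [map_mul, map_mul, hf, hf']) hg'' h'', const_apply, const_apply,
    ← cls_mul (h := by rw [D_mul, D_form_map hF, h']; simp),
    ← cls_mul (h := by rw [D_mul, D_form_map hF, h]; simp), ← cls_add (h := by
      rw [map_add, D_mul, D_form_map hF, h', D_mul, D_form_map hF, h]; simp)]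
  refine cls_congr ?_ _ _
  rw [Finset.mul_sum, Finset.mul_sum, ← Finset.sum_add_distrib]
  refine Finset.sum_congr rfl fun i _ => ?_
  rw [form_mul_form, form_mul_form, map_add, map_mul, map_mul, add_form, hf, ← gamma_mk, hf',
    hF.gamma_map]

theorem qderiv_coord_pow_self (i : Fin d) :
    qderiv R i (PowerSeries.C (coord R i) ^ p) =
      algebraMap ℤ⟦X⟧ R⟦X⟧ (cyclo p) * PowerSeries.C (coord R i) ^ (p - 1) := by
  apply denom_cancel R (i := i)
  have h := congrArg (algebraMap ℤ⟦X⟧ R⟦X⟧) (X_mul_cyclo p)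
  simp only [map_mul, map_sub, map_pow, map_add, map_one, algebraMap_X'] at h
  rw [qderiv_spec', map_pow, gamma_coord_self, mul_pow]
  calc _ = ((1 + PowerSeries.X) ^ p - 1) * PowerSeries.C (coord R i) ^ p := by ring
    _ = (PowerSeries.X * algebraMap ℤ⟦X⟧ R⟦X⟧ (cyclo p)) *
        (PowerSeries.C (coord R i) ^ (p - 1 + 1)) := by rw [h, Nat.sub_add_cancel hp.out.one_le]
    _ = _ := by ring

omit hp in
theorem qderiv_coord_pow_of_ne {i j : Fin d} (h : j ≠ i) :
    qderiv R j (PowerSeries.C (coord R i) ^ p) = 0 := by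
  apply denom_cancel R (i := j)
  rw [qderiv_spec', map_pow, gamma_coord_of_ne R h.symm, sub_self, mul_zero]

theorem D_form_T_pow (i : Fin d) :
    (qDeRhamMod d R p).D ((qDeRhamMod d R p).form (T p R i ^ (p - 1)) (dT i)) = 0 := by
  rw [D_form]
  refine Finset.sum_eq_zero fun j _ => ?_
  by_cases h : j = i
  · subst h; rw [dT_mul_self, form_zero]
  · rw [del_eq_zero_of_gamma_eq (by rw [map_pow, gamma_T_of_ne (Ne.symm h)]), zero_form]

/-- The boundary of `φ(Tᵢ) = Tᵢ ^ p` is the class of `Tᵢ ^ (p - 1) dTᵢ`. -/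
theorem boundary_const_T (i : Fin d) :
    boundary d p R (const hF (T p R i)) =
      (qDeRhamMod d R p).cls ((qDeRhamMod d R p).form (T p R i ^ (p - 1)) (dT i))
        (D_form_T_pow i) := by
  have hg : ∀ j, qderiv R j (PowerSeries.C (coord R i) ^ p) = algebraMap ℤ⟦X⟧ R⟦X⟧ (cyclo p) *
      (Pi.single i (PowerSeries.C (coord R i) ^ (p - 1)) : Fin d → R⟦X⟧) j := fun j => by
    by_cases h : j = i
    · subst h; rw [Pi.single_eq_same, qderiv_coord_pow_self]
    · rw [Pi.single_eq_of_ne h, mul_zero, qderiv_coord_pow_of_ne h]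
  rw [boundary_const hF (by rw [hF.map_T, map_pow]; rfl) hg
    (D_form_eq_smul_and_D_sum_form_eq_zero (cyclo_mem_nonZeroDivisors d R p) hg).2]
  refine cls_congr ?_ _ _
  rw [Finset.sum_eq_single i]
  · rw [Pi.single_eq_same, map_pow]; rfl
  · intro j _ hj
    rw [Pi.single_eq_of_ne hj, map_zero, zero_form]
  · simp

end QuotCyclo

/-! ### Continuity, and derivations on `ℤ_p[ζ_p]` -/

section Topology

/-- Additive maps are continuous for the `p`-adic topologies. -/
theorem continuous_padicTopology (p : ℕ) {M N : Type*} [AddCommGroup M] [AddCommGroup N]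
    (f : M →+ N) : @Continuous _ _ (padicTopology p M) (padicTopology p N) f := by
  let I : Ideal ℤ := Ideal.span {(p : ℤ)}
  let := I.adicTopology
  let BM := (I.ringFilterBasis.moduleFilterBasis (I.adic_module_basis M)).toAddGroupFilterBasis
  let BN := (I.ringFilterBasis.moduleFilterBasis (I.adic_module_basis N)).toAddGroupFilterBasis
  let tM : TopologicalSpace M := BM.topology
  let tN : TopologicalSpace N := BN.topology
  have : IsTopologicalAddGroup M := BM.isTopologicalAddGroup
  have : IsTopologicalAddGroup N := BN.isTopologicalAddGroup
  change Continuous f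
  refine continuous_of_continuousAt_zero f ?_
  rw [ContinuousAt, map_zero]
  refine (BM.nhds_zero_hasBasis.tendsto_iff BN.nhds_zero_hasBasis).2 ?_
  rintro _ ⟨n, rfl⟩
  refine ⟨_, ⟨n, rfl⟩, fun x hx => ?_⟩
  have hx' : x ∈ (I ^ n • ⊤ : Submodule ℤ M) := hx
  change f x ∈ (I ^ n • ⊤ : Submodule ℤ N)
  exact Submodule.smul_top_le_comap_smul_top (I ^ n) f.toIntLinearMap hx'

end Topology

section ZpZeta

/-- A derivation on `ℤ_p[ζ_p]` that kills `ζ_p` vanishes if its target is `p`-adically separated,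
because the integers are dense in `ℤ_p`. -/
theorem eq_zero_of_leibniz {p : ℕ} [Fact p.Prime] {A : Type*} [Ring A] (e : ZpZeta p →+* A)
    (θ : ZpZeta p →+ A) (hθ : ∀ a b, θ (a * b) = e a * θ b + e b * θ a)
    (sep : ∀ m : A, (∀ n : ℕ, ∃ y, m = p ^ n • y) → m = 0) (hroot : θ (AdjoinRoot.root _) = 0)
    (c : ZpZeta p) : θ c = 0 := by
  have h1 : θ 1 = 0 := by
    have := hθ 1 1
    rw [mul_one, map_one e, one_mul] at this
    exact left_eq_add.1 this
  have hn : ∀ (m : ℕ) a, θ ((m : ZpZeta p) * a) = m • θ a := fun m a => by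
    rw [← nsmul_eq_mul, map_nsmul]
  have hn' : ∀ m : ℕ, θ (m : ZpZeta p) = 0 := fun m => by
    rw [← mul_one (m : ZpZeta p), hn, h1, smul_zero]
  induction c using AdjoinRoot.induction_on with
  | ih f =>
    induction f using Polynomial.induction_on with
    | C z =>
      refine sep _ fun n => ?_
      obtain ⟨y, hy⟩ := Ideal.mem_span_singleton.1 (PadicInt.appr_spec n z)
      have hz : AdjoinRoot.of (Polynomial.cyclotomic p ℤ_[p]) z =
          (z.appr n : ZpZeta p) + ((p ^ n : ℕ) : ZpZeta p) * AdjoinRoot.of _ y := by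
        rw [← map_natCast (AdjoinRoot.of (Polynomial.cyclotomic p ℤ_[p])),
          ← map_natCast (AdjoinRoot.of (Polynomial.cyclotomic p ℤ_[p])), ← map_mul, ← map_add,
          Nat.cast_pow, ← hy, add_sub_cancel]
      exact ⟨θ (AdjoinRoot.of _ y), by rw [AdjoinRoot.mk_C, hz, map_add, hn, hn', zero_add]⟩
    | add f g hf hg => rw [map_add, map_add, hf, hg, add_zero]
    | monomial n z ih =>
      rw [pow_succ, ← mul_assoc, map_mul (AdjoinRoot.mk _), hθ, ih, AdjoinRoot.mk_X, hroot, mul_zero,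
        mul_zero, add_zero]

end ZpZeta

/-! ### Exterior powers of differentials -/

section Exterior
variable {R C A M : Type*} [CommRing R] [CommRing C] [Algebra R C] [Ring A] [Algebra C A]
  [Algebra R A] [IsScalarTower R C A] [AddCommGroup M] [Module R M]

/-- The linear map that a derivation with values in a ring induces on differentials. -/
theorem exists_kaehler_lift (δ : R →+ A) (h : ∀ a b, δ (a * b) = a • δ b + b • δ a) :
    ∃ f : Ω[R⁄ℤ] →ₗ[R] A, ∀ r, f (KaehlerDifferential.D ℤ R r) = δ r :=
  ⟨(Derivation.mk' δ.toIntLinearMap h).liftKaehlerDifferential, fun _ =>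
    Derivation.liftKaehlerDifferential_comp_D _ _⟩

theorem mul_self_eq_zero_of_basis {d : ℕ} (b : Module.Basis (Fin d) R M) (f : M →ₗ[R] A)
    (h0 : ∀ i, f (b i) * f (b i) = 0) (h1 : ∀ i j, f (b i) * f (b j) + f (b j) * f (b i) = 0)
    (m : M) : f m * f m = 0 := by
  rw [← b.sum_repr m, map_sum, Finset.sum_mul_sum]
  simp only [map_smul, smul_mul_smul_comm]
  apply sum_sum_eq_zero_of_antisymm
  · intro i; rw [h0, smul_zero]
  · intro i j; rw [mul_comm (b.repr m j), ← smul_add, h1, smul_zero]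

/-- If the products of the `f (b i)` over the subsets of the index set form a `C`-basis of `A`, then
the algebra homomorphism from the exterior algebra that extends `f` identifies `C ⊗ ⋀ⁿ M` with the span
of the products over the subsets with `n` elements. -/
theorem exists_exteriorPower_map {d : ℕ} (b : Module.Basis (Fin d) R M) (f : M →ₗ[R] A)
    (h0 : ∀ i, f (b i) * f (b i) = 0) (h1 : ∀ i j, f (b i) * f (b j) + f (b j) * f (b i) = 0)
    (u : Module.Basis (Finset (Fin d)) C A) (n : ℕ)
    (hu : ∀ s : Set.powersetCard (Fin d) n,
      u s = ((FormAlgebra.idx s).map fun i => f (b i)).prod) :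
    ∃ e : C ⊗[R] ⋀[R]^n M →ₗ[C] A, Function.Injective e ∧
      (∀ x, x ∈ LinearMap.range e ↔ ∀ I : Finset (Fin d), I.card ≠ n → u.repr x I = 0) ∧
      ∀ ω : Fin n → M, e (1 ⊗ₜ exteriorPower.ιMulti R n ω) = (List.ofFn fun k => f (ω k)).prod := by
  let L := ExteriorAlgebra.lift R ⟨f, mul_self_eq_zero_of_basis b f h0 h1⟩
  let e : C ⊗[R] ⋀[R]^n M →ₗ[C] A :=
    (L.toLinearMap ∘ₗ (⋀[R]^n M).subtype).liftBaseChange C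
  have he : ∀ ω : Fin n → M, e (1 ⊗ₜ exteriorPower.ιMulti R n ω) =
      (List.ofFn fun k => f (ω k)).prod := by
    intro ω
    rw [LinearMap.liftBaseChange_tmul, one_smul]
    change L (exteriorPower.ιMulti R n ω : ExteriorAlgebra R M) = _
    rw [exteriorPower.ιMulti_apply_coe, ExteriorAlgebra.ιMulti_apply, map_list_prod, List.map_ofFn]
    congr 2
    funext k
    exact ExteriorAlgebra.lift_ι_apply _ _ _ _
  let v := (b.exteriorPower n).baseChange C
  have hv : ∀ s, e (v s) = u s := by
    intro s
    rw [Module.Basis.baseChange_apply, exteriorPower.basis_apply, hu,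
      exteriorPower.ιMulti_family, he, FormAlgebra.idx, List.map_ofFn]
    rfl
  have hinj : Function.Injective e := by
    rw [← LinearMap.ker_eq_bot]
    refine LinearMap.ker_eq_bot'.2 fun x hx => ?_
    rw [← v.sum_repr x, map_sum] at hx
    simp only [map_smul, hv] at hx
    have hli := u.linearIndependent.comp (Subtype.val : Set.powersetCard (Fin d) n → _)
      Subtype.val_injective
    have h := Fintype.linearIndependent_iff.1 hli _ hx
    exact v.ext_elem fun s => by rw [h s, map_zero, Finsupp.zero_apply]
  refine ⟨e, hinj, fun x => ⟨?_, fun h => ?_⟩, he⟩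
  · rintro ⟨y, rfl⟩ I hI
    rw [← v.sum_repr y, map_sum, map_sum, Finsupp.finsetSum_apply]
    refine Finset.sum_eq_zero fun s _ => ?_
    rw [map_smul, hv, map_smul, Finsupp.smul_apply, u.repr_self, Finsupp.single_apply, if_neg,
      smul_zero]
    rintro rfl
    exact hI s.2
  · rw [← u.sum_repr x]
    refine sum_mem fun I _ => ?_
    by_cases hI : I.card = n
    · exact Submodule.smul_mem _ _ ⟨v ⟨I, hI⟩, hv ⟨I, hI⟩⟩
    · rw [h I hI, zero_smul]; exact zero_mem _

/-- A ring `A` with a central homomorphism from `C` is identified with `⨁ₙ Ωⁿ ⊗ C` through a derivation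
`δ : R → A`, if the products of the `δ(Tᵢ)` over the subsets of the coordinates form a `C`-basis
of `A`, and if the `δ(Tᵢ)` anticommute and have square zero. -/
theorem exists_forms_equiv {d : ℕ} [Algebra (MvPolynomial (Fin d) ℤ) R]
    [Algebra.Etale (MvPolynomial (Fin d) ℤ) R] {S : Type*} [CommRing S] {A : Type*} [Ring A]
    [Module S A] (e₀ : C →+* A) (hcomm : ∀ c x, e₀ c * x = x * e₀ c) (δ : R →+ A)
    (hδ : ∀ a b, δ (a * b) = e₀ (algebraMap R C a) * δ b + e₀ (algebraMap R C b) * δ a)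
    (h0 : ∀ i : Fin d, δ (coord R i) * δ (coord R i) = 0)
    (h1 : ∀ i j : Fin d, δ (coord R i) * δ (coord R j) + δ (coord R j) * δ (coord R i) = 0)
    (E : (Finset (Fin d) → C) ≃+ A) (hmul : ∀ c x, e₀ c * E x = E fun I => c * x I)
    (hE : ∀ (n : ℕ) (s : Set.powersetCard (Fin d) n), E (Pi.single (s : Finset (Fin d)) 1) =
      ((FormAlgebra.idx s).map fun i => δ (coord R i)).prod)
    (H : ℕ → Submodule S A) (hH : ∀ n c, E c ∈ H n ↔ ∀ I, I.card ≠ n → c I = 0) :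
    ∃ e₁ : C ⊗[R] Ω[R⁄ℤ] ≃+ H 1,
      (∀ a x, (e₁ (a • x) : A) = e₀ a * e₁ x) ∧
      (∀ r : R, (e₁ (1 ⊗ₜ KaehlerDifferential.D ℤ R r) : A) = δ r) ∧
      ∀ i : ℕ, ∃ e : C ⊗[R] ⋀[R]^i Ω[R⁄ℤ] ≃+ H i,
        (∀ a x, (e (a • x) : A) = e₀ a * e x) ∧
        ∀ ω : Fin i → Ω[R⁄ℤ], (e (1 ⊗ₜ exteriorPower.ιMulti R i ω) : A) =
          (List.ofFn fun k => (e₁ (1 ⊗ₜ ω k) : A)).prod := by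
  let algC : Algebra C A := e₀.toAlgebra' hcomm
  let algR : Algebra R A := (e₀.comp (algebraMap R C)).toAlgebra' fun c x => hcomm _ x
  have tower : IsScalarTower R C A := IsScalarTower.of_algebraMap_eq fun _ => rfl
  obtain ⟨f, hf⟩ := exists_kaehler_lift δ hδ
  have hfb : ∀ i, f (kaehlerBasis d R i) = δ (coord R i) := fun i => by
    rw [kaehlerBasis_apply, hf]
  let E' : (Finset (Fin d) → C) ≃ₗ[C] A := { E with map_smul' := fun c x => (hmul c x).symm }
  let u : Module.Basis (Finset (Fin d)) C A := Module.Basis.ofEquivFun E'.symm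
  have hu : ∀ (n : ℕ) (s : Set.powersetCard (Fin d) n),
      u s = ((FormAlgebra.idx s).map fun i => f (kaehlerBasis d R i)).prod := fun n s => by
    simp only [hfb]
    rw [← hE, Module.Basis.coe_ofEquivFun]
    rfl
  have hH' : ∀ (n : ℕ) (x : A), x ∈ H n ↔
      ∀ I : Finset (Fin d), I.card ≠ n → u.repr x I = 0 := fun n x => by
    obtain ⟨c, rfl⟩ := E.surjective x
    have : ∀ I, u.repr (E c) I = c I := fun I => congrFun (E.symm_apply_apply c) I
    simp only [this]
    exact hH n c
  have main : ∀ n : ℕ, ∃ e : C ⊗[R] ⋀[R]^n Ω[R⁄ℤ] ≃+ H n,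
      (∀ a x, (e (a • x) : A) = e₀ a * e x) ∧
      ∀ ω : Fin n → Ω[R⁄ℤ], (e (1 ⊗ₜ exteriorPower.ιMulti R n ω) : A) =
        (List.ofFn fun k => f (ω k)).prod := fun n => by
    obtain ⟨e, hinj, hrange, he⟩ := exists_exteriorPower_map (kaehlerBasis d R) f
      (fun i => by rw [hfb, h0]) (fun i j => by rw [hfb, hfb, h1]) u n (hu n)
    have hmem : ∀ x, e x ∈ H n := fun x => (hH' n _).2 ((hrange _).1 ⟨x, rfl⟩)
    refine ⟨AddEquiv.ofBijective (e.toAddMonoidHom.codRestrict (H n) hmem)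
      ⟨fun x y h => hinj (congrArg Subtype.val h), fun y => ?_⟩, fun a x => map_smul e a x, he⟩
    obtain ⟨x, hx⟩ := (hrange _).2 ((hH' n _).1 y.2)
    exact ⟨x, Subtype.ext hx⟩
  obtain ⟨e, he, hprod⟩ := main 1
  let g : C ⊗[R] Ω[R⁄ℤ] ≃ₗ[C] C ⊗[R] ⋀[R]^1 Ω[R⁄ℤ] :=
    (exteriorPower.oneEquiv R Ω[R⁄ℤ]).symm.baseChange R C _ _
  have hg : ∀ ω, ((e (g (1 ⊗ₜ ω))) : A) = f ω := fun ω => by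
    have : g (1 ⊗ₜ ω) = 1 ⊗ₜ exteriorPower.ιMulti R 1 fun _ => ω := by
      refine congrArg (fun y => (1 : C) ⊗ₜ[R] y) ?_
      exact (LinearEquiv.symm_apply_eq _).2
        (exteriorPower.oneEquiv_ιMulti (fun _ => ω)).symm
    rw [this, hprod]
    simp
  refine ⟨g.toAddEquiv.trans e, fun a x => ?_, fun r => (hg _).trans (hf r), fun n => ?_⟩
  · exact (congrArg (fun y => (e y : A)) (map_smul g a x)).trans (he a _)
  · obtain ⟨e', he', hprod'⟩ := main n
    refine ⟨e', he', fun ω => (hprod' ω).trans ?_⟩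
    congr 2
    funext k
    exact (hg (ω k)).symm

end Exterior

/-! ### Products of the classes `Tᵢ ^ (p - 1) dTᵢ` -/

namespace QuotCyclo
open FormAlgebra TwistedDerivations
variable {p : ℕ} [hp : Fact p.Prime] {d : ℕ} {R : Type*} [CommRing R]
  [Algebra (MvPolynomial (Fin d) ℤ) R] [Algebra.Etale (MvPolynomial (Fin d) ℤ) R]

/-- The class of `Tᵢ ^ (p - 1) dTᵢ`. -/
noncomputable def cartierClass (p : ℕ) [hp : Fact p.Prime] (R : Type*) [CommRing R]
    [Algebra (MvPolynomial (Fin d) ℤ) R] [Algebra.Etale (MvPolynomial (Fin d) ℤ) R] (i : Fin d) :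
    (qDeRhamMod d R p).Cohomology :=
  (qDeRhamMod d R p).cls ((qDeRhamMod d R p).form (T p R i ^ (p - 1)) (dT i)) (D_form_T_pow i)

omit hp in
theorem form_T_pow_mul_form {i : Fin d} {c : QuotCyclo p R} (ω : FormAlgebra d)
    (hc : (qDeRhamMod d R p).γ i c = c) (n : ℕ) :
    (qDeRhamMod d R p).form (T p R i ^ n) (dT i) * (qDeRhamMod d R p).form c ω =
      (qDeRhamMod d R p).form (T p R i ^ n * c) (dT i * ω) := by
  rw [form_mul, leftMul_dT, mulDT_form, smul_form, hc]

set_option synthInstance.maxHeartbeats 200000 in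
theorem cartierClass_mul_self (i : Fin d) : cartierClass p R i * cartierClass p R i = 0 := by
  rw [cartierClass, ← cls_mul (h := by rw [D_mul, D_form_T_pow]; simp)]
  refine cls_eq_zero_iff.2 ⟨0, ?_⟩
  rw [map_zero, form_mul, leftMul_dT, mulDT_form, dT_mul_self, form_zero, smul_zero]

theorem cartierClass_anticomm (i j : Fin d) :
    cartierClass p R i * cartierClass p R j + cartierClass p R j * cartierClass p R i = 0 := by
  by_cases h : i = j
  · subst h; rw [cartierClass_mul_self, add_zero]
  rw [cartierClass, cartierClass, ← cls_mul (h := by rw [D_mul, D_form_T_pow, D_form_T_pow]; simp),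
    ← cls_mul (h := by rw [D_mul, D_form_T_pow, D_form_T_pow]; simp),
    ← cls_add (h := by rw [map_add, D_mul, D_mul, D_form_T_pow, D_form_T_pow]; simp)]
  refine cls_eq_zero_iff.2 ⟨0, ?_⟩
  rw [map_zero, form_T_pow_mul_form _ (by rw [map_pow, gamma_T_of_ne (Ne.symm h)]),
    form_T_pow_mul_form _ (by rw [map_pow, gamma_T_of_ne h]), mul_comm (T p R j ^ _), ← form_add,
    dT_anticomm, form_zero]

set_option synthInstance.maxHeartbeats 200000 in
/-- The product of the classes `Tᵢ ^ (p - 1) dTᵢ` involves no powers of `q`, because `γᵢ` fixes `Tⱼ` for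
`j ≠ i`. -/
theorem prod_cartierClass (l : List (Fin d)) (hl : l.Nodup) :
    ∃ h, (l.map (cartierClass p R)).prod = (qDeRhamMod d R p).cls ((qDeRhamMod d R p).form
      (l.map fun i => T p R i ^ (p - 1)).prod (l.map dT).prod) h := by
  induction l with
  | nil => exact ⟨D_one _, rfl⟩
  | cons i l ih =>
    obtain ⟨h, ih⟩ := ih (List.nodup_cons.1 hl).2
    have hc : (qDeRhamMod d R p).γ i (l.map fun i => T p R i ^ (p - 1)).prod =
        (l.map fun i => T p R i ^ (p - 1)).prod := by
      rw [map_list_prod, List.map_map]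
      congr 1
      refine List.map_congr_left fun j hj => ?_
      rw [Function.comp_apply, map_pow, gamma_T_of_ne]
      rintro rfl
      exact (List.nodup_cons.1 hl).1 hj
    have h' := form_T_pow_mul_form (l.map dT).prod hc (p - 1)
    have hD : (qDeRhamMod d R p).D ((qDeRhamMod d R p).form (T p R i ^ (p - 1)) (dT i) *
      (qDeRhamMod d R p).form (l.map fun i => T p R i ^ (p - 1)).prod (l.map dT).prod) = 0 := by
      rw [D_mul, D_form_T_pow, h]; simp
    refine ⟨(congrArg _ h').symm.trans hD, ?_⟩
    rw [List.map_cons, List.prod_cons, ih]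
    exact (cls_mul _ _ hD).symm.trans (cls_congr h' _ _)

set_option synthInstance.maxHeartbeats 200000 in
theorem cohomologyEquiv_single {F : QuotCyclo p R →+* QuotCyclo p R}
    (hF : IsTwistedFrobenius d F) {n : ℕ} (s : Set.powersetCard (Fin d) n) :
    cohomologyEquiv hF (Pi.single (s : Finset (Fin d)) 1) = ((idx s).map (cartierClass p R)).prod := by
  obtain ⟨h, hs⟩ := prod_cartierClass (p := p) (R := R) (idx s) (nodup_idx s)
  rw [hs]
  refine cls_congr ?_ _ _
  have hm : mono p R (topExp p (s : Finset (Fin d))) =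
      ((idx s).map fun i => T p R i ^ (p - 1)).prod := by
    rw [← List.prod_toFinset _ (nodup_idx s), mono, smallMonomial]
    have : (idx s).toFinset = (s : Finset (Fin d)) := by ext i; simp [mem_idx]
    rw [this, ← Finset.prod_subset (Finset.subset_univ (s : Finset (Fin d)))]
    · refine Finset.prod_congr rfl fun i hi => ?_
      simp [topExp, hi]
    · intro i _ hi
      simp [topExp, hi]
  rw [topForm_apply, Finset.sum_eq_single (s : Finset (Fin d)), Pi.single_eq_same, map_one, one_mul,
    hm, basis_eq_prod]
  · intro I _ hI
    rw [Pi.single_eq_of_ne hI, map_zero, zero_mul, zero_form]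
  · simp

end QuotCyclo

/-! ### The comparison with differential forms -/

namespace QuotCyclo
open FormAlgebra TwistedDerivations
variable {p : ℕ} [hp : Fact p.Prime] {d : ℕ} {R : Type*} [CommRing R]
  [Algebra (MvPolynomial (Fin d) ℤ) R] [Algebra.Etale (MvPolynomial (Fin d) ℤ) R]
  {F : QuotCyclo p R →+* QuotCyclo p R} (hF : IsTwistedFrobenius d F)

/-- The boundary kills `q`, as `q` is a constant for `∇_q`. -/
theorem boundary_const_qElt : boundary d p R (const hF (qElt p R)) = 0 := by
  have hg : ∀ i : Fin d, qderiv R i (1 + PowerSeries.X) =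
      algebraMap ℤ⟦X⟧ R⟦X⟧ (cyclo p) * (0 : Fin d → R⟦X⟧) i := fun i => by
    apply denom_cancel R (i := i)
    rw [qderiv_spec', map_add, map_one, algHom_X, Pi.zero_apply, mul_zero, mul_zero, sub_self]
  have hf : mk p R (1 + PowerSeries.X) = F (qElt p R) := by
    rw [qElt_eq, map_add, map_add, map_one, map_one, hF.map_x]
    rfl
  have h := (D_form_eq_smul_and_D_sum_form_eq_zero (cyclo_mem_nonZeroDivisors d R p) hg).2
  rw [boundary_const hF hf hg h]
  exact cls_eq_zero_iff.2 ⟨0, by simp [zero_form]⟩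

/-- The boundary map vanishes on `ℤ_p[ζ_p]`. -/
theorem boundary_const_zpZeta {ψ : ZpZeta p →+* QuotCyclo p R}
    (hψ : ψ (AdjoinRoot.root _) = qElt p R) (c : ZpZeta p) :
    boundary d p R (const hF (ψ c)) = 0 := by
  let e : ZpZeta p →+* (qDeRhamMod d R p).Cohomology := (const hF).comp ψ
  refine eq_zero_of_leibniz e ((boundary d p R).toAddMonoidHom.comp e.toAddMonoidHom)
    (fun a b => ?_) (fun m => cohomology_eq_zero_of_forall_pow hF) ?_ c
  · have := boundary_const_mul hF (ψ a) (ψ b)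
    rw [← map_mul ψ] at this
    exact this
  · have := boundary_const_qElt hF
    rw [← hψ] at this
    exact this

set_option synthInstance.maxHeartbeats 200000 in
/-- The derivation `r ↦ ∂(φ(r))` identifies the cohomology with the differential forms over a ring `C`
that is identified with `R[[q-1]]/Φ_p(q)`. -/
theorem exists_forms_equiv_cohomology {C : Type*} [CommRing C] [Algebra R C] (ι : C ≃+* QuotCyclo p R)
    (hι : ∀ r, ι (algebraMap R C r) = mk p R (PowerSeries.C r))
    (e₀ : C →+* (qDeRhamMod d R p).Cohomology) (he₀ : ∀ c, e₀ c = const hF (ι c)) :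
    ∃ e₁ : C ⊗[R] Ω[R⁄ℤ] ≃+ (qDeRhamMod d R p).H 1,
      (∀ a x, (e₁ (a • x) : (qDeRhamMod d R p).Cohomology) = e₀ a * e₁ x) ∧
      (∀ r : R, (e₁ (1 ⊗ₜ KaehlerDifferential.D ℤ R r) : (qDeRhamMod d R p).Cohomology) =
        boundary d p R (e₀ (algebraMap R C r))) ∧
      ∀ i : ℕ, ∃ e : C ⊗[R] ⋀[R]^i Ω[R⁄ℤ] ≃+ (qDeRhamMod d R p).H i,
        (∀ a x, (e (a • x) : (qDeRhamMod d R p).Cohomology) = e₀ a * e x) ∧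
        ∀ ω : Fin i → Ω[R⁄ℤ],
          (e (1 ⊗ₜ exteriorPower.ιMulti R i ω) : (qDeRhamMod d R p).Cohomology) =
            (List.ofFn fun k => (e₁ (1 ⊗ₜ ω k) : (qDeRhamMod d R p).Cohomology)).prod := by
  let δ : R →+ (qDeRhamMod d R p).Cohomology := (boundary d p R).toAddMonoidHom.comp
    (e₀.comp (algebraMap R C)).toAddMonoidHom
  have hδ_apply : ∀ r, δ r = boundary d p R (e₀ (algebraMap R C r)) := fun _ => rfl
  have hδ : ∀ a b, δ (a * b) = e₀ (algebraMap R C a) * δ b + e₀ (algebraMap R C b) * δ a := by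
    intro a b
    rw [hδ_apply, hδ_apply, hδ_apply, he₀, he₀, he₀, map_mul, map_mul ι]
    exact boundary_const_mul hF _ _
  have hδT : ∀ i : Fin d, δ (coord R i) = cartierClass p R i := by
    intro i
    rw [hδ_apply, he₀, hι]
    exact boundary_const_T hF i
  let E : (Finset (Fin d) → C) ≃+ (qDeRhamMod d R p).Cohomology :=
    (AddEquiv.piCongrRight fun _ => ι.toAddEquiv).trans (cohomologyEquiv hF)
  have hE_apply : ∀ c, E c = cohomologyEquiv hF fun I => ι (c I) := fun _ => rfl
  refine exists_forms_equiv (S := PowerSeries ℤ) (A := (qDeRhamMod d R p).Cohomology) e₀ ?_ δ hδ ?_ ?_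
    E ?_ ?_ (qDeRhamMod d R p).H ?_
  · intro c x
    rw [he₀]
    exact const_mul_comm hF (ι c) x
  · intro i
    rw [hδT]
    exact cartierClass_mul_self i
  · intro i j
    rw [hδT, hδT]
    exact cartierClass_anticomm i j
  · intro c x
    rw [hE_apply, hE_apply, he₀]
    refine (const_mul_cohomologyEquiv hF (ι c) fun I => ι (x I)).trans ?_
    simp only [map_mul]
  · intro n s
    simp only [hδT]
    rw [hE_apply]
    refine Eq.trans ?_ (cohomologyEquiv_single hF s)
    congr 1
    funext I
    by_cases h : I = s
    · rw [h, Pi.single_eq_same, Pi.single_eq_same, map_one]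
    · rw [Pi.single_eq_of_ne h, Pi.single_eq_of_ne h, map_zero]
  · intro n c
    rw [hE_apply, cohomologyEquiv_mem_H_iff]
    simp only [map_eq_zero_iff ι ι.injective]

end QuotCyclo
end QDeRham

open QDeRham
set_option maxHeartbeats 2000000 in
theorem proposition3p1 (p : ℕ) [Fact p.Prime] (d : ℕ) (R : Type*) [CommRing R]
    [Algebra (MvPolynomial (Fin d) ℤ) R] [Algebra.Etale (MvPolynomial (Fin d) ℤ) R] :
    -- the Frobenius lift `φ` of `R̂` and the identification `ι : R̂[ζ_p] = R[[q-1]]/Φ_p(q)`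
    ∃ (φ : PadicCompletion p R →+* PadicCompletion p R) (ι : PadicCyclo p R ≃ₐ[R] QuotCyclo p R),
      IsFrobeniusLift p d φ ∧ (∀ φ', IsFrobeniusLift p d φ' → φ' = φ) ∧
      ι (AdjoinRoot.root _) = qElt p R ∧
      (∀ ι' : PadicCyclo p R ≃ₐ[R] QuotCyclo p R, ι' (AdjoinRoot.root _) = qElt p R → ι' = ι) ∧
    -- (i) `φ` has image in the kernel of `∇_q` and induces an isomorphism `e₀` onto `H⁰`
    ∃ e₀ : PadicCyclo p R →+* (qDeRhamMod d R p).Cohomology,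
      (∀ a, ∃ h : (qDeRhamMod d R p).D ((qDeRhamMod d R p).form (ι (cycloMap p φ a)) 1) = 0,
        e₀ a = (qDeRhamMod d R p).cls _ h) ∧
      Function.Injective e₀ ∧ Set.range e₀ = ((qDeRhamMod d R p).H 0 : Set _) ∧
    -- (ii) the boundary map is a continuous `ℤ_p[ζ_p]`-linear derivation from `H⁰` to `H¹`
      (∀ x ∈ (qDeRhamMod d R p).H 0, boundary d p R x ∈ (qDeRhamMod d R p).H 1) ∧
      @Continuous _ _ (padicTopology p (PadicCyclo p R))
        (padicTopology p (qDeRhamMod d R p).Cohomology) (fun a => boundary d p R (e₀ a)) ∧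
      (∀ a b, boundary d p R (e₀ (a * b)) =
        e₀ a * boundary d p R (e₀ b) + e₀ b * boundary d p R (e₀ a)) ∧
      (∀ (c : ZpZeta p) (a : PadicCyclo p R),
        boundary d p R (e₀ (cycloMap p (padicIntToCompletion p R) c * a)) =
          e₀ (cycloMap p (padicIntToCompletion p R) c) * boundary d p R (e₀ a)) ∧
    -- and the induced linear map is an isomorphism `e₁` onto `H¹`
      ∃ e₁ : PadicCyclo p R ⊗[R] Ω[R⁄ℤ] ≃+ (qDeRhamMod d R p).H 1,
        (∀ a x, (e₁ (a • x) : (qDeRhamMod d R p).Cohomology) = e₀ a * e₁ x) ∧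
        (∀ r : R, (e₁ (1 ⊗ₜ KaehlerDifferential.D ℤ R r) : (qDeRhamMod d R p).Cohomology) =
          boundary d p R (e₀ (algebraMap R _ r))) ∧
    -- (iii) cup products of classes in `H¹` induce isomorphisms in every degree
        ∀ i : ℕ, ∃ e : PadicCyclo p R ⊗[R] ⋀[R]^i Ω[R⁄ℤ] ≃+ (qDeRhamMod d R p).H i,
          (∀ a x, (e (a • x) : (qDeRhamMod d R p).Cohomology) = e₀ a * e x) ∧
          ∀ ω : Fin i → Ω[R⁄ℤ],
            (e (1 ⊗ₜ exteriorPower.ιMulti R i ω) : (qDeRhamMod d R p).Cohomology) =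
              (List.ofFn fun k => (e₁ (1 ⊗ₜ ω k) : (qDeRhamMod d R p).Cohomology)).prod := by
  obtain ⟨φ, hφ⟩ := exists_isFrobeniusLift p d R
  have hex := exists_padicCyclo_equiv (p := p) (R := R) d
  obtain ⟨ι, hι⟩ := hex
  have hF := QuotCyclo.isTwistedFrobenius hφ ι hι
  obtain ⟨e₀, he₀⟩ : ∃ e₀ : PadicCyclo p R →+* (qDeRhamMod d R p).Cohomology,
      ∀ a, e₀ a = QuotCyclo.const hF (ι a) :=
    ⟨(QuotCyclo.const hF).comp (ι : PadicCyclo p R →+* QuotCyclo p R), fun _ => rfl⟩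
  have he₀' : ⇑e₀ = QuotCyclo.const hF ∘ ι := funext he₀
  have hmul : ∀ a b, boundary d p R (e₀ (a * b)) =
      e₀ a * boundary d p R (e₀ b) + e₀ b * boundary d p R (e₀ a) := fun a b => by
    rw [he₀, he₀, he₀, map_mul ι]
    exact QuotCyclo.boundary_const_mul hF (ι a) (ι b)
  refine ⟨φ, ι, hφ, fun φ' h' => hφ.unique h', hι, fun ι' hι' => ?_, e₀, fun a => ?_, ?_, ?_, ?_,
    ?_, hmul, fun c a => ?_, ?_⟩
  · have : (ι' : PadicCyclo p R →ₐ[R] QuotCyclo p R) = ι :=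
      padicCyclo_hom_ext d hι' hι
    exact AlgEquiv.ext fun a => AlgHom.congr_fun this a
  · have hb : ι (cycloMap p φ a) = ((ι : PadicCyclo p R →+* QuotCyclo p R).comp
        ((cycloMap p φ).comp (ι.symm : QuotCyclo p R →+* PadicCyclo p R))) (ι a) :=
      congrArg (fun b => ι (cycloMap p φ b)) (ι.symm_apply_apply a).symm
    rw [hb]
    exact ⟨QuotCyclo.D_form_map hF (ι a), he₀ a⟩
  · rw [he₀']
    exact (QuotCyclo.const_injective hF).comp ι.injective
  · rw [← QuotCyclo.range_const hF, he₀']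
    exact ι.surjective.range_comp (QuotCyclo.const hF)
  · intro x hx
    rw [← SetLike.mem_coe, ← QuotCyclo.range_const hF] at hx
    obtain ⟨b, rfl⟩ := hx
    exact QuotCyclo.boundary_const_mem hF b
  · exact continuous_padicTopology p ((boundary d p R).toAddMonoidHom.comp e₀.toAddMonoidHom)
  · let ψ : ZpZeta p →+* QuotCyclo p R := (ι : PadicCyclo p R →+* QuotCyclo p R).comp
      (cycloMap p (padicIntToCompletion p R))
    have hψ : ψ (AdjoinRoot.root _) = qElt p R := by
      change ι (cycloMap p (padicIntToCompletion p R) (AdjoinRoot.root _)) = _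
      rw [cycloMap_root, hι]
    rw [hmul, he₀ (cycloMap p (padicIntToCompletion p R) c)]
    have h0 := QuotCyclo.boundary_const_zpZeta hF hψ c
    change boundary d p R (QuotCyclo.const hF
      (ι (cycloMap p (padicIntToCompletion p R) c))) = 0 at h0
    rw [h0, mul_zero, add_zero]
  · have hι' : ∀ r, ι.toRingEquiv (algebraMap R (PadicCyclo p R) r) =
        QuotCyclo.mk p R (PowerSeries.C r) := fun r => by
      rw [← algebraMap_quotCyclo]
      exact ι.commutes r
    have key := QuotCyclo.exists_forms_equiv_cohomology hF ι.toRingEquiv hι' e₀ he₀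
    exact key
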